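/- **Theorem (Learning decision tree distributions).** Write a distribution over $\{\pm1\}^n$ as *depth-$d$ representable* if its probability mass function (pmf) is computed by a decision tree of depth at most $d$ (internal nodes query coordinates, leaves are labelled by numbers), and call it *monotone* if $x\le y$ coordinatewise implies $\mathcal D(x)\le\mathcal D(y)$. Algorithms are while-programs for a unit-cost register machine (registers hold cons-cell trees with natural numbers as atoms; the operations are forming and splitting a cons cell, addition and truncated subtraction of numbers, and testing for the number 0; drawing a sample costs $n+1$ units of time), which is polynomially equivalent to Turing machines. Let $d_{\mathrm{TV}}(\mathcal D,\mathcal D')=\frac12\sum_x|\mathcal D(x)-\mathcal D'(x)|$. There is a program $A$ that accesses an unknown distribution $\mathcal D$ only through independent random samples, a program $A'$ that accesses it through samples and subcube-conditional samples (the program specifies a subcube of $\{\pm1\}^n$ of positive probability and receives a fresh draw from $\mathcal D$ conditioned on that subcube), and a constant $C$ for each of them, such that the following holds for all integers $n,d\ge0$ and all real $\varepsilon,\delta\in(0,1]$. Given $n$, $d$, $\lceil1/\varepsilon\rceil$ and $\lceil\log_2(1/\delta)\rceil$, and access to a depth-$d$ representable distribution $\mathcal D$ over $\{\pm1\}^n$,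 which for $A$ is moreover monotone, the program always halts with running time and number of samples at most $$C\,(n+1)^{C}\cdot\Big(\frac d\varepsilon\Big)^{C d}\cdot\big(1+\log(1/\delta)\big)$$ (where $(0/\varepsilon)^0=1$), and with probability at least $1-\delta$ over the draw of the samples it outputs a decision tree of depth at most $d$, with rational leaf labels and querying no coordinate twice on a path, that computes the pmf of a distribution $\mathcal D'$ with $d_{\mathrm{TV}}(\mathcal D,\mathcal D')\le\varepsilon$. -/

import Mathlib

namespace DTLearn

/-! ### Decision trees and decision tree distributions

The point `x : Fin n → Bool` stands for a point of `{±1}ⁿ`: `false` is `-1` and `true` is `+1`. -/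

/-- Decision trees over `n` Boolean coordinates with leaves labelled in `α`.
In `node i l r` the branch `l` is followed if `xᵢ = -1` and `r` if `xᵢ = +1`. -/
inductive DecisionTree (n : ℕ) (α : Type) : Type
  | leaf (a : α) : DecisionTree n α
  | node (i : Fin n) (l r : DecisionTree n α) : DecisionTree n α

namespace DecisionTree

variable {n : ℕ} {α : Type}

/-- The label of the leaf reached by `x`. -/
def eval : DecisionTree n α → (Fin n → Bool) → α
  | leaf a, _ => a
  | node i l r, x => if x i then r.eval x else l.eval x

/-- The largest number of queries on a root-to-leaf path. -/
def depth : DecisionTree n α → ℕ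
  | leaf _ => 0
  | node _ l r => max l.depth r.depth + 1

/-- The coordinates queried somewhere in the tree. -/
def vars : DecisionTree n α → Set (Fin n)
  | leaf _ => ∅
  | node i l r => {i} ∪ l.vars ∪ r.vars

/-- No coordinate is queried twice on a root-to-leaf path
(so that a leaf `ℓ` is reached by exactly `2 ^ (n - |ℓ|)` points). -/
def ReadOnce : DecisionTree n α → Prop
  | leaf _ => True
  | node i l r => i ∉ l.vars ∧ i ∉ r.vars ∧ l.ReadOnce ∧ r.ReadOnce

end DecisionTree

/-- The pmf of `D` is computed by a decision tree of depth (at most) `d`. -/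
def RepresentableByDepth {n : ℕ} (D : PMF (Fin n → Bool)) (d : ℕ) : Prop :=
  ∃ T : DecisionTree n ℝ, T.depth ≤ d ∧ ∀ x, (D x).toReal = T.eval x

/-- The pmf of `D` is monotone for the coordinatewise order of the cube. -/
def IsMonotone {n : ℕ} (D : PMF (Fin n → Bool)) : Prop :=
  ∀ x y : Fin n → Bool, (∀ i, x i ≤ y i) → D x ≤ D y

/-- Total variation distance. -/
noncomputable def tvDist {n : ℕ} (D E : PMF (Fin n → Bool)) : ℝ :=
  (1 / 2) * ∑ x, |(D x).toReal - (E x).toReal|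

/-! ### The machine

Registers hold S-expressions: trees of cons cells whose atoms are natural numbers. The empty list is
the atom `0`. Every instruction takes one unit of time, except that drawing a sample, which is a
list of length `n`, takes `n + 1` units. The arithmetic is addition and truncated subtraction only,
so that a number gains at most one bit per unit of time, and this unit-cost model simulates, and is
simulated by, Turing machines with polynomial overhead. -/

/-- S-expressions over the natural numbers. -/
inductive Val : Type
  | num (k : ℕ) : Val
  | pair (a b : Val) : Val

namespace Val

/-- First component (`0` for an atom). -/
def fst : Val → Val
  | num _ => num 0
  | pair a _ => a

/-- Second component (`0` for an atom). -/
def snd : Val → Val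
  | num _ => num 0
  | pair _ b => b

/-- The number in an atom (`0` for a pair). -/
def toNat : Val → ℕ
  | num k => k
  | pair _ _ => 0

/-- The entry with index `i` of a list. -/
def nth (v : Val) : ℕ → Val
  | 0 => v.fst
  | i + 1 => v.snd.nth i

/-- A point of the cube as the list of its `n` bits; `-1` is written `0` and `+1` is written `1`. -/
def ofPoint {n : ℕ} (x : Fin n → Bool) : Val :=
  (List.ofFn x).foldr (fun b v => pair (num (if b then 1 else 0)) v) (num 0)

/-- The subcube that a list describes: the entry `0` fixes the coordinate to `-1`, the entry `1`
fixes it to `+1`, and any other entry leaves it free. -/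
def subcube (n : ℕ) (v : Val) : Set (Fin n → Bool) :=
  {x | ∀ i : Fin n, (v.nth i = num 0 → x i = false) ∧ (v.nth i = num 1 → x i = true)}

/-- How a decision tree with rational labels is written. The label `(a, b)` is the fraction `a / b`,
which need not be in lowest terms. -/
def ofTree {n : ℕ} : DecisionTree n (ℕ × ℕ+) → Val
  | .leaf (a, b) => pair (num 0) (pair (num a) (num b))
  | .node i l r => pair (num (i + 1)) (pair (ofTree l) (ofTree r))

end Val

/-- Programs. Registers are named by natural numbers; `x` is always the register written to.
A test `ifNZ y` or `whileNZ y` asks whether register `y` holds something other than the atom `0`. -/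
inductive Prog : Type
  | const (x : ℕ) (k : ℕ) : Prog
  | copy (x y : ℕ) : Prog
  | add (x y z : ℕ) : Prog
  | sub (x y z : ℕ) : Prog
  | pair (x y z : ℕ) : Prog
  | fst (x y : ℕ) : Prog
  | snd (x y : ℕ) : Prog
  | seq (p q : Prog) : Prog
  | ifNZ (y : ℕ) (p q : Prog) : Prog
  | whileNZ (y : ℕ) (p : Prog) : Prog
  /-- draw a random sample into register `x` -/
  | sample (x : ℕ) : Prog
  /-- draw a sample conditioned on the subcube described in register `y` into register `x` -/
  | condSample (x y : ℕ) : Prog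

/-- The program contains no conditional sampling instruction: its only access to the unknown
distribution is by random samples. -/
def Prog.SamplesOnly : Prog → Prop
  | .seq p q => p.SamplesOnly ∧ q.SamplesOnly
  | .ifNZ _ p q => p.SamplesOnly ∧ q.SamplesOnly
  | .whileNZ _ p => p.SamplesOnly
  | .condSample _ _ => False
  | _ => True

/-- A configuration: the programs still to be executed, in this order, the registers, the time spent
and the number of (plain or conditional) samples drawn so far. -/
structure Config : Type where
  todo : List Prog
  regs : ℕ → Val
  time : ℕ
  samples : ℕ

namespace Config

/-- A configuration with nothing left to do. -/
def Halted (c : Config) : Prop := c.todo = []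

/-- Continue with `k`, after one unit of time. -/
def goto (c : Config) (k : List Prog) : Config :=
  { c with todo := k, time := c.time + 1 }

/-- Write `v` to register `x` and continue with `k`, after one unit of time. -/
def write (c : Config) (k : List Prog) (x : ℕ) (v : Val) : Config :=
  { c with todo := k, regs := Function.update c.regs x v, time := c.time + 1 }

/-- Write the drawn sample `s` to register `x` and continue with `k`. -/
def receive {n : ℕ} (c : Config) (k : List Prog) (x : ℕ) (s : Fin n → Bool) : Config :=
  { todo := k, regs := Function.update c.regs x (Val.ofPoint s),
    time := c.time + (n + 1), samples := c.samples + 1 }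

end Config

open Classical in
/-- One step of the machine with access to the distribution `D`. Conditioning on a subcube of
probability zero is not a legal instruction: the machine is then stuck and never halts. -/
noncomputable def step {n : ℕ} (D : PMF (Fin n → Bool)) (c : Config) : PMF Config :=
  match c.todo with
  | [] => PMF.pure c
  | .const x k :: t => PMF.pure (c.write t x (.num k))
  | .copy x y :: t => PMF.pure (c.write t x (c.regs y))
  | .add x y z :: t => PMF.pure (c.write t x (.num ((c.regs y).toNat + (c.regs z).toNat)))
  | .sub x y z :: t => PMF.pure (c.write t x (.num ((c.regs y).toNat - (c.regs z).toNat)))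
  | .pair x y z :: t => PMF.pure (c.write t x (.pair (c.regs y) (c.regs z)))
  | .fst x y :: t => PMF.pure (c.write t x (c.regs y).fst)
  | .snd x y :: t => PMF.pure (c.write t x (c.regs y).snd)
  | .seq p q :: t => PMF.pure (c.goto (p :: q :: t))
  | .ifNZ y p q :: t => PMF.pure (c.goto (if c.regs y = .num 0 then q :: t else p :: t))
  | .whileNZ y p :: t =>
      PMF.pure (c.goto (if c.regs y = .num 0 then t else p :: .whileNZ y p :: t))
  | .sample x :: t => D.map (c.receive t x)
  | .condSample x y :: t =>
      if h : ∃ s ∈ (c.regs y).subcube n, s ∈ D.support then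
        (D.filter ((c.regs y).subcube n) h).map (c.receive t x)
      else PMF.pure c

/-- The distribution of the configuration after `t` steps. -/
noncomputable def run {n : ℕ} (D : PMF (Fin n → Bool)) : ℕ → Config → PMF Config
  | 0, c => PMF.pure c
  | t + 1, c => (step D c).bind (run D t)

/-- The start of program `P` on the numerical inputs `a₀, a₁, a₂, a₃`, given in registers
`0, 1, 2, 3`. All other registers hold the atom `0`. -/
def Config.start (P : Prog) (a₀ a₁ a₂ a₃ : ℕ) : Config where
  todo := [P]
  regs := fun j => .num (if j = 0 then a₀ else if j = 1 then a₁ else if j = 2 then a₂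
    else if j = 3 then a₃ else 0)
  time := 0
  samples := 0

/-- The content `v` of the output register is a decision tree of depth at most `d` that computes
the pmf of a distribution within total variation distance `ε` of `D`. -/
def GoodOutput {n : ℕ} (D : PMF (Fin n → Bool)) (d : ℕ) (ε : ℝ) (v : Val) : Prop :=
  ∃ T : DecisionTree n (ℕ × ℕ+), v = Val.ofTree T ∧ T.depth ≤ d ∧ T.ReadOnce ∧
    ∃ D' : PMF (Fin n → Bool),
      (∀ x, (D' x).toReal = ((T.eval x).1 : ℝ) / ((T.eval x).2 : ℕ)) ∧ tvDist D D' ≤ ε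

/-- Program `P`, started on `n`, `d`, `⌈1/ε⌉` and `⌈log₂(1/δ)⌉` with access to `D`, always halts
within time `B` and after at most `B` samples, and with probability at least `1 - δ` leaves a good
output in register `0`. -/
def Learns {n : ℕ} (P : Prog) (D : PMF (Fin n → Bool)) (d : ℕ) (ε δ B : ℝ) : Prop :=
  ∃ t : ℕ,
    let final : PMF Config := run D t (Config.start P n d ⌈1 / ε⌉₊ ⌈Real.logb 2 (1 / δ)⌉₊)
    (∀ c ∈ final.support, c.Halted ∧ (c.time : ℝ) ≤ B ∧ (c.samples : ℝ) ≤ B) ∧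
    ENNReal.ofReal (1 - δ) ≤ final.toOuterMeasure {c | GoodOutput D d ε (c.regs 0)}

end DTLearn

/-!
A pmf `g` computed by a decision tree `S` of depth `d` is learned by looking for a tree of depth `d`
that minimizes the total influence at its leaves.

*Why small influence suffices.* By the `L¹` Poincaré inequality (`sum_abs_sub_avg_le`), the distance
of `g` from its average over a subcube is at most the sum of the influences
`½ ∑ₓ |g x - g (flip i x)|` of the free coordinates. A tree whose leaves are labelled by the averages
is therefore within the total influence at its leaves. For `S` itself this is zero.

*How influences are estimated.* If `g` is monotone, the influence of `i` in a subcube is the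
expectation of the `i`-th coordinate (`±1`) of a random point, restricted to the subcube. In general,
for a random point `x`, a second point is drawn from the edge `{x, flip i x}`, and whether it is equal
to `x` has a bias of expectation `½ ∑ₓ (p - q)² / (p + q)`, where `p = g x` and `q = g (flip i x)`.
By the Cauchy–Schwarz inequality, this is as good as the influence at a quadratic loss, which
does not involve `n`, because `g` has at most `d` sensitive directions at every point. Both cases are
covered by `EdgeWeight`. Polynomially many records give accurate estimates for all `3ⁿ` subcubes
simultaneously (`Mean.prob_exists_deviation_le`, `prob_deviation_le`).

*Why the search is fast.* A coordinate is tried at a node of the search only if its estimated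
influence is a substantial fraction of the mass of the subcube. As the total influence is at most `d`
times the mass, there are `poly(d / ε)` such candidates (`Accurate.mem_cands`), so that the search
tree has `(d / ε) ^ O(d)` nodes. The restriction to candidates does little harm: if `S` queries a
coordinate of small influence, the node may be replaced by one of its subtrees at the expense of this
influence (`Accurate.best_le`). The resulting error is bounded in `Accurate.sum_abs_label_le`.

*How the algorithm becomes a program.* `Computes` is a calculus of deterministic subroutines with
running times. The recursion of the search is unfolded into a list of instructions for a stack
machine (`exec_unfolded`), and `Computes.search` is the resulting program. The drawing of the records
is treated by the predicate `Wp`, a weakest precondition with bounds for time, number of samples and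
probability of success, and `exists_learner` combines everything.
-/

namespace DTLearn

open Finset

/-! ### Subcubes, influences and the `L¹` Poincaré inequality -/

section Subcubes

variable {n : ℕ}

/-- The point `x` with coordinate `i` negated. -/
def flip (i : Fin n) (x : Fin n → Bool) : Fin n → Bool := Function.update x i (!x i)

@[simp] lemma flip_flip (i : Fin n) (x : Fin n → Bool) : flip i (flip i x) = x := by
  simp [flip]

@[simp] lemma flip_same (i : Fin n) (x : Fin n → Bool) : flip i x i = !x i := by
  simp [flip]

lemma flip_ne {i j : Fin n} (h : j ≠ i) (x : Fin n → Bool) : flip i x j = x j := by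
  simp [flip, h]

/-- The points of the subcube given by a partial assignment `ρ`; `ρ i = none` means that
coordinate `i` is free. -/
def points (ρ : Fin n → Option Bool) : Finset (Fin n → Bool) :=
  univ.filter fun x => ∀ i, ρ i = none ∨ ρ i = some (x i)

/-- The free coordinates of a partial assignment. -/
def free (ρ : Fin n → Option Bool) : Finset (Fin n) := univ.filter fun i => ρ i = none

/-- The partial assignment `ρ` with coordinate `i` fixed to `b`. -/
def fix (ρ : Fin n → Option Bool) (i : Fin n) (b : Bool) : Fin n → Option Bool :=
  Function.update ρ i (some b)

lemma mem_points {ρ : Fin n → Option Bool} {x : Fin n → Bool} :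
    x ∈ points ρ ↔ ∀ i, ρ i = none ∨ ρ i = some (x i) := by simp [points]

lemma mem_free {ρ : Fin n → Option Bool} {i : Fin n} : i ∈ free ρ ↔ ρ i = none := by simp [free]

lemma flip_mem_points {ρ : Fin n → Option Bool} {i : Fin n} (hi : i ∈ free ρ)
    (x : Fin n → Bool) : flip i x ∈ points ρ ↔ x ∈ points ρ := by
  rw [mem_free] at hi
  simp only [mem_points]
  refine forall_congr' fun j => ?_
  by_cases h : j = i
  · subst h; simp [hi]
  · rw [flip_ne h]

lemma sum_flip {ρ : Fin n → Option Bool} {i : Fin n} (hi : i ∈ free ρ)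
    (F : (Fin n → Bool) → ℝ) : ∑ x ∈ points ρ, F (flip i x) = ∑ x ∈ points ρ, F x :=
  Finset.sum_nbij' (flip i) (flip i) (fun x hx => (flip_mem_points hi x).2 hx)
    (fun x hx => (flip_mem_points hi x).2 hx) (by simp) (by simp) (by simp)

lemma points_fix {ρ : Fin n → Option Bool} {i : Fin n} (hi : i ∈ free ρ) (b : Bool) :
    points (fix ρ i b) = (points ρ).filter fun x => x i = b := by
  rw [mem_free] at hi
  ext x
  simp only [mem_points, mem_filter, fix]
  constructor
  · intro h
    refine ⟨fun j => ?_, ?_⟩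
    · by_cases hj : j = i
      · subst hj; exact Or.inl hi
      · have := h j; rwa [Function.update_of_ne hj] at this
    · have := h i; simp at this; exact this.symm
  · rintro ⟨h, hb⟩ j
    by_cases hj : j = i
    · subst hj; simp [hb]
    · rw [Function.update_of_ne hj]; exact h j

lemma sum_split {ρ : Fin n → Option Bool} {i : Fin n} (hi : i ∈ free ρ)
    (F : (Fin n → Bool) → ℝ) :
    ∑ x ∈ points ρ, F x
      = ∑ x ∈ points (fix ρ i false), F x + ∑ x ∈ points (fix ρ i true), F x := by
  rw [points_fix hi, points_fix hi, ← Finset.sum_filter_add_sum_filter_not _ (fun x => x i = false)]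
  simp

lemma free_fix {ρ : Fin n → Option Bool} (i : Fin n) (b : Bool) :
    free (fix ρ i b) = (free ρ).erase i := by
  ext j
  by_cases hj : j = i
  · subst hj; simp [mem_free, fix]
  · simp [mem_free, fix, hj]

lemma sum_fix_not {ρ : Fin n → Option Bool} {i : Fin n} (hi : i ∈ free ρ) (b : Bool)
    (F : (Fin n → Bool) → ℝ) :
    ∑ x ∈ points (fix ρ i (!b)), F x = ∑ x ∈ points (fix ρ i b), F (flip i x) := by
  rw [points_fix hi, points_fix hi]
  refine Finset.sum_nbij' (flip i) (flip i) ?_ ?_ (by simp) (by simp) (by simp) <;>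
  · intro x hx
    rw [mem_filter] at hx ⊢
    exact ⟨(flip_mem_points hi x).2 hx.1, by simp [hx.2]⟩

lemma sum_fix_true {ρ : Fin n → Option Bool} {i : Fin n} (hi : i ∈ free ρ)
    (F : (Fin n → Bool) → ℝ) :
    ∑ x ∈ points (fix ρ i true), F x = ∑ x ∈ points (fix ρ i false), F (flip i x) :=
  sum_fix_not hi false F

lemma sum_split' {ρ : Fin n → Option Bool} {i : Fin n} (hi : i ∈ free ρ) (b : Bool)
    (F : (Fin n → Bool) → ℝ) :
    ∑ x ∈ points ρ, F x
      = ∑ x ∈ points (fix ρ i b), F x + ∑ x ∈ points (fix ρ i b), F (flip i x) := by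
  rw [sum_split hi, ← sum_fix_not hi]
  cases b
  · rfl
  · exact add_comm _ _

/-- The sum of `g` over a subcube. -/
def mass (g : (Fin n → Bool) → ℝ) (ρ : Fin n → Option Bool) : ℝ := ∑ x ∈ points ρ, g x

/-- The (unnormalized `L¹`) influence of coordinate `i` on `g` within a subcube. Each edge in
direction `i` is met from both of its ends, which the factor `1 / 2` compensates. -/
noncomputable def infl (g : (Fin n → Bool) → ℝ) (i : Fin n) (ρ : Fin n → Option Bool) : ℝ :=
  ∑ x ∈ points ρ, |g x - g (flip i x)| / 2

/-- `L¹` Poincaré inequality: the distance of `g` from its average over a subcube is at most the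
total influence there. The two halves of the subcube are treated by induction, and the difference of their
averages is at most the influence of the coordinate that separates them. -/
lemma sum_abs_sub_avg_le (g : (Fin n → Bool) → ℝ) (ρ : Fin n → Option Bool) :
    #(points ρ) = 2 ^ #(free ρ) ∧
    ∑ x ∈ points ρ, |g x - mass g ρ / 2 ^ #(free ρ)| ≤ ∑ i ∈ free ρ, infl g i ρ := by
  induction hf : #(free ρ) generalizing ρ with
  | zero =>
    rw [Finset.card_eq_zero] at hf
    have hsome : ∀ i, ∃ b, ρ i = some b := fun i => by
      rw [← Option.ne_none_iff_exists', Ne, ← mem_free, hf]; simp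
    choose y hy using hsome
    have hp : points ρ = {y} := by
      ext x
      simp [mem_points, hy, funext_iff, eq_comm]
    simp [mass, hp, hf]
  | succ k ih =>
    obtain ⟨i, hi⟩ : (free ρ).Nonempty := by
      rw [← Finset.card_pos]; omega
    have hk : ∀ b, #(free (fix ρ i b)) = k := fun b => by
      rw [free_fix, Finset.card_erase_of_mem hi]; omega
    obtain ⟨hc0, h0⟩ := ih (fix ρ i false) (hk _)
    obtain ⟨hc1, h1⟩ := ih (fix ρ i true) (hk _)
    have hm : mass g ρ = mass g (fix ρ i false) + mass g (fix ρ i true) := sum_split hi g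
    set a0 := mass g (fix ρ i false) with ha0
    set a1 := mass g (fix ρ i true) with ha1
    have hpow : (0 : ℝ) < 2 ^ k := by positivity
    have hcard : #(points ρ) = 2 ^ (k + 1) := by
      have := sum_split hi (fun _ => (1 : ℝ))
      simp only [sum_const, nsmul_eq_mul, mul_one, hc0, hc1] at this
      have h2 : ((#(points ρ) : ℕ) : ℝ) = ((2 ^ (k + 1) : ℕ) : ℝ) := by
        rw [this]; push_cast; ring
      exact_mod_cast h2
    refine ⟨hcard, ?_⟩
    -- the two halves, each with its own average, and the distance between the averages
    have key : ∀ b : ℝ, ∀ σ : Fin n → Option Bool, #(points σ) = 2 ^ k →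
        ∑ x ∈ points σ, |g x - mass g ρ / 2 ^ (k + 1)|
          ≤ ∑ x ∈ points σ, |g x - b / 2 ^ k| + |b - mass g ρ / 2| := by
      intro b σ hσ
      have hpt : ∀ x ∈ points σ, |g x - mass g ρ / 2 ^ (k + 1)|
          ≤ |g x - b / 2 ^ k| + |b - mass g ρ / 2| / 2 ^ k := by
        intro x _
        have e : g x - mass g ρ / 2 ^ (k + 1)
            = (g x - b / 2 ^ k) + (b - mass g ρ / 2) / 2 ^ k := by
          rw [pow_succ]; field_simp; ring
        rw [e]
        refine (abs_add_le _ _).trans ?_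
        rw [abs_div, abs_of_pos hpow]
      refine (Finset.sum_le_sum hpt).trans (le_of_eq ?_)
      rw [Finset.sum_add_distrib, Finset.sum_const, hσ, nsmul_eq_mul]
      push_cast
      rw [mul_div_cancel₀ _ hpow.ne']
    have hdiff : |a0 - mass g ρ / 2| + |a1 - mass g ρ / 2| ≤ infl g i ρ := by
      have e0 : a0 - mass g ρ / 2 = (a0 - a1) / 2 := by rw [hm]; ring
      have e1 : a1 - mass g ρ / 2 = -((a0 - a1) / 2) := by rw [hm]; ring
      rw [e0, e1, abs_neg, abs_div, abs_two, add_halves]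
      have e2 : a0 - a1 = ∑ x ∈ points (fix ρ i false), (g x - g (flip i x)) := by
        rw [Finset.sum_sub_distrib, ← sum_fix_true hi]; rfl
      rw [e2, infl, sum_split hi, sum_fix_true hi, ← Finset.sum_add_distrib]
      refine (Finset.abs_sum_le_sum_abs _ _).trans (Finset.sum_le_sum fun x _ => ?_)
      rw [flip_flip, abs_sub_comm (g (flip i x)), add_halves]
    have hsplit : ∑ j ∈ free ρ, infl g j ρ = infl g i ρ
        + (∑ j ∈ (free ρ).erase i, infl g j (fix ρ i false)
          + ∑ j ∈ (free ρ).erase i, infl g j (fix ρ i true)) := by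
      rw [← Finset.add_sum_erase _ _ hi, ← Finset.sum_add_distrib]
      exact congrArg _ (Finset.sum_congr rfl fun j _ => sum_split hi _)
    rw [sum_split hi, hsplit]
    rw [free_fix] at h0 h1
    have k0 := key a0 _ hc0
    have k1 := key a1 _ hc1
    linarith

end Subcubes

/-! ### Sensitivity of decision trees -/

namespace DecisionTree

variable {n : ℕ} {α : Type}

/-- The tree with all queries to coordinate `i` answered by `b`. -/
def restrict (i : Fin n) (b : Bool) : DecisionTree n α → DecisionTree n α
  | leaf a => leaf a
  | node j l r => if j = i then (if b then r.restrict i b else l.restrict i b)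
      else node j (l.restrict i b) (r.restrict i b)

lemma depth_restrict (i : Fin n) (b : Bool) (T : DecisionTree n α) :
    (T.restrict i b).depth ≤ T.depth := by
  induction T with
  | leaf a => exact le_rfl
  | node j l r hl hr =>
    unfold restrict
    split_ifs <;> simp only [depth] <;> omega

lemma eval_restrict (i : Fin n) (b : Bool) (T : DecisionTree n α) (x : Fin n → Bool) :
    (T.restrict i b).eval x = T.eval (Function.update x i b) := by
  induction T with
  | leaf a => rfl
  | node j l r hl hr =>
    unfold restrict
    by_cases hj : j = i
    · subst hj
      cases b <;> simp [eval, hl, hr]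
    · simp [hj, eval, hl, hr]

/-- At every point at most `depth` many coordinates are sensitive. -/
lemma card_sensitive_le [DecidableEq α] (T : DecisionTree n α) (x : Fin n → Bool) :
    #{i | T.eval (DTLearn.flip i x) ≠ T.eval x} ≤ T.depth := by
  induction T with
  | leaf a => simp [eval]
  | node j l r hl hr =>
    have hsub : ∀ S : DecisionTree n α, #{i | S.eval (DTLearn.flip i x) ≠ S.eval x} ≤ S.depth →
        (∀ i, i ≠ j → (node j l r).eval (DTLearn.flip i x) = S.eval (DTLearn.flip i x)) →
        (node j l r).eval x = S.eval x →
        #{i | (node j l r).eval (DTLearn.flip i x) ≠ (node j l r).eval x} ≤ S.depth + 1 := by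
      intro S hS h1 h2
      refine (Finset.card_le_card
        (t := insert j (univ.filter fun i => S.eval (DTLearn.flip i x) ≠ S.eval x))
        fun i hi => ?_).trans ((Finset.card_insert_le _ _).trans (by omega))
      rw [Finset.mem_filter, h2] at hi
      by_cases hij : i = j
      · simp [hij]
      · rw [h1 i hij] at hi; simp [hi.2]
    cases hx : x j with
    | false =>
      refine (hsub l hl (fun i hi => ?_) (by simp [eval, hx])).trans (by simp [depth])
      simp [eval, flip_ne (Ne.symm hi), hx]
    | true =>
      refine (hsub r hr (fun i hi => ?_) (by simp [eval, hx])).trans (by simp [depth])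
      simp [eval, flip_ne (Ne.symm hi), hx]

end DecisionTree

/-- The coordinates sensitive for `g` at `x`. -/
noncomputable def sens {n : ℕ} (g : (Fin n → Bool) → ℝ) (x : Fin n → Bool) : Finset (Fin n) :=
  {i | g (flip i x) ≠ g x}

lemma mem_sens {n : ℕ} {g : (Fin n → Bool) → ℝ} {x : Fin n → Bool} {i : Fin n} :
    i ∈ sens g x ↔ g (flip i x) ≠ g x := by simp [sens]

lemma mem_sens_flip {n : ℕ} {g : (Fin n → Bool) → ℝ} {x : Fin n → Bool} {i : Fin n} :
    i ∈ sens g (flip i x) ↔ i ∈ sens g x := by simp [mem_sens, ne_comm]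

/-- Summing a nonnegative function of the endpoints over the sensitive edges inside a subcube counts
every point at most `d` times, `d` being a bound on the sensitivity. -/
lemma sum_edges_le {n d : ℕ} {g : (Fin n → Bool) → ℝ} (hg : ∀ x, #(sens g x) ≤ d)
    (F : (Fin n → Bool) → ℝ) (hF : ∀ x, 0 ≤ F x) (ρ : Fin n → Option Bool) :
    ∑ i ∈ free ρ, ∑ x ∈ points ρ, (if i ∈ sens g x then (F x + F (flip i x)) / 2 else 0)
      ≤ d * ∑ x ∈ points ρ, F x := by
  have h1 : ∀ i ∈ free ρ,
      ∑ x ∈ points ρ, (if i ∈ sens g x then (F x + F (flip i x)) / 2 else 0)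
        = ∑ x ∈ points ρ, (if i ∈ sens g x then F x else 0) := by
    intro i hi
    have h2 : ∑ x ∈ points ρ, (if i ∈ sens g x then F (flip i x) else 0)
        = ∑ x ∈ points ρ, (if i ∈ sens g x then F x else 0) := by
      rw [← sum_flip hi (fun x => if i ∈ sens g x then F x else 0)]
      simp only [mem_sens_flip]
    have h3 : ∑ x ∈ points ρ, (if i ∈ sens g x then (F x + F (flip i x)) / 2 else 0)
        = (∑ x ∈ points ρ, (if i ∈ sens g x then F x else 0)
          + ∑ x ∈ points ρ, (if i ∈ sens g x then F (flip i x) else 0)) / 2 := by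
      rw [← Finset.sum_add_distrib, Finset.sum_div]
      refine Finset.sum_congr rfl fun x _ => ?_
      split_ifs <;> simp
    rw [h3, h2, add_self_div_two]
  rw [Finset.sum_congr rfl h1, Finset.sum_comm, Finset.mul_sum]
  refine Finset.sum_le_sum fun x _ => ?_
  rw [← Finset.sum_filter, Finset.sum_const, nsmul_eq_mul]
  refine mul_le_mul_of_nonneg_right ?_ (hF x)
  exact_mod_cast (Finset.card_le_card fun i hi => (Finset.mem_filter.1 hi).2).trans (hg x)

/-- The total influence is at most `d` times the `L¹` distance to any constant. -/
lemma sum_infl_le {n d : ℕ} {g : (Fin n → Bool) → ℝ} (hg : ∀ x, #(sens g x) ≤ d) (c : ℝ)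
    (ρ : Fin n → Option Bool) :
    ∑ i ∈ free ρ, infl g i ρ ≤ d * ∑ x ∈ points ρ, |g x - c| := by
  refine le_trans (Finset.sum_le_sum fun i _ => Finset.sum_le_sum fun x _ => ?_)
    (sum_edges_le hg (fun x => |g x - c|) (fun _ => abs_nonneg _) ρ)
  split_ifs with h
  · rw [abs_sub_comm (g (flip i x)) c]
    gcongr
    exact abs_sub_le _ _ _
  · rw [mem_sens, not_not] at h
    simp [h]

/-! ### Expectations and concentration of sample averages -/

/-- A normalized positive linear functional, the expectation of a random element of `α`. -/
structure Mean (α : Type) where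
  E : (α → ℝ) → ℝ
  add : ∀ f g, E (fun a => f a + g a) = E f + E g
  smul : ∀ (c : ℝ) f, E (fun a => c * f a) = c * E f
  mono : ∀ f g, (∀ a, f a ≤ g a) → E f ≤ E g
  one : E (fun _ => 1) = 1

namespace Mean

variable {α β : Type}

lemma const (M : Mean α) (c : ℝ) : M.E (fun _ => c) = c := by
  have := M.smul c (fun _ => 1)
  simpa [M.one] using this

lemma finset_sum (M : Mean α) {κ : Type} (s : Finset κ) (f : κ → α → ℝ) :
    M.E (fun a => ∑ k ∈ s, f k a) = ∑ k ∈ s, M.E (f k) := by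
  classical
  induction s using Finset.induction_on with
  | empty => simpa using M.const 0
  | insert k s hk ih => simp only [Finset.sum_insert hk, M.add, ih]

/-- The point mass. -/
def pure (a : α) : Mean α where
  E f := f a
  add _ _ := rfl
  smul _ _ := rfl
  mono _ _ h := h a
  one := rfl

/-- Averages over a finite type with respect to nonnegative weights of total `1`. -/
def ofWeights [Fintype α] (p : α → ℝ) (h0 : ∀ a, 0 ≤ p a) (h1 : ∑ a, p a = 1) : Mean α where
  E f := ∑ a, p a * f a
  add f g := by simp [mul_add, Finset.sum_add_distrib]
  smul c f := by rw [Finset.mul_sum]; exact Finset.sum_congr rfl fun a _ => by ring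
  mono f g h := Finset.sum_le_sum fun a _ => mul_le_mul_of_nonneg_left (h a) (h0 a)
  one := by simpa using h1

/-- Two-stage experiments. -/
def bind (M : Mean α) (N : α → Mean β) : Mean β where
  E f := M.E fun a => (N a).E f
  add f g := by simp only [Mean.add]
  smul c f := by simp only [Mean.smul]
  mono f g h := M.mono _ _ fun a => (N a).mono _ _ h
  one := by simp only [Mean.one]

/-- The result of prepending successive draws to a list; the first entry of the argument is the
distribution of the first draw. -/
def draws : List (Mean α) → List α → Mean (List α)
  | [], l => pure l
  | M :: Ms, l => M.bind fun a => draws Ms (a :: l)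

lemma draws_sum_exp (M : Mean α) (h : α → ℝ) (m : ℕ) (l : List α) :
    (draws (List.replicate m M) l).E (fun l' => Real.exp (l'.map h).sum)
      = M.E (fun a => Real.exp (h a)) ^ m * Real.exp (l.map h).sum := by
  induction m generalizing l with
  | zero => simp [draws, pure]
  | succ m ih =>
    rw [List.replicate_succ]
    change M.E (fun a => (draws (List.replicate m M) (a :: l)).E _) = _
    simp only [ih, List.map_cons, List.sum_cons, Real.exp_add]
    have : (fun a => M.E (fun a => Real.exp (h a)) ^ m
        * (Real.exp (h a) * Real.exp (l.map h).sum))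
        = fun a => (M.E (fun a => Real.exp (h a)) ^ m * Real.exp (l.map h).sum)
          * Real.exp (h a) := by
      funext a; ring
    rw [this, M.smul]; ring

open Classical in
/-- Probability of an event. -/
noncomputable def prob (M : Mean α) (s : α → Prop) : ℝ := M.E fun a => if s a then 1 else 0

lemma prob_mono (M : Mean α) {s t : α → Prop} (h : ∀ a, s a → t a) : M.prob s ≤ M.prob t := by
  refine M.mono _ _ fun a => ?_
  by_cases hs : s a
  · simp [hs, h a hs]
  · simp only [hs, if_false]; positivity

lemma prob_exists_le (M : Mean α) {κ : Type} [Fintype κ] (s : κ → α → Prop) {b : ℝ}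
    (h : ∀ k, M.prob (s k) ≤ b) : M.prob (fun a => ∃ k, s k a) ≤ Fintype.card κ * b := by
  classical
  have h1 : M.prob (fun a => ∃ k, s k a)
      ≤ M.E (fun a => ∑ k, if s k a then (1 : ℝ) else 0) := by
    refine M.mono _ _ fun a => ?_
    split_ifs with hk
    · obtain ⟨k, hk⟩ := hk
      refine le_trans (by simp [hk]) (Finset.single_le_sum
        (f := fun k => if s k a then (1 : ℝ) else 0) (fun k _ => by positivity) (Finset.mem_univ k))
    · exact Finset.sum_nonneg fun k _ => by positivity
  refine h1.trans ?_
  rw [finset_sum]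
  refine (Finset.sum_le_card_nsmul _ _ b fun k _ => ?_).trans (by simp)
  refine le_trans (le_of_eq ?_) (h k)
  unfold prob
  congr! 3

lemma prob_not (M : Mean α) (s : α → Prop) : M.prob (fun a => ¬ s a) = 1 - M.prob s := by
  classical
  have h := M.add (fun a => if ¬ s a then 1 else 0) (fun a => if s a then 1 else 0)
  have h2 : (fun a => (if ¬ s a then (1 : ℝ) else 0) + (if s a then 1 else 0)) = fun _ => 1 := by
    funext a; by_cases hs : s a <;> simp [hs]
  rw [h2, M.one] at h
  have e : ∀ t : α → Prop, ∀ _ : DecidablePred t,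
      M.E (fun a => if t a then 1 else 0) = M.prob t := fun t _ => by unfold prob; congr! 3
  rw [e, e] at h
  linarith

/-- One-sided Chernoff bound for a statistic with values in `[-1, 1]`. -/
lemma prob_sum_gt_le (M : Mean α) (h : α → ℝ) (hh : ∀ a, |h a| ≤ 1) (m : ℕ) {c : ℝ}
    (hc0 : 0 ≤ c) (hc : c ≤ 1) :
    (draws (List.replicate m M) []).prob
        (fun l => m * M.E h + m * c < (l.map h).sum) ≤ Real.exp (-(m * c ^ 2 / 16)) := by
  classical
  set μ := M.E h with hμ
  have hμ1 : |μ| ≤ 1 := by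
    rw [abs_le]
    constructor
    · simpa [M.const] using M.mono (fun _ => -1) h fun a => (abs_le.1 (hh a)).1
    · simpa [M.const] using M.mono h (fun _ => 1) fun a => (abs_le.1 (hh a)).2
  have hmgf : M.E (fun a => Real.exp (c / 8 * (h a - μ))) ≤ Real.exp (c ^ 2 / 16) := by
    have hpt : ∀ a, Real.exp (c / 8 * (h a - μ))
        ≤ (c / 8) * h a + (1 - c / 8 * μ + c ^ 2 / 16) := by
      intro a
      have hy : |c / 8 * (h a - μ)| ≤ 1 := by
        rw [abs_mul, abs_of_nonneg (by positivity)]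
        have : |h a - μ| ≤ 2 := (abs_sub _ _).trans (by linarith [hh a])
        nlinarith [abs_nonneg (h a - μ)]
      have h1 := Real.abs_exp_sub_one_sub_id_le hy
      have h2 : (c / 8 * (h a - μ)) ^ 2 ≤ c ^ 2 / 16 := by
        have : (h a - μ) ^ 2 ≤ 2 ^ 2 := by
          rw [sq_le_sq, abs_two]; exact (abs_sub _ _).trans (by linarith [hh a])
        rw [mul_pow]; nlinarith [sq_nonneg c]
      have := (abs_le.1 h1).2
      linarith
    refine (M.mono _ _ hpt).trans ?_
    rw [M.add, M.smul, M.const, ← hμ]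
    have := Real.add_one_le_exp (c ^ 2 / 16)
    linarith
  have hmarkov : ∀ l : List α, (if m * μ + m * c < (l.map h).sum ∧ l.length = m then (1 : ℝ) else 0)
      ≤ Real.exp (-(c / 8 * (m * c)))
        * Real.exp (l.map (fun a => c / 8 * (h a - μ))).sum := by
    intro l
    split_ifs with hl
    · rw [← Real.exp_add]
      refine Real.one_le_exp ?_
      have e : (l.map (fun a => c / 8 * (h a - μ))).sum
          = c / 8 * ((l.map h).sum - l.length * μ) := by
        clear hl
        induction l with
        | nil => simp
        | cons a l ih =>
          simp only [List.map_cons, List.sum_cons, ih, List.length_cons]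
          push_cast; ring
      rw [e, hl.2]
      nlinarith [hl.1]
    · positivity
  have hlen : ∀ (m : ℕ) (l₀ : List α) (f g : List α → ℝ),
      (∀ l, l.length = m + l₀.length → f l ≤ g l) →
      (draws (List.replicate m M) l₀).E f ≤ (draws (List.replicate m M) l₀).E g := by
    intro m
    induction m with
    | zero => intro l₀ f g hfg; exact hfg l₀ (by simp)
    | succ m ih =>
      intro l₀ f g hfg
      refine M.mono _ _ fun a => ih (a :: l₀) f g fun l hl => hfg l ?_
      rw [hl, List.length_cons]; omega
  have h1 := hlen m [] (fun l => if m * μ + m * c < (l.map h).sum then (1 : ℝ) else 0)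
    (fun l => Real.exp (-(c / 8 * (m * c))) * Real.exp (l.map (fun a => c / 8 * (h a - μ))).sum)
    (fun l hl => by simpa [show l.length = m by simpa using hl] using hmarkov l)
  rw [Mean.smul, draws_sum_exp] at h1
  refine le_trans (le_of_eq ?_) (h1.trans ?_)
  · unfold prob; congr! 2
  · have h0 : 0 ≤ M.E (fun a => Real.exp (c / 8 * (h a - μ))) := by
      simpa [M.const] using M.mono (fun _ => 0) _ fun a => (Real.exp_pos (c / 8 * (h a - μ))).le
    calc _ ≤ Real.exp (-(c / 8 * (m * c))) * Real.exp (c ^ 2 / 16) ^ m := by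
          simp only [List.map_nil, List.sum_nil, Real.exp_zero, mul_one]
          gcongr
      _ = _ := by
          rw [← Real.exp_nat_mul, ← Real.exp_add]; congr 1; ring

/-- Two-sided Chernoff bound, simultaneously for a finite family of statistics. -/
lemma prob_exists_deviation_le (M : Mean α) {κ : Type} [Fintype κ] (h : κ → α → ℝ)
    (hh : ∀ k a, |h k a| ≤ 1) (m : ℕ) {c : ℝ} (hc0 : 0 ≤ c) (hc : c ≤ 1) :
    (draws (List.replicate m M) []).prob
        (fun l => ∃ k, m * c < |(l.map (h k)).sum - m * M.E (h k)|)
      ≤ 2 * Fintype.card κ * Real.exp (-(m * c ^ 2 / 16)) := by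
  have h1 := (draws (List.replicate m M) []).prob_exists_le
    (fun (k : κ × Bool) l => m * M.E (fun a => (if k.2 then 1 else -1) * h k.1 a) + m * c
      < (l.map (fun a => (if k.2 then 1 else -1) * h k.1 a)).sum)
    (fun k => M.prob_sum_gt_le _ (fun a => by
      rw [abs_mul]; split_ifs <;> simpa using hh _ _) m hc0 hc)
  refine (prob_mono _ ?_).trans (h1.trans (le_of_eq ?_))
  · rintro l ⟨k, hk⟩
    rcases lt_abs.1 hk with hk | hk
    · refine ⟨(k, true), ?_⟩
      simp only [if_true, one_mul]
      linarith
    · refine ⟨(k, false), ?_⟩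
      simp only [Bool.false_eq_true, if_false]
      rw [M.smul, List.sum_map_mul_left]
      linarith
  · simp only [Fintype.card_prod, Fintype.card_bool]; push_cast; ring

end Mean

/-! ### The search procedure -/

/-- A record consists of a sample `x` and of a list `w` whose `i`-th bit estimates the influence of
coordinate `i`: the bit `true` counts `+1` and the bit `false` counts `-1`. -/
abbrev Record : Type := List Bool × List Bool

/-- A node of the search: the records that lie in the subcube of the node, and the list of the
coordinates that are free there. -/
abbrev State : Type := List Record × List ℕ

/-- The numerical parameters of the search: the number `m` of records, the cap `K` on the number of
candidates at a node, and the constants `A` and `G` of the candidate test. -/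
structure Params : Type where
  m : ℕ
  A : ℕ
  K : ℕ
  G : ℕ

/-- The positive part of the sum of the signs for coordinate `i`, an estimate of `m` times the
influence of coordinate `i`. -/
def score (i : ℕ) (data : List Record) : ℕ :=
  2 * data.countP (fun r => r.2.getD i false) - data.length

/-- The estimated total influence at a node. -/
def leafScore (s : State) : ℕ := (s.2.map fun i => score i s.1).sum

/-- The nodes of the search in which coordinate `i` is fixed to `b`. -/
def branch (b : Bool) (i : ℕ) (s : State) : State :=
  ((s.1.filter fun r => r.1.getD i false = b).reverse, (s.2.filter (· ≠ i)).reverse)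

/-- The candidates: the free coordinates whose influence is estimated to be a substantial fraction
of the mass of the subcube. The cap `K` bounds the running time whatever the samples are. -/
def cands (P : Params) (s : State) : List ℕ :=
  ((s.2.filter fun i => s.1.length + P.G < P.A * score i s.1).take P.K).reverse

/-- Output and score of a leaf. -/
def leafVal (P : Params) (s : State) : ℕ × Val :=
  (leafScore s, .pair (.num 0) (.pair (.num s.1.length) (.num (P.m * 2 ^ s.2.length))))

/-- The better of `b` and of the tree which queries `i` and continues with `v₀` or `v₁`. -/
def comb (i : ℕ) (b v₀ v₁ : ℕ × Val) : ℕ × Val :=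
  if v₀.1 + v₁.1 < b.1 then (v₀.1 + v₁.1, .pair (.num (i + 1)) (.pair v₀.2 v₁.2)) else b

/-- The tree of depth at most `k` with the smallest estimated total influence at its leaves, among
those which query candidates only. -/
def best (P : Params) : ℕ → State → ℕ × Val
  | 0, s => leafVal P s
  | k + 1, s => (cands P s).foldl
      (fun b i => comb i b (best P k (branch false i s)) (best P k (branch true i s))) (leafVal P s)

lemma comb_le (i : ℕ) (b v₀ v₁ : ℕ × Val) : (comb i b v₀ v₁).1 ≤ b.1 := by
  unfold comb
  split_ifs with h
  · exact h.le
  · exact le_rfl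

lemma comb_le_add (i : ℕ) (b v₀ v₁ : ℕ × Val) : (comb i b v₀ v₁).1 ≤ v₀.1 + v₁.1 := by
  unfold comb
  split_ifs with h
  · exact le_rfl
  · exact not_lt.1 h

lemma foldl_comb_le (v₀ v₁ : ℕ → ℕ × Val) (l : List ℕ) (b : ℕ × Val) :
    (l.foldl (fun b i => comb i b (v₀ i) (v₁ i)) b).1 ≤ b.1 := by
  induction l generalizing b with
  | nil => exact le_rfl
  | cons i l ih => exact (ih _).trans (comb_le _ _ _ _)

lemma foldl_comb_le_add (v₀ v₁ : ℕ → ℕ × Val) (l : List ℕ) (b : ℕ × Val) {i : ℕ} (hi : i ∈ l) :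
    (l.foldl (fun b i => comb i b (v₀ i) (v₁ i)) b).1 ≤ (v₀ i).1 + (v₁ i).1 := by
  induction l generalizing b with
  | nil => simp at hi
  | cons j l ih =>
    rcases List.mem_cons.1 hi with rfl | h
    · exact (foldl_comb_le v₀ v₁ l _).trans (comb_le_add _ _ _ _)
    · exact ih _ h

lemma best_le_leafScore (P : Params) (k : ℕ) (s : State) : (best P k s).1 ≤ leafScore s := by
  cases k with
  | zero => exact le_rfl
  | succ k =>
    exact foldl_comb_le (fun i => best P k (branch false i s))
      (fun i => best P k (branch true i s)) _ (leafVal P s)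

lemma best_succ_le_of_mem (P : Params) (k : ℕ) (s : State) {i : ℕ} (hi : i ∈ cands P s) :
    (best P (k + 1) s).1 ≤ (best P k (branch false i s)).1 + (best P k (branch true i s)).1 :=
  foldl_comb_le_add (fun i => best P k (branch false i s)) (fun i => best P k (branch true i s)) _
    (leafVal P s) hi

/-! ### What the search computes -/

section Search

variable {n : ℕ}

/-- The list `l` of bits lies in the subcube given by `ρ`. -/
def Matches (ρ : Fin n → Option Bool) (l : List Bool) : Prop :=
  ∀ i : Fin n, ρ i = none ∨ ρ i = some (l.getD i false)

instance (ρ : Fin n → Option Bool) : DecidablePred (Matches ρ) :=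
  fun l => inferInstanceAs (Decidable (∀ i : Fin n, ρ i = none ∨ ρ i = some (l.getD i false)))

lemma matches_fix {ρ : Fin n → Option Bool} {i : Fin n} (hi : i ∈ free ρ) (b : Bool)
    (l : List Bool) : Matches (fix ρ i b) l ↔ Matches ρ l ∧ l.getD i false = b := by
  rw [mem_free] at hi
  constructor
  · intro h
    refine ⟨fun j => ?_, ?_⟩
    · by_cases hj : j = i
      · subst hj; exact Or.inl hi
      · have := h j; rwa [fix, Function.update_of_ne hj] at this
    · have := h i
      rw [fix, Function.update_self] at this
      simpa [eq_comm] using this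
  · rintro ⟨h, hb⟩ j
    by_cases hj : j = i
    · subst hj; right; rw [fix, Function.update_self, hb]
    · rw [fix, Function.update_of_ne hj]; exact h j

lemma matches_ofFn (ρ : Fin n → Option Bool) (x : Fin n → Bool) :
    Matches ρ (List.ofFn x) ↔ x ∈ points ρ := by
  simp [Matches, mem_points]

/-- The records in a subcube. -/
def inside (data : List Record) (ρ : Fin n → Option Bool) : List Record :=
  data.filter fun r => Matches ρ r.1

/-- The node `s` of the search belongs to the subcube given by `ρ`. -/
structure Represents (data : List Record) (ρ : Fin n → Option Bool) (s : State) : Prop where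
  perm : s.1.Perm (inside data ρ)
  nodup : s.2.Nodup
  mem : ∀ j, j ∈ s.2 ↔ ∃ i ∈ free ρ, (i : ℕ) = j

lemma Represents.branch {data : List Record} {ρ : Fin n → Option Bool} {s : State}
    (hs : Represents data ρ s) {i : Fin n} (hi : i ∈ free ρ) (b : Bool) :
    Represents data (fix ρ i b) (branch b i s) where
  perm := by
    refine (List.reverse_perm _).trans ((hs.perm.filter _).trans (List.Perm.of_eq ?_))
    rw [inside, inside, List.filter_filter]
    refine List.filter_congr fun r _ => ?_
    simp only [matches_fix hi, ← Bool.decide_and, and_comm]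
  nodup := List.nodup_reverse.2 (hs.nodup.filter _)
  mem j := by
    simp only [DTLearn.branch, List.mem_reverse, List.mem_filter, hs.mem, free_fix, mem_erase]
    constructor
    · rintro ⟨⟨k, hk, rfl⟩, hne⟩
      exact ⟨k, ⟨fun h => by simp [h] at hne, hk⟩, rfl⟩
    · rintro ⟨k, ⟨hne, hk⟩, rfl⟩
      exact ⟨⟨k, hk, rfl⟩, by simpa [Fin.val_inj] using hne⟩

lemma Represents.length_free {data : List Record} {ρ : Fin n → Option Bool} {s : State}
    (hs : Represents data ρ s) : s.2.length = #(free ρ) := by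
  rw [← List.toFinset_card_of_nodup hs.nodup,
    ← Finset.card_map (s := free ρ) Fin.valEmbedding]
  congr 1
  ext j
  simp [hs.mem]

lemma score_perm {l l' : List Record} (h : l.Perm l') (i : ℕ) : score i l = score i l' := by
  rw [score, score, h.countP_eq, h.length_eq]

lemma Represents.sum_free {data : List Record} {ρ : Fin n → Option Bool} {s : State}
    (hs : Represents data ρ s) (F : ℕ → ℕ) : (s.2.map F).sum = ∑ i ∈ free ρ, F i := by
  rw [← List.sum_toFinset F hs.nodup]
  have : s.2.toFinset = (free ρ).map Fin.valEmbedding := by ext j; simp [hs.mem]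
  rw [this, Finset.sum_map]; rfl

/-- Sum of a function of subcubes over the leaves of a tree, started in the subcube given by `ρ`. -/
def leafSum {α : Type} (Φ : (Fin n → Option Bool) → ℝ) :
    (Fin n → Option Bool) → DecisionTree n α → ℝ
  | ρ, .leaf _ => Φ ρ
  | ρ, .node i l r => leafSum Φ (fix ρ i false) l + leafSum Φ (fix ρ i true) r

/-- All coordinates queried are free, and the leaf reached in the subcube of `ρ` is labelled by the
fraction of records in this subcube, divided by the number of its points. -/
def Fitted (P : Params) (data : List Record) :
    (Fin n → Option Bool) → DecisionTree n (ℕ × ℕ+) → Prop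
  | ρ, .leaf a => a.1 = (inside data ρ).length ∧ (a.2 : ℕ) = P.m * 2 ^ #(free ρ)
  | ρ, .node i l r => i ∈ free ρ ∧ Fitted P data (fix ρ i false) l ∧ Fitted P data (fix ρ i true) r

lemma Fitted.vars_subset {P : Params} {data : List Record} {ρ : Fin n → Option Bool}
    {T : DecisionTree n (ℕ × ℕ+)} (hT : Fitted P data ρ T) : T.vars ⊆ ↑(free ρ) := by
  induction T generalizing ρ with
  | leaf a => simp [DecisionTree.vars]
  | node i l r hl hr =>
    obtain ⟨hi, h0, h1⟩ := hT
    simp only [DecisionTree.vars, Set.union_subset_iff, Set.singleton_subset_iff]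
    refine ⟨⟨hi, (hl h0).trans ?_⟩, (hr h1).trans ?_⟩ <;>
    · rw [free_fix]; exact_mod_cast Finset.erase_subset _ _

lemma Fitted.readOnce {P : Params} {data : List Record} {ρ : Fin n → Option Bool}
    {T : DecisionTree n (ℕ × ℕ+)} (hT : Fitted P data ρ T) : T.ReadOnce := by
  induction T generalizing ρ with
  | leaf a => trivial
  | node i l r hl hr =>
    obtain ⟨hi, h0, h1⟩ := hT
    refine ⟨fun h => ?_, fun h => ?_, hl h0, hr h1⟩
    · have := h0.vars_subset h; simp [free_fix] at this
    · have := h1.vars_subset h; simp [free_fix] at this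

lemma exists_tree_leafVal {P : Params} (hP : 0 < P.m) (data : List Record)
    {ρ : Fin n → Option Bool} {s : State} (hs : Represents data ρ s) :
    ∃ T : DecisionTree n (ℕ × ℕ+), (leafVal P s).2 = Val.ofTree T ∧ T.depth ≤ 0 ∧
      Fitted P data ρ T ∧ ((leafVal P s).1 : ℝ)
        = leafSum (fun σ => ∑ i ∈ free σ, (score i (inside data σ) : ℝ)) ρ T := by
  refine ⟨.leaf (s.1.length, ⟨P.m * 2 ^ s.2.length, by positivity⟩), rfl, le_rfl,
    ⟨hs.perm.length_eq, by simp [hs.length_free]⟩, ?_⟩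
  simp only [leafVal, leafScore, leafSum, hs.sum_free]
  push_cast
  exact Finset.sum_congr rfl fun i _ => by rw [score_perm hs.perm]

lemma exists_tree_best {P : Params} (hP : 0 < P.m) (data : List Record) (k : ℕ)
    {ρ : Fin n → Option Bool} {s : State} (hs : Represents data ρ s) :
    ∃ T : DecisionTree n (ℕ × ℕ+), (best P k s).2 = Val.ofTree T ∧ T.depth ≤ k ∧
      Fitted P data ρ T ∧ ((best P k s).1 : ℝ)
        = leafSum (fun σ => ∑ i ∈ free σ, (score i (inside data σ) : ℝ)) ρ T := by
  induction k generalizing ρ s with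
  | zero => exact exists_tree_leafVal hP data hs
  | succ k ih =>
    have hstart : ∃ T : DecisionTree n (ℕ × ℕ+), (leafVal P s).2 = Val.ofTree T ∧
        T.depth ≤ k + 1 ∧ Fitted P data ρ T ∧ ((leafVal P s).1 : ℝ)
          = leafSum (fun σ => ∑ i ∈ free σ, (score i (inside data σ) : ℝ)) ρ T := by
      obtain ⟨T₀, h₀⟩ := exists_tree_leafVal hP data hs
      exact ⟨T₀, h₀.1, h₀.2.1.trans (Nat.zero_le _), h₀.2.2⟩
    have hfree : ∀ j ∈ cands P s, j ∈ s.2 := fun j hj => by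
      rw [cands, List.mem_reverse] at hj
      exact (List.mem_filter.1 (List.mem_of_mem_take hj)).1
    rw [best]
    generalize leafVal P s = b at hstart ⊢
    generalize cands P s = l at hfree ⊢
    induction l generalizing b with
    | nil => exact hstart
    | cons j l ihl =>
      refine ihl _ ?_ (fun j' hj' => hfree j' (List.mem_cons_of_mem _ hj'))
      beta_reduce
      unfold comb
      split_ifs with hc
      · obtain ⟨i, hi, rfl⟩ := (hs.mem j).1 (hfree j List.mem_cons_self)
        obtain ⟨L, hL1, hL2, hL3, hL4⟩ := ih (hs.branch hi false)
        obtain ⟨R, hR1, hR2, hR3, hR4⟩ := ih (hs.branch hi true)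
        refine ⟨.node i L R, ?_, ?_, ⟨hi, hL3, hR3⟩, ?_⟩
        · simp [Val.ofTree, hL1, hR1]
        · simp only [DecisionTree.depth]; omega
        · simp only [leafSum, Nat.cast_add, hL4, hR4]
      · exact hstart

end Search

/-! ### Accurate samples lead to a good tree -/

section Accuracy

variable {n : ℕ}

/-- The average that the bits `w` of the records estimate: `h i x` replaces the `L¹` influence
`|g x - g (flip i x)| / 2`, bounds it from below, and bounds it from above in the sense of the
Cauchy–Schwarz inequality. -/
structure EdgeWeight (g : (Fin n → Bool) → ℝ) (h : Fin n → (Fin n → Bool) → ℝ) : Prop where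
  nonneg : ∀ i x, 0 ≤ h i x
  le : ∀ i x, h i x ≤ |g x - g (flip i x)| / 2
  sq_le : ∀ i x, (g x - g (flip i x)) ^ 2 ≤ 2 * h i x * (g x + g (flip i x))

/-- The total weight of coordinate `i` in a subcube. -/
def weight (h : Fin n → (Fin n → Bool) → ℝ) (i : Fin n) (ρ : Fin n → Option Bool) : ℝ :=
  ∑ x ∈ points ρ, h i x

variable {g : (Fin n → Bool) → ℝ} {h : Fin n → (Fin n → Bool) → ℝ}

lemma EdgeWeight.abs_le (hw : EdgeWeight g h) (hg : ∀ x, 0 ≤ g x) {t : ℝ} (ht : 0 < t)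
    (i : Fin n) (x : Fin n → Bool) :
    |g x - g (flip i x)| / 2 ≤ t * ((g x + g (flip i x)) / 2) / 2 + h i x / t / 2 := by
  have h0 : 0 ≤ t * ((g x + g (flip i x)) / 2) := by
    have := hg x; have := hg (flip i x); positivity
  have h1 : 0 ≤ h i x / t := div_nonneg (hw.nonneg i x) ht.le
  have h2 : (t * ((g x + g (flip i x)) / 2)) * (h i x / t)
      = h i x * (g x + g (flip i x)) / 2 := by field_simp
  have h3 : |g x - g (flip i x)| ≤ t * ((g x + g (flip i x)) / 2) + h i x / t := by
    refine abs_le_of_sq_le_sq ?_ (by positivity)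
    nlinarith [hw.sq_le i x, sq_nonneg (t * ((g x + g (flip i x)) / 2) - h i x / t)]
  linarith

lemma EdgeWeight.infl_le (hw : EdgeWeight g h) (hg : ∀ x, 0 ≤ g x) {t : ℝ} (ht : 0 < t)
    {i : Fin n} {ρ : Fin n → Option Bool} (hi : i ∈ free ρ) :
    infl g i ρ ≤ t * mass g ρ / 2 + weight h i ρ / t / 2 := by
  refine (Finset.sum_le_sum fun x _ => hw.abs_le hg ht i x).trans (le_of_eq ?_)
  rw [Finset.sum_add_distrib, ← Finset.sum_div, ← Finset.mul_sum, ← Finset.sum_div,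
    Finset.sum_add_distrib, sum_flip hi, ← Finset.sum_div, ← Finset.sum_div, add_self_div_two]
  rfl

lemma EdgeWeight.weight_le (hw : EdgeWeight g h) (i : Fin n) (ρ : Fin n → Option Bool) :
    weight h i ρ ≤ infl g i ρ := Finset.sum_le_sum fun x _ => hw.le i x

lemma mass_nonneg (hg : ∀ x, 0 ≤ g x) (ρ : Fin n → Option Bool) : 0 ≤ mass g ρ :=
  Finset.sum_nonneg fun x _ => hg x

lemma sum_infl_le_mass {d : ℕ} (hg : ∀ x, 0 ≤ g x) (hs : ∀ x, #(sens g x) ≤ d)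
    (ρ : Fin n → Option Bool) : ∑ i ∈ free ρ, infl g i ρ ≤ d * mass g ρ := by
  have := sum_infl_le hs 0 ρ
  simp only [sub_zero, abs_of_nonneg (hg _)] at this
  exact this

/-- Total influence against total weight, without a dependence on `n`: at each point only the
sensitive coordinates contribute. -/
lemma EdgeWeight.sum_infl_le (hw : EdgeWeight g h) {d : ℕ} (hg : ∀ x, 0 ≤ g x)
    (hs : ∀ x, #(sens g x) ≤ d) {t : ℝ} (ht : 0 < t) (ρ : Fin n → Option Bool) :
    ∑ i ∈ free ρ, infl g i ρ
      ≤ d * mass g ρ * t / 2 + (∑ i ∈ free ρ, weight h i ρ) / t / 2 := by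
  have h1 : ∀ i ∈ free ρ, infl g i ρ
      ≤ t / 2 * (∑ x ∈ points ρ, if i ∈ sens g x then (g x + g (flip i x)) / 2 else 0)
        + weight h i ρ / t / 2 := by
    intro i _
    rw [weight, Finset.sum_div, Finset.sum_div, Finset.mul_sum, ← Finset.sum_add_distrib]
    refine Finset.sum_le_sum fun x _ => ?_
    split_ifs with hx
    · have := hw.abs_le hg ht i x
      linarith
    · rw [mem_sens, not_not] at hx
      have : 0 ≤ h i x / t / 2 := by have := hw.nonneg i x; positivity
      simpa [hx] using this
  refine (Finset.sum_le_sum h1).trans ?_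
  rw [Finset.sum_add_distrib, ← Finset.mul_sum, ← Finset.sum_div, ← Finset.sum_div]
  have := sum_edges_le hs g hg ρ
  rw [← mass] at this
  nlinarith

/-- The sum of the signs for coordinate `i`. -/
def signSum (i : ℕ) (data : List Record) : ℝ :=
  (data.map fun r => if r.2.getD i false then (1 : ℝ) else -1).sum

lemma score_eq (i : ℕ) (data : List Record) : (score i data : ℝ) = max 0 (signSum i data) := by
  have h1 : signSum i data = 2 * (data.countP (fun r => r.2.getD i false) : ℝ) - data.length := by
    unfold signSum
    induction data with
    | nil => simp
    | cons r l ih =>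
      simp only [List.map_cons, List.sum_cons, ih, List.countP_cons, List.length_cons]
      split_ifs <;> push_cast <;> ring
  rw [h1, score]
  rcases le_total (data.length) (2 * data.countP (fun r => r.2.getD i false)) with hle | hle
  · rw [Nat.cast_sub hle]
    push_cast
    rw [max_eq_right]
    have : (data.length : ℝ) ≤ ((2 * data.countP (fun r => r.2.getD i false) : ℕ) : ℝ) := by
      exact_mod_cast hle
    push_cast at this; linarith
  · rw [Nat.sub_eq_zero_of_le hle, max_eq_left]
    · simp
    have : ((2 * data.countP (fun r => r.2.getD i false) : ℕ) : ℝ) ≤ (data.length : ℝ) := by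
      exact_mod_cast hle
    push_cast at this; linarith

/-- The empirical masses and weights of all subcubes are correct up to `c`. -/
structure Accurate (m : ℕ) (g : (Fin n → Bool) → ℝ) (h : Fin n → (Fin n → Bool) → ℝ) (c : ℝ)
    (data : List Record) : Prop where
  length_eq : data.length = m
  mass : ∀ ρ : Fin n → Option Bool, |((inside data ρ).length : ℝ) - m * mass g ρ| ≤ m * c
  weight : ∀ ρ : Fin n → Option Bool, ∀ i ∈ free ρ,
    |signSum i (inside data ρ) - m * weight h i ρ| ≤ m * c

/-- The parameters fit together: with `Λ = 2d³e²`, the influence threshold is `Λ⁻²` and the samples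
are assumed accurate up to `1 / Γ`. -/
structure Tuned (n d e Γ Λ : ℕ) (P : Params) : Prop where
  d_pos : 0 < d
  e_pos : 0 < e
  m_pos : 0 < P.m
  Λ_eq : Λ = 2 * d ^ 3 * e ^ 2
  A_eq : P.A = Λ * Λ
  K_eq : P.K = d * P.A
  Γ_eq : Γ = 2 ^ (d + 2) * d * e ^ 2 * (d * Λ + n)
  G_eq : (P.G : ℝ) = 2 * (P.m * (1 / Γ)) * P.A

variable {d e Γ Λ : ℕ} {P : Params}

lemma Tuned.Λ_pos (hP : Tuned n d e Γ Λ P) : 0 < Λ := by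
  rw [hP.Λ_eq]; have := hP.d_pos; have := hP.e_pos; positivity

lemma Tuned.Γ_pos (hP : Tuned n d e Γ Λ P) : 0 < Γ := by
  rw [hP.Γ_eq]; have := hP.d_pos; have := hP.e_pos; have := hP.Λ_pos; positivity

lemma Accurate.score_le {data : List Record} {m : ℕ} {c : ℝ} (hw : EdgeWeight g h)
    (ha : Accurate m g h c data) {ρ : Fin n → Option Bool} {i : Fin n} (hi : i ∈ free ρ)
    (hc : 0 ≤ c) : |(score i (inside data ρ) : ℝ) - m * DTLearn.weight h i ρ| ≤ m * c := by
  have h0 : 0 ≤ (m : ℝ) * DTLearn.weight h i ρ :=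
    mul_nonneg (Nat.cast_nonneg _) (Finset.sum_nonneg fun x _ => hw.nonneg i x)
  have h1 := abs_le.1 (ha.weight ρ i hi)
  have h2 : 0 ≤ (m : ℝ) * c := by positivity
  rw [score_eq, abs_le]
  rcases le_total 0 (signSum i (inside data ρ)) with hs | hs
  · rw [max_eq_right hs]; exact h1
  · rw [max_eq_left hs]; constructor <;> linarith

/-- A coordinate that passes the candidate test is truly influential: its weight is more than the
fraction `1 / A` of the mass of the subcube. -/
lemma Accurate.candidate {data : List Record} (hP : Tuned n d e Γ Λ P)
    (hw : EdgeWeight g h) (ha : Accurate P.m g h (1 / Γ) data)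
    {ρ : Fin n → Option Bool} {i : Fin n} (hi : i ∈ free ρ)
    (ht : (inside data ρ).length + P.G < P.A * score i (inside data ρ)) :
    DTLearn.mass g ρ / P.A < DTLearn.weight h i ρ := by
  have hA : (1 : ℝ) ≤ P.A := by
    have : 0 < P.A := by rw [hP.A_eq]; exact Nat.mul_pos hP.Λ_pos hP.Λ_pos
    exact_mod_cast this
  have hm : (0 : ℝ) < P.m := by exact_mod_cast hP.m_pos
  set γ : ℝ := P.m * (1 / Γ) with hγ
  have hγ0 : 0 ≤ γ := by positivity
  have ht' : ((inside data ρ).length : ℝ) + P.G < P.A * score i (inside data ρ) := by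
    exact_mod_cast ht
  have h1 := (abs_le.1 (ha.score_le hw hi (by positivity))).2
  have h2 := (abs_le.1 (ha.mass ρ)).1
  rw [hP.G_eq] at ht'
  rw [← hγ] at h1 h2 ht'
  rw [div_lt_iff₀ (by linarith)]
  have h3 : (P.A : ℝ) * score i (inside data ρ) ≤ P.A * (P.m * DTLearn.weight h i ρ + γ) := by
    gcongr; linarith
  have h4 : (P.m : ℝ) * DTLearn.mass g ρ < P.m * (DTLearn.weight h i ρ * P.A) := by nlinarith
  exact lt_of_mul_lt_mul_left h4 hm.le

/-- A coordinate that fails the candidate test has little influence: its weight is about `Λ⁻²` times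
the mass at most, which makes the `L¹` influence at most about `Λ⁻¹` times the mass. -/
lemma Accurate.not_candidate {data : List Record} (hP : Tuned n d e Γ Λ P)
    (hw : EdgeWeight g h) (hg : ∀ x, 0 ≤ g x) (ha : Accurate P.m g h (1 / Γ) data)
    {ρ : Fin n → Option Bool} {i : Fin n} (hi : i ∈ free ρ)
    (ht : ¬ (inside data ρ).length + P.G < P.A * score i (inside data ρ)) :
    infl g i ρ ≤ DTLearn.mass g ρ / Λ + 2 * Λ / Γ := by
  have hΛ : (1 : ℝ) ≤ Λ := by exact_mod_cast hP.Λ_pos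
  have hA : (P.A : ℝ) = Λ * Λ := by exact_mod_cast hP.A_eq
  have hm : (0 : ℝ) < P.m := by exact_mod_cast hP.m_pos
  have hΓ : (0 : ℝ) < Γ := by exact_mod_cast hP.Γ_pos
  set γ : ℝ := 1 / Γ with hγ
  have hγ0 : 0 ≤ γ := by positivity
  have ht' : (P.A : ℝ) * score i (inside data ρ) ≤ ((inside data ρ).length : ℝ) + P.G := by
    exact_mod_cast not_lt.1 ht
  have h1 := (abs_le.1 (ha.score_le hw hi hγ0)).1
  have h2 := (abs_le.1 (ha.mass ρ)).2
  rw [hP.G_eq, ← hγ] at ht'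
  have hA1 : (1 : ℝ) ≤ P.A := by rw [hA]; nlinarith
  have h3 : (P.A : ℝ) * (P.m * DTLearn.weight h i ρ - P.m * γ) ≤ P.A * score i (inside data ρ) := by
    gcongr; linarith
  have h4 : (P.m : ℝ) * (P.A * DTLearn.weight h i ρ)
      ≤ P.m * (DTLearn.mass g ρ + 4 * γ * P.A) := by
    have : (P.m : ℝ) * γ ≤ P.A * (P.m * γ) := le_mul_of_one_le_left (by positivity) hA1
    nlinarith
  have h5 := le_of_mul_le_mul_left h4 hm
  have h6 : DTLearn.weight h i ρ ≤ DTLearn.mass g ρ / (Λ * Λ) + 4 * γ := by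
    rw [← hA, ← sub_le_iff_le_add, le_div_iff₀ (by linarith)]
    nlinarith
  have h7 := hw.infl_le hg (t := 1 / Λ) (by positivity) hi
  refine h7.trans ?_
  have h8 : DTLearn.weight h i ρ / (1 / (Λ : ℝ)) / 2
      ≤ (DTLearn.mass g ρ / (Λ * Λ) + 4 * γ) / (1 / (Λ : ℝ)) / 2 := by gcongr
  have h9 : (DTLearn.mass g ρ / (Λ * Λ) + 4 * γ) / (1 / (Λ : ℝ)) / 2
      = DTLearn.mass g ρ / Λ / 2 + 2 * Λ / Γ := by
    rw [hγ]; field_simp; ring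
  have h10 : 1 / (Λ : ℝ) * DTLearn.mass g ρ / 2 = DTLearn.mass g ρ / Λ / 2 := by ring
  linarith

/-- With accurate samples the cap does not take effect: every coordinate which passes the test is a
candidate. -/
lemma Accurate.mem_cands {data : List Record} (hP : Tuned n d e Γ Λ P)
    (hw : EdgeWeight g h) (hg : ∀ x, 0 ≤ g x) (hs : ∀ x, #(sens g x) ≤ d)
    (ha : Accurate P.m g h (1 / Γ) data) {ρ : Fin n → Option Bool} {s : State}
    (hr : Represents data ρ s) {i : Fin n} (hi : i ∈ free ρ)
    (ht : (inside data ρ).length + P.G < P.A * score i (inside data ρ)) : (i : ℕ) ∈ cands P s := by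
  have hA : (0 : ℝ) < P.A := by
    have : 0 < P.A := by rw [hP.A_eq]; exact Nat.mul_pos hP.Λ_pos hP.Λ_pos
    exact_mod_cast this
  set C : Finset (Fin n) := (free ρ).filter fun i =>
    (inside data ρ).length + P.G < P.A * score i (inside data ρ) with hC
  have hwt : ∀ i ∈ C, DTLearn.mass g ρ / P.A < DTLearn.weight h i ρ := fun i hi => by
    rw [hC, Finset.mem_filter] at hi
    exact ha.candidate hP hw hi.1 hi.2
  have hwsum : ∑ i ∈ C, DTLearn.weight h i ρ ≤ d * DTLearn.mass g ρ := by
    refine le_trans (Finset.sum_le_sum_of_subset_of_nonneg (Finset.filter_subset _ _)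
      fun j _ _ => Finset.sum_nonneg fun x _ => hw.nonneg j x) ?_
    exact (Finset.sum_le_sum fun j _ => hw.weight_le j ρ).trans (sum_infl_le_mass hg hs ρ)
  have hiC : i ∈ C := by rw [hC, Finset.mem_filter]; exact ⟨hi, ht⟩
  have hcard : #C ≤ P.K := by
    have h1 : #C * (DTLearn.mass g ρ / P.A) < d * DTLearn.mass g ρ := by
      refine lt_of_lt_of_le ?_ hwsum
      rw [← nsmul_eq_mul, ← Finset.sum_const]
      exact Finset.sum_lt_sum_of_nonempty ⟨i, hiC⟩ hwt
    have h2 : 0 < DTLearn.mass g ρ := by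
      rcases (mass_nonneg hg ρ).lt_or_eq with h | h
      · exact h
      · rw [← h] at h1; simp at h1
    rw [← mul_div_assoc, div_lt_iff₀ hA] at h1
    have h3 : (#C : ℝ) < d * P.A := by nlinarith
    rw [hP.K_eq]
    exact_mod_cast h3.le
  rw [cands, List.mem_reverse, List.take_of_length_le, List.mem_filter]
  · refine ⟨(hr.mem _).2 ⟨i, hi, rfl⟩, ?_⟩
    simpa only [decide_eq_true_eq, hr.perm.length_eq, score_perm hr.perm] using ht
  · rw [← List.toFinset_card_of_nodup (hr.nodup.filter _)]
    refine le_trans (Finset.card_le_card (t := C.map Fin.valEmbedding) fun j hj => ?_)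
      ((Finset.card_map _).le.trans hcard)
    rw [List.mem_toFinset, List.mem_filter, hr.mem] at hj
    obtain ⟨⟨k, hk, rfl⟩, hj⟩ := hj
    simp only [decide_eq_true_eq, hr.perm.length_eq, score_perm hr.perm] at hj
    exact Finset.mem_map.2 ⟨k, by rw [hC, Finset.mem_filter]; exact ⟨hk, hj⟩, rfl⟩

lemma card_free_le (ρ : Fin n → Option Bool) : (#(free ρ) : ℝ) ≤ n := by
  have := Finset.card_le_univ (free ρ)
  rw [Fintype.card_fin] at this
  exact_mod_cast this

/-- The score of a leaf, compared with the distance of `g` from an arbitrary constant. -/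
lemma Accurate.best_le_leaf {data : List Record} (hP : Tuned n d e Γ Λ P)
    (hw : EdgeWeight g h) (hs : ∀ x, #(sens g x) ≤ d)
    (ha : Accurate P.m g h (1 / Γ) data) (k : ℕ) (c : ℝ) {ρ : Fin n → Option Bool} {s : State}
    (hr : Represents data ρ s) :
    ((best P k s).1 : ℝ) ≤ P.m * (d * ∑ x ∈ points ρ, |g x - c| + n / Γ) := by
  have hm : (0 : ℝ) < P.m := by exact_mod_cast hP.m_pos
  have hΓ : (0 : ℝ) < Γ := by exact_mod_cast hP.Γ_pos
  have h1 : ((best P k s).1 : ℝ) ≤ ((leafScore s : ℕ) : ℝ) := by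
    exact_mod_cast best_le_leafScore P k s
  refine h1.trans ?_
  rw [leafScore, hr.sum_free]
  push_cast
  have h2 : ∀ i ∈ free ρ, (score i s.1 : ℝ) ≤ P.m * infl g i ρ + P.m * (1 / Γ) := by
    intro i hi
    rw [score_perm hr.perm]
    have h3 := (abs_le.1 (ha.score_le hw hi (by positivity))).2
    have h4 : (P.m : ℝ) * DTLearn.weight h i ρ ≤ P.m * infl g i ρ := by
      gcongr; exact hw.weight_le i ρ
    linarith
  refine (Finset.sum_le_sum h2).trans ?_
  rw [Finset.sum_add_distrib, Finset.sum_const, nsmul_eq_mul, ← Finset.mul_sum, mul_add]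
  have h5 := DTLearn.sum_infl_le hs c ρ
  have h6 : (#(free ρ) : ℝ) * (P.m * (1 / Γ)) ≤ P.m * (n / Γ) := by
    rw [show (P.m : ℝ) * (n / Γ) = n * (P.m * (1 / Γ)) by ring]
    exact mul_le_mul_of_nonneg_right (card_free_le ρ) (by positivity)
  gcongr

/-- Using a tree in one half of a subcube for the other half too costs the influence of the
coordinate that distinguishes the halves. -/
lemma sum_restrict_le (g : (Fin n → Bool) → ℝ) (S : DecisionTree n ℝ) (b : Bool) {i : Fin n}
    {ρ : Fin n → Option Bool} (hi : i ∈ free ρ) :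
    ∑ x ∈ points ρ, |g x - (S.restrict i b).eval x|
      ≤ 2 * ∑ x ∈ points (fix ρ i b), |g x - S.eval x| + infl g i ρ := by
  have h1 : infl g i ρ = ∑ x ∈ points (fix ρ i b), |g x - g (flip i x)| := by
    rw [infl, sum_split' hi b, ← Finset.sum_add_distrib]
    refine Finset.sum_congr rfl fun x _ => ?_
    rw [flip_flip, abs_sub_comm (g (flip i x)), add_halves]
  rw [h1, two_mul, add_assoc, ← Finset.sum_add_distrib, sum_split' hi b]
  refine add_le_add ?_ ?_ <;> refine Finset.sum_le_sum fun x hx => ?_ <;>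
  rw [points_fix hi, Finset.mem_filter] at hx <;> rw [DecisionTree.eval_restrict]
  · rw [← hx.2, Function.update_eq_self]
  · rw [flip, Function.update_idem, ← hx.2, Function.update_eq_self, add_comm,
      abs_sub_comm (g x) (g _)]
    exact abs_sub_le _ _ _

/-- Pruning. Any decision tree `S` of depth at most `j ≤ k` is a yardstick for the search: a node of
`S` which queries a candidate is matched by the search, and a node which queries another coordinate
is replaced by one of its two subtrees, at the expense of the influence of that coordinate. -/
lemma Accurate.best_le {data : List Record} (hP : Tuned n d e Γ Λ P)
    (hw : EdgeWeight g h) (hg : ∀ x, 0 ≤ g x) (hs : ∀ x, #(sens g x) ≤ d)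
    (ha : Accurate P.m g h (1 / Γ) data) (j k : ℕ) (hjk : j ≤ k) (S : DecisionTree n ℝ)
    (hS : S.depth ≤ j) (ρ : Fin n → Option Bool) (s : State) (hr : Represents data ρ s) :
    ((best P k s).1 : ℝ) ≤ P.m * (d * (∑ x ∈ points ρ, |g x - S.eval x|
      + j / Λ * DTLearn.mass g ρ + 2 ^ j * (2 * Λ / Γ)) + 2 ^ k * n / Γ) := by
  have hΛ : (1 : ℝ) ≤ Λ := by exact_mod_cast hP.Λ_pos
  have hm : (0 : ℝ) < P.m := by exact_mod_cast hP.m_pos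
  have hΓ : (0 : ℝ) < Γ := by exact_mod_cast hP.Γ_pos
  induction j generalizing k S ρ s with
  | zero =>
    cases S with
    | node i l r => simp [DecisionTree.depth] at hS
    | leaf c =>
      refine (ha.best_le_leaf hP hw hs k c hr).trans ?_
      have h2 : (1 : ℝ) ≤ 2 ^ k := one_le_pow₀ (by norm_num)
      have h3 : (n : ℝ) / Γ ≤ 2 ^ k * n / Γ := by
        gcongr; exact le_mul_of_one_le_left (by positivity) h2
      gcongr
      simp only [DecisionTree.eval]
      have : (0 : ℝ) ≤ 2 ^ 0 * (2 * Λ / Γ) := by positivity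
      have : ((0 : ℕ) : ℝ) / Λ * DTLearn.mass g ρ = 0 := by simp
      linarith
  | succ j ih =>
    -- lowering the error of the yardstick and its depth
    have hstep : ∀ (S' : DecisionTree n ℝ), S'.depth ≤ j →
        ∑ x ∈ points ρ, |g x - S'.eval x| ≤ ∑ x ∈ points ρ, |g x - S.eval x|
          + DTLearn.mass g ρ / Λ + 2 * Λ / Γ →
        ((best P k s).1 : ℝ) ≤ P.m * (d * (∑ x ∈ points ρ, |g x - S.eval x|
          + (j + 1 : ℕ) / Λ * DTLearn.mass g ρ + 2 ^ (j + 1) * (2 * Λ / Γ)) + 2 ^ k * n / Γ) := by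
      intro S' hd' herr
      refine (ih k (by omega) S' hd' ρ s hr).trans ?_
      gcongr P.m * (d * ?_ + _)
      have h1 : (1 : ℝ) ≤ 2 ^ j := one_le_pow₀ (by norm_num)
      have h2 : (0 : ℝ) ≤ 2 * Λ / Γ := by positivity
      have h3 : 2 * Λ / Γ ≤ 2 ^ j * (2 * Λ / Γ : ℝ) := le_mul_of_one_le_left h2 h1
      have h4 : ((j + 1 : ℕ) : ℝ) / Λ * DTLearn.mass g ρ
          = j / Λ * DTLearn.mass g ρ + DTLearn.mass g ρ / Λ := by push_cast; ring
      rw [h4, pow_succ]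
      linarith
    have hmass0 := mass_nonneg hg ρ
    have hextra : (0 : ℝ) ≤ DTLearn.mass g ρ / Λ + 2 * Λ / Γ := by positivity
    cases S with
    | leaf c => exact hstep (.leaf c) (Nat.zero_le _) (by linarith)
    | node i l r =>
      have hl : l.depth ≤ j := by simp only [DecisionTree.depth] at hS; omega
      have hr' : r.depth ≤ j := by simp only [DecisionTree.depth] at hS; omega
      by_cases hi : i ∈ free ρ
      · have e0 : ∑ x ∈ points (fix ρ i false), |g x - (DecisionTree.node i l r).eval x|
            = ∑ x ∈ points (fix ρ i false), |g x - l.eval x| := by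
          refine Finset.sum_congr rfl fun x hx => ?_
          rw [points_fix hi, Finset.mem_filter] at hx
          simp [DecisionTree.eval, hx.2]
        have e1 : ∑ x ∈ points (fix ρ i true), |g x - (DecisionTree.node i l r).eval x|
            = ∑ x ∈ points (fix ρ i true), |g x - r.eval x| := by
          refine Finset.sum_congr rfl fun x hx => ?_
          rw [points_fix hi, Finset.mem_filter] at hx
          simp [DecisionTree.eval, hx.2]
        by_cases ht : (inside data ρ).length + P.G < P.A * score i (inside data ρ)
        · obtain ⟨k, rfl⟩ : ∃ k', k = k' + 1 := ⟨k - 1, by omega⟩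
          have hc := best_succ_le_of_mem P k s (ha.mem_cands hP hw hg hs hr hi ht)
          have h0 := ih k (by omega) l hl _ _ (hr.branch hi false)
          have h1 := ih k (by omega) r hr' _ _ (hr.branch hi true)
          have hc' : ((best P (k + 1) s).1 : ℝ)
              ≤ (best P k (branch false i s)).1 + (best P k (branch true i s)).1 := by
            exact_mod_cast hc
          have hms : DTLearn.mass g ρ
              = DTLearn.mass g (fix ρ i false) + DTLearn.mass g (fix ρ i true) := sum_split hi g
          refine hc'.trans ((add_le_add h0 h1).trans ?_)
          rw [← mul_add]
          gcongr P.m * ?_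
          have hj1 : (j : ℝ) / Λ * DTLearn.mass g ρ
              ≤ ((j + 1 : ℕ) : ℝ) / Λ * DTLearn.mass g ρ := by
            gcongr; simp
          have hd0 : (d : ℝ) * (j / Λ * DTLearn.mass g ρ)
              ≤ d * (((j + 1 : ℕ) : ℝ) / Λ * DTLearn.mass g ρ) := by gcongr
          rw [sum_split hi, e0, e1, pow_succ, pow_succ]
          rw [hms] at hd0 ⊢
          refine le_trans (le_of_eq ?_) (le_trans (add_le_add_right hd0
            ((d : ℝ) * (∑ x ∈ points (fix ρ i false), |g x - l.eval x|
              + ∑ x ∈ points (fix ρ i true), |g x - r.eval x| + 2 ^ j * 2 * (2 * Λ / Γ))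
              + 2 ^ k * 2 * n / Γ)) (le_of_eq ?_)) <;> ring
        · -- both subtrees, with coordinate `i` set to the value of their own half
          have hI := ha.not_candidate hP hw hg hi ht
          have hsum : ∑ x ∈ points ρ, |g x - (DecisionTree.node i l r).eval x|
              = ∑ x ∈ points (fix ρ i false), |g x - l.eval x|
                + ∑ x ∈ points (fix ρ i true), |g x - r.eval x| := by
            rw [sum_split hi, e0, e1]
          rcases le_total (∑ x ∈ points (fix ρ i false), |g x - l.eval x|)
            (∑ x ∈ points (fix ρ i true), |g x - r.eval x|) with hle | hle
          · refine hstep _ ((l.depth_restrict i false).trans hl)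
              ((sum_restrict_le g l false hi).trans ?_)
            rw [hsum]; linarith
          · refine hstep _ ((r.depth_restrict i true).trans hr')
              ((sum_restrict_le g r true hi).trans ?_)
            rw [hsum]; linarith
      · -- the coordinate is fixed, so that the query has a known answer
        obtain ⟨b, hb⟩ : ∃ b, ρ i = some b :=
          Option.ne_none_iff_exists'.1 fun h => hi (mem_free.2 h)
        refine hstep (if b then r else l) (by split_ifs <;> assumption) ?_
        have : ∑ x ∈ points ρ, |g x - (if b then r else l).eval x|
            = ∑ x ∈ points ρ, |g x - (DecisionTree.node i l r).eval x| := by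
          refine Finset.sum_congr rfl fun x hx => ?_
          have hxi := mem_points.1 hx i
          rw [hb] at hxi
          have hxb : b = x i := by simpa using hxi
          rw [hxb]
          simp only [DecisionTree.eval]
          split_ifs <;> rfl
        rw [this]; linarith

end Accuracy

/-! ### The error of the tree found -/

section Output

variable {n : ℕ}

lemma leafSum_add {α : Type} (Φ Ψ : (Fin n → Option Bool) → ℝ) (T : DecisionTree n α)
    (ρ : Fin n → Option Bool) :
    leafSum (fun σ => Φ σ + Ψ σ) ρ T = leafSum Φ ρ T + leafSum Ψ ρ T := by
  induction T generalizing ρ with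
  | leaf a => rfl
  | node i l r hl hr => simp only [leafSum, hl, hr]; ring

lemma leafSum_mul {α : Type} (c : ℝ) (Φ : (Fin n → Option Bool) → ℝ) (T : DecisionTree n α)
    (ρ : Fin n → Option Bool) : leafSum (fun σ => c * Φ σ) ρ T = c * leafSum Φ ρ T := by
  induction T generalizing ρ with
  | leaf a => rfl
  | node i l r hl hr => simp only [leafSum, hl, hr]; ring

lemma leafSum_mono {α : Type} {Φ Ψ : (Fin n → Option Bool) → ℝ} (h : ∀ σ, Φ σ ≤ Ψ σ)
    (T : DecisionTree n α) (ρ : Fin n → Option Bool) : leafSum Φ ρ T ≤ leafSum Ψ ρ T := by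
  induction T generalizing ρ with
  | leaf a => exact h ρ
  | node i l r hl hr => exact add_le_add (hl _) (hr _)

lemma leafSum_one_le {α : Type} (T : DecisionTree n α) (ρ : Fin n → Option Bool) :
    leafSum (fun _ => 1) ρ T ≤ 2 ^ T.depth := by
  induction T generalizing ρ with
  | leaf a => simp [leafSum, DecisionTree.depth]
  | node i l r hl hr =>
    have h1 : (2 : ℝ) ^ l.depth ≤ 2 ^ max l.depth r.depth :=
      pow_le_pow_right₀ (by norm_num) (le_max_left _ _)
    have h2 : (2 : ℝ) ^ r.depth ≤ 2 ^ max l.depth r.depth :=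
      pow_le_pow_right₀ (by norm_num) (le_max_right _ _)
    simp only [leafSum, DecisionTree.depth, pow_succ]
    linarith [hl (fix ρ i false), hr (fix ρ i true)]

/-- The number which the tree assigns to a point. -/
noncomputable def label (T : DecisionTree n (ℕ × ℕ+)) (x : Fin n → Bool) : ℝ :=
  ((T.eval x).1 : ℝ) / ((T.eval x).2 : ℕ)

lemma sum_points_node {α : Type} {ρ : Fin n → Option Bool} {i : Fin n} (hi : i ∈ free ρ)
    (l r : DecisionTree n α) (F : (Fin n → Bool) → α → ℝ) :
    ∑ x ∈ points ρ, F x ((DecisionTree.node i l r).eval x)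
      = ∑ x ∈ points (fix ρ i false), F x (l.eval x)
        + ∑ x ∈ points (fix ρ i true), F x (r.eval x) := by
  rw [sum_split hi]
  congr 1 <;> refine Finset.sum_congr rfl fun x hx => ?_ <;>
  · rw [points_fix hi, Finset.mem_filter] at hx
    simp [DecisionTree.eval, hx.2]

lemma length_inside_split {data : List Record} {ρ : Fin n → Option Bool} {i : Fin n}
    (hi : i ∈ free ρ) : (inside data ρ).length
      = (inside data (fix ρ i false)).length + (inside data (fix ρ i true)).length := by
  unfold inside
  simp only [matches_fix hi]
  induction data with
  | nil => rfl
  | cons r l ih =>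
    simp only [List.filter_cons]
    by_cases h : Matches ρ r.1
    · cases hb : r.1.getD i false <;> simp [h, ih] <;> omega
    · simp [h, ih]

lemma Fitted.sum_label {P : Params} (hm : 0 < P.m) {data : List Record}
    {T : DecisionTree n (ℕ × ℕ+)} {ρ : Fin n → Option Bool} (hT : Fitted P data ρ T) :
    ∑ x ∈ points ρ, label T x = (inside data ρ).length / P.m := by
  induction T generalizing ρ with
  | leaf a =>
    have hm' : (0 : ℝ) < P.m := by exact_mod_cast hm
    simp only [label, DecisionTree.eval, Finset.sum_const, (sum_abs_sub_avg_le 0 ρ).1,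
      nsmul_eq_mul, hT.1, hT.2]
    push_cast
    field_simp
  | node i l r hl hr =>
    obtain ⟨hi, h0, h1⟩ := hT
    have := sum_points_node hi l r (fun _ a => (a.1 : ℝ) / (a.2 : ℕ))
    simp only [label] at hl hr ⊢
    rw [this, hl h0, hr h1, length_inside_split hi]
    push_cast; ring

variable {g : (Fin n → Bool) → ℝ} {h : Fin n → (Fin n → Bool) → ℝ} {d e Γ Λ : ℕ} {P : Params}

/-- The Poincaré inequality at each leaf bounds the error by the total influence at the leaves. -/
lemma Fitted.sum_abs_le (hm : 0 < P.m) {c : ℝ} {data : List Record}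
    (ha : Accurate P.m g h c data) {T : DecisionTree n (ℕ × ℕ+)} {ρ : Fin n → Option Bool}
    (hT : Fitted P data ρ T) :
    ∑ x ∈ points ρ, |g x - label T x|
      ≤ leafSum (fun σ => ∑ i ∈ free σ, infl g i σ + c * 1) ρ T := by
  induction T generalizing ρ with
  | leaf a =>
    have hm' : (0 : ℝ) < P.m := by exact_mod_cast hm
    obtain ⟨hcard, hP⟩ := sum_abs_sub_avg_le g ρ
    have hpow : (0 : ℝ) < 2 ^ #(free ρ) := by positivity
    have h1 : ∀ x ∈ points ρ, |g x - label (DecisionTree.leaf a) x|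
        ≤ |g x - DTLearn.mass g ρ / 2 ^ #(free ρ)| + c / 2 ^ #(free ρ) := by
      intro x _
      refine (abs_sub_le _ (DTLearn.mass g ρ / 2 ^ #(free ρ)) _).trans ?_
      gcongr
      simp only [label, DecisionTree.eval, hT.1, hT.2]
      push_cast
      rw [mul_comm (P.m : ℝ), div_mul_eq_div_div_swap, ← sub_div, abs_div, abs_of_pos hpow]
      gcongr
      have h2 := ha.mass ρ
      rw [abs_sub_comm] at h2
      have h3 : DTLearn.mass g ρ - (inside data ρ).length / P.m
          = (P.m * DTLearn.mass g ρ - (inside data ρ).length) / P.m := by field_simp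
      rw [h3, abs_div, abs_of_pos hm', div_le_iff₀ hm']
      linarith
    refine (Finset.sum_le_sum h1).trans ?_
    rw [Finset.sum_add_distrib, Finset.sum_const, hcard, nsmul_eq_mul]
    push_cast
    rw [mul_div_cancel₀ _ hpow.ne']
    simp only [leafSum, mul_one]
    linarith
  | node i l r hl hr =>
    obtain ⟨hi, h0, h1⟩ := hT
    have := sum_points_node hi l r (fun x a => |g x - (a.1 : ℝ) / (a.2 : ℕ)|)
    simp only [label] at hl hr ⊢
    rw [this]
    exact add_le_add (hl h0) (hr h1)

lemma Fitted.leafSum_mass {data : List Record} {T : DecisionTree n (ℕ × ℕ+)}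
    {ρ : Fin n → Option Bool} (hT : Fitted P data ρ T) (g : (Fin n → Bool) → ℝ) :
    leafSum (mass g) ρ T = mass g ρ := by
  induction T generalizing ρ with
  | leaf a => rfl
  | node i l r hl hr =>
    obtain ⟨hi, h0, h1⟩ := hT
    simp only [leafSum, hl h0, hr h1]
    exact (sum_split hi g).symm

/-- The error of the tree found, for accurate samples: the tree `S` of the distribution itself is
the yardstick for the score, and at each leaf the weights are converted into `L¹` influences by the
Cauchy–Schwarz inequality with balance `1 / (d e)`. -/
lemma Accurate.sum_abs_label_le {data : List Record} (hP : Tuned n d e Γ Λ P)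
    (hw : EdgeWeight g h) (hg : ∀ x, 0 ≤ g x) {S : DecisionTree n ℝ} (hS : S.depth ≤ d)
    (hSg : ∀ x, g x = S.eval x) (ha : Accurate P.m g h (1 / Γ) data)
    {ρ : Fin n → Option Bool} (hρ : DTLearn.mass g ρ = 1) {s : State} (hr : Represents data ρ s)
    {T : DecisionTree n (ℕ × ℕ+)} (hTd : T.depth ≤ d) (hT : Fitted P data ρ T)
    (hTs : ((best P d s).1 : ℝ)
      = leafSum (fun σ => ∑ i ∈ free σ, (score i (inside data σ) : ℝ)) ρ T) :
    ∑ x ∈ points ρ, |g x - label T x| ≤ 2 / e := by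
  have hs : ∀ x, #(sens g x) ≤ d := by
    intro x
    have := S.card_sensitive_le x
    simp only [← hSg] at this
    exact this.trans hS
  have hm : (0 : ℝ) < P.m := by exact_mod_cast hP.m_pos
  have hd : (1 : ℝ) ≤ d := by exact_mod_cast hP.d_pos
  have he : (1 : ℝ) ≤ e := by exact_mod_cast hP.e_pos
  have hΛ : (1 : ℝ) ≤ Λ := by exact_mod_cast hP.Λ_pos
  have hΓ : (0 : ℝ) < Γ := by exact_mod_cast hP.Γ_pos
  have hΛe : (Λ : ℝ) = 2 * d ^ 3 * e ^ 2 := by rw [hP.Λ_eq]; push_cast; ring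
  have hΓe : (Γ : ℝ) = 2 ^ (d + 2) * d * e ^ 2 * (d * Λ + n) := by
    rw [hP.Γ_eq]; push_cast; ring
  -- the estimated score of the tree, compared with that of the tree for `g`
  have hbest := ha.best_le hP hw hg hs d d le_rfl S hS ρ s hr
  have h0 : ∑ x ∈ points ρ, |g x - S.eval x| = 0 :=
    Finset.sum_eq_zero fun x _ => by rw [hSg x, sub_self, abs_zero]
  rw [h0, hρ, hTs] at hbest
  -- the true weights at the leaves
  have hpt : ∀ σ : Fin n → Option Bool, ∑ i ∈ free σ, infl g i σ + 1 / (Γ : ℝ) * 1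
      ≤ (d * (1 / (d * e)) / 2) * DTLearn.mass g σ
        + (((d * e) / 2 / P.m) * ∑ i ∈ free σ, (score i (inside data σ) : ℝ)
          + ((d * e) / 2 * (n / Γ) + 1 / Γ) * 1) := by
    intro σ
    have h1 := hw.sum_infl_le hg hs (t := 1 / (d * e)) (by positivity) σ
    have h2 : ∑ i ∈ free σ, DTLearn.weight h i σ
        ≤ (1 / P.m) * ∑ i ∈ free σ, (score i (inside data σ) : ℝ) + n / Γ := by
      have h3 : ∀ i ∈ free σ, DTLearn.weight h i σ
          ≤ (1 / P.m) * (score i (inside data σ) : ℝ) + 1 / Γ := by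
        intro i hi
        have h4 := (abs_le.1 (ha.score_le hw hi (by positivity))).1
        have h5 : (1 / (P.m : ℝ)) * (P.m * DTLearn.weight h i σ)
            ≤ (1 / P.m) * (score i (inside data σ) + P.m * (1 / Γ)) := by
          gcongr; linarith
        have h6 : (1 / (P.m : ℝ)) * (P.m * DTLearn.weight h i σ) = DTLearn.weight h i σ := by
          field_simp
        have h7 : (1 / (P.m : ℝ)) * (score i (inside data σ) + P.m * (1 / Γ))
            = (1 / P.m) * (score i (inside data σ) : ℝ) + 1 / Γ := by
          field_simp
        linarith
      refine (Finset.sum_le_sum h3).trans ?_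
      rw [Finset.sum_add_distrib, ← Finset.mul_sum, Finset.sum_const, nsmul_eq_mul]
      have : (#(free σ) : ℝ) * (1 / Γ) ≤ n / Γ := by
        rw [← mul_one_div (n : ℝ)]
        exact mul_le_mul_of_nonneg_right (card_free_le σ) (by positivity)
      linarith
    have h3 : (∑ i ∈ free σ, DTLearn.weight h i σ) / (1 / (d * e)) / 2
        ≤ ((1 / P.m) * ∑ i ∈ free σ, (score i (inside data σ) : ℝ) + n / Γ)
          / (1 / (d * e)) / 2 := by
      gcongr
    have h4 : ((1 / P.m) * ∑ i ∈ free σ, (score i (inside data σ) : ℝ) + n / Γ)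
          / (1 / (d * e)) / 2
        = ((d * e) / 2 / P.m) * ∑ i ∈ free σ, (score i (inside data σ) : ℝ)
          + (d * e) / 2 * (n / Γ) := by
      field_simp
    linarith
  have h1 := (hT.sum_abs_le hP.m_pos ha).trans (leafSum_mono hpt T ρ)
  rw [leafSum_add, leafSum_add, leafSum_mul, leafSum_mul, leafSum_mul, hT.leafSum_mass, hρ] at h1
  have hone : leafSum (fun _ => (1 : ℝ)) ρ T ≤ 2 ^ d :=
    (leafSum_one_le T ρ).trans (pow_le_pow_right₀ (by norm_num) hTd)
  have h2 : (d * e : ℝ) / 2 / P.m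
        * leafSum (fun σ => ∑ i ∈ free σ, (score i (inside data σ) : ℝ)) ρ T
      ≤ (d * e : ℝ) / 2 / P.m * (P.m * (d * (0 + d / Λ * 1 + 2 ^ d * (2 * Λ / Γ))
          + 2 ^ d * n / Γ)) := by gcongr
  have h3 : ((d * e : ℝ) / 2 * (n / Γ) + 1 / Γ) * leafSum (fun _ => (1 : ℝ)) ρ T
      ≤ ((d * e : ℝ) / 2 * (n / Γ) + 1 / Γ) * 2 ^ d := by gcongr
  refine h1.trans ((add_le_add_right (add_le_add h2 h3) _).trans ?_)
  have h4 : (d * e : ℝ) / 2 / P.m * (P.m * (d * (0 + d / Λ * 1 + 2 ^ d * (2 * Λ / Γ))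
          + 2 ^ d * n / Γ)) + ((d * e : ℝ) / 2 * (n / Γ) + 1 / Γ) * 2 ^ d
      = d ^ 3 * e / (2 * Λ) + (d * e) * 2 ^ d * (d * Λ + n) / Γ + 2 ^ d / Γ := by
    field_simp; ring
  have h5 : (d : ℝ) ^ 3 * e / (2 * Λ) = 1 / (4 * e) := by rw [hΛe]; field_simp; norm_num
  have hX : (1 : ℝ) ≤ d * Λ + n := by
    have : (1 : ℝ) ≤ d * Λ := by nlinarith
    have : (0 : ℝ) ≤ n := Nat.cast_nonneg n
    linarith
  have h6 : (d * e : ℝ) * 2 ^ d * (d * Λ + n) / Γ = 1 / (4 * e) := by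
    rw [hΓe, pow_add]; field_simp; norm_num
  have h7 : (2 : ℝ) ^ d / Γ ≤ 1 / (4 * e) := by
    rw [← h6]
    gcongr
    have : (1 : ℝ) ≤ d * e := by nlinarith
    calc (2 : ℝ) ^ d = 1 * 2 ^ d * 1 := by ring
      _ ≤ d * e * 2 ^ d * (d * Λ + n) := by gcongr
  rw [h4, h5, h6]
  have h8 : (d : ℝ) * (1 / (d * e)) / 2 * 1 = 1 / (2 * e) := by field_simp
  have h9 : (2 : ℝ) / e = 8 * (1 / (4 * e)) := by field_simp; norm_num
  have h10 : (1 : ℝ) / (2 * e) = 2 * (1 / (4 * e)) := by field_simp; norm_num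
  have : (0 : ℝ) ≤ 1 / (4 * e) := by positivity
  rw [h8, h9, h10]
  linarith

lemma points_none : points (fun _ : Fin n => none) = univ := by
  ext x; simp [mem_points]

lemma inside_none (data : List Record) : inside data (fun _ : Fin n => none) = data := by
  simp [inside, Matches]

/-- A tree fitted to a nonempty sample computes a pmf. -/
lemma Fitted.goodOutput {D : PMF (Fin n → Bool)} {data : List Record} {ε : ℝ} (hm : 0 < P.m)
    (hlen : data.length = P.m) {T : DecisionTree n (ℕ × ℕ+)} (hTd : T.depth ≤ d)
    (hT : Fitted P data (fun _ => none) T)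
    (herr : ∑ x, |(D x).toReal - label T x| ≤ 2 * ε) : GoodOutput D d ε (Val.ofTree T) := by
  have hsum := hT.sum_label hm
  have hm' : (0 : ℝ) < P.m := by exact_mod_cast hm
  rw [points_none, inside_none, hlen, div_self hm'.ne'] at hsum
  have hpos : ∀ x, 0 ≤ label T x := fun x => by unfold label; positivity
  let D' : PMF (Fin n → Bool) := PMF.ofFintype (fun x => ENNReal.ofReal (label T x)) (by
    rw [← ENNReal.ofReal_sum_of_nonneg fun x _ => hpos x, hsum, ENNReal.ofReal_one])
  have hD' : ∀ x, (D' x).toReal = label T x := fun x => by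
    simp only [D', PMF.ofFintype_apply, ENNReal.toReal_ofReal (hpos x)]
  refine ⟨T, rfl, hTd, hT.readOnce, D', hD', ?_⟩
  simp only [tvDist, hD']
  linarith

lemma sum_toReal (D : PMF (Fin n → Bool)) : ∑ x, (D x).toReal = 1 := by
  rw [← ENNReal.toReal_sum fun x _ => D.apply_ne_top x, ← tsum_fintype (L := .unconditional _),
    D.tsum_coe, ENNReal.toReal_one]

lemma goodOutput_of_accurate {D : PMF (Fin n → Bool)} (hD : RepresentableByDepth D d)
    (hP : Tuned n d e Γ Λ P) (hw : EdgeWeight (fun x => (D x).toReal) h) {data : List Record}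
    (ha : Accurate P.m (fun x => (D x).toReal) h (1 / Γ) data) {ε : ℝ} (he : 1 / e ≤ ε) {s : State}
    (hr : Represents data (fun _ : Fin n => none) s) : GoodOutput D d ε (best P d s).2 := by
  obtain ⟨S, hSd, hS⟩ := hD
  obtain ⟨T, hTv, hTd, hT, hTs⟩ := exists_tree_best hP.m_pos data d hr
  rw [hTv]
  refine hT.goodOutput hP.m_pos ha.length_eq hTd ?_
  have := ha.sum_abs_label_le hP hw (fun x => ENNReal.toReal_nonneg) hSd hS
    (by rw [mass, points_none, sum_toReal]) hr hTd hT hTs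
  rw [points_none] at this
  refine this.trans ?_
  rw [show (2 : ℝ) / e = 2 * (1 / e) by ring]
  linarith

/-- A depth-zero distribution is uniform, and every record list of length `1` is good enough. -/
lemma goodOutput_zero {D : PMF (Fin n → Bool)} (hD : RepresentableByDepth D 0) (hm : P.m = 1)
    {data : List Record} (hlen : data.length = 1) {ε : ℝ} (he : 0 ≤ ε) {s : State}
    (hr : Represents data (fun _ : Fin n => none) s) : GoodOutput D 0 ε (best P 0 s).2 := by
  obtain ⟨S, hSd, hS⟩ := hD
  obtain ⟨T, hTv, hTd, hT, -⟩ := exists_tree_best (by omega : 0 < P.m) data 0 hr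
  rw [hTv]
  refine hT.goodOutput (by omega) (by omega) hTd ?_
  have h1 := sum_toReal D
  have h2 := hT.sum_label (by omega)
  cases S with
  | node i l r => simp [DecisionTree.depth] at hSd
  | leaf c =>
    cases T with
    | node i l r => simp [DecisionTree.depth] at hTd
    | leaf a =>
      rw [points_none, inside_none, hlen, hm] at h2
      simp only [hS, label, DecisionTree.eval, Finset.sum_const, nsmul_eq_mul, Nat.cast_one,
        div_one, Finset.card_univ] at h1 h2 ⊢
      have hne : (Fintype.card (Fin n → Bool) : ℝ) ≠ 0 := by
        exact_mod_cast Fintype.card_ne_zero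
      have : c = (a.1 : ℝ) / (a.2 : ℕ) := mul_left_cancel₀ hne (h1.trans h2.symm)
      rw [← this]
      simpa using he

end Output

/-! ### Deterministic execution -/

lemma run_add {n : ℕ} (D : PMF (Fin n → Bool)) (a b : ℕ) (c : Config) :
    run D (a + b) c = (run D a c).bind (run D b) := by
  induction a generalizing c with
  | zero => simp [run]
  | succ a ih =>
    rw [Nat.succ_add, run, run, PMF.bind_bind]
    congr 1
    funext c'
    exact ih c'

/-- From the registers `r`, the program `p` leads to the registers `r'` in exactly `τ` steps,
without drawing samples. -/
def Exec (p : Prog) (r r' : ℕ → Val) (τ : ℕ) : Prop :=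
  ∀ (n : ℕ) (D : PMF (Fin n → Bool)) (k : List Prog) (t s : ℕ),
    run D τ ⟨p :: k, r, t, s⟩ = PMF.pure ⟨k, r', t + τ, s⟩

namespace Exec

variable {p q : Prog} {r r' r'' : ℕ → Val} {τ τ' : ℕ}

lemma const (x k : ℕ) (r : ℕ → Val) :
    Exec (.const x k) r (Function.update r x (.num k)) 1 := by
  intro n D l t s
  simp [run, step, Config.write]

lemma copy (x y : ℕ) (r : ℕ → Val) :
    Exec (.copy x y) r (Function.update r x (r y)) 1 := by
  intro n D l t s
  simp [run, step, Config.write]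

lemma add (x y z : ℕ) (r : ℕ → Val) : Exec (.add x y z) r
    (Function.update r x (.num ((r y).toNat + (r z).toNat))) 1 := by
  intro n D l t s
  simp [run, step, Config.write]

lemma sub (x y z : ℕ) (r : ℕ → Val) : Exec (.sub x y z) r
    (Function.update r x (.num ((r y).toNat - (r z).toNat))) 1 := by
  intro n D l t s
  simp [run, step, Config.write]

lemma pair (x y z : ℕ) (r : ℕ → Val) : Exec (.pair x y z) r
    (Function.update r x (.pair (r y) (r z))) 1 := by
  intro n D l t s
  simp [run, step, Config.write]

lemma fst (x y : ℕ) (r : ℕ → Val) :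
    Exec (.fst x y) r (Function.update r x (r y).fst) 1 := by
  intro n D l t s
  simp [run, step, Config.write]

lemma snd (x y : ℕ) (r : ℕ → Val) :
    Exec (.snd x y) r (Function.update r x (r y).snd) 1 := by
  intro n D l t s
  simp [run, step, Config.write]

lemma seq (hp : Exec p r r' τ) (hq : Exec q r' r'' τ') : Exec (.seq p q) r r'' (1 + τ + τ') := by
  intro n D l t s
  have h1 : run D 1 ⟨.seq p q :: l, r, t, s⟩ = PMF.pure ⟨p :: q :: l, r, t + 1, s⟩ := by
    simp [run, step, Config.goto]
  rw [add_assoc, run_add, h1, PMF.pure_bind, run_add, hp, PMF.pure_bind, hq]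
  simp only [add_assoc]

lemma ifNZ_pos {y : ℕ} (hy : r y ≠ .num 0) (hp : Exec p r r' τ) :
    Exec (.ifNZ y p q) r r' (1 + τ) := by
  intro n D l t s
  have h1 : run D 1 ⟨.ifNZ y p q :: l, r, t, s⟩ = PMF.pure ⟨p :: l, r, t + 1, s⟩ := by
    simp [run, step, Config.goto, hy]
  rw [run_add, h1, PMF.pure_bind, hp, add_assoc]

lemma ifNZ_neg {y : ℕ} (hy : r y = .num 0) (hq : Exec q r r' τ) :
    Exec (.ifNZ y p q) r r' (1 + τ) := by
  intro n D l t s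
  have h1 : run D 1 ⟨.ifNZ y p q :: l, r, t, s⟩ = PMF.pure ⟨q :: l, r, t + 1, s⟩ := by
    simp [run, step, Config.goto, hy]
  rw [run_add, h1, PMF.pure_bind, hq, add_assoc]

lemma while_stop {y : ℕ} (hy : r y = .num 0) : Exec (.whileNZ y p) r r 1 := by
  intro n D l t s
  simp [run, step, Config.goto, hy]

lemma while_go {y : ℕ} (hy : r y ≠ .num 0) (hp : Exec p r r' τ)
    (hq : Exec (.whileNZ y p) r' r'' τ') : Exec (.whileNZ y p) r r'' (1 + τ + τ') := by
  intro n D l t s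
  have h1 : run D 1 ⟨.whileNZ y p :: l, r, t, s⟩
      = PMF.pure ⟨p :: .whileNZ y p :: l, r, t + 1, s⟩ := by
    simp [run, step, Config.goto, hy]
  rw [add_assoc, run_add, h1, PMF.pure_bind, run_add, hp, PMF.pure_bind, hq]
  simp only [add_assoc]

end Exec

/-! ### A calculus of programs with running times -/

/-- For every index `i`, the value `b i` is computed from the value `a i`, by one and the same
program without sampling instructions, in time `O(T i + 1)`. A version of the program exists for
every `base`: it expects its input and leaves its output in register `base`, and it leaves the
registers below `base` alone. -/
def Computes {ι : Type} (a b : ι → Val) (T : ι → ℕ) : Prop :=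
  ∀ base : ℕ, ∃ (p : Prog) (c : ℕ), p.SamplesOnly ∧ ∀ (i : ι) (r : ℕ → Val), r base = a i →
    ∃ r' τ, Exec p r r' τ ∧ r' base = b i ∧ (∀ j < base, r' j = r j) ∧ τ ≤ c * (T i + 1)

namespace Computes

variable {ι κ : Type} {a b c : ι → Val} {T T' : ι → ℕ}

lemma reindex (h : Computes a b T) (f : κ → ι) :
    Computes (fun k => a (f k)) (fun k => b (f k)) (fun k => T (f k)) := by
  intro base
  obtain ⟨p, c, hp, h⟩ := h base
  exact ⟨p, c, hp, fun k r hr => h (f k) r hr⟩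

lemma congr {a' b' : ι → Val} (h : Computes a b T) (ha : ∀ i, a' i = a i) (hb : ∀ i, b' i = b i) :
    Computes a' b' T := by
  rwa [show a' = a from funext ha, show b' = b from funext hb]

lemma congr_right {b' : ι → Val} (h : Computes a b T) (hb : ∀ i, b' i = b i) :
    Computes a b' T := h.congr (fun _ => rfl) hb

/-- The running time is bounded up to a constant factor only. -/
lemma mono_const (C : ℕ) (h : Computes a b T) (hT : ∀ i, T i ≤ C * (T' i + 1)) :
    Computes a b T' := by
  intro base
  obtain ⟨p, c, hp, h⟩ := h base
  refine ⟨p, c * (C + 1), hp, fun i r hr => ?_⟩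
  obtain ⟨r', τ, h1, h2, h3, h4⟩ := h i r hr
  refine ⟨r', τ, h1, h2, h3, h4.trans ?_⟩
  rw [mul_assoc]
  refine Nat.mul_le_mul_left _ ?_
  have := hT i
  have e : (C + 1) * (T' i + 1) = C * (T' i + 1) + (T' i + 1) := by ring
  omega

lemma mono (h : Computes a b T) (hT : ∀ i, T i ≤ T' i) : Computes a b T' :=
  h.mono_const 1 fun i => by have := hT i; omega

lemma trans (h : Computes a b T) (h' : Computes b c T) : Computes a c T := by
  intro base
  obtain ⟨p, k, hp, h⟩ := h base
  obtain ⟨p', k', hp', h'⟩ := h' base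
  refine ⟨.seq p p', k + k' + 1, ⟨hp, hp'⟩, fun i r hr => ?_⟩
  obtain ⟨r1, τ1, e1, b1, f1, t1⟩ := h i r hr
  obtain ⟨r2, τ2, e2, b2, f2, t2⟩ := h' i r1 b1
  refine ⟨r2, _, e1.seq e2, b2, fun j hj => (f2 j hj).trans (f1 j hj), ?_⟩
  calc 1 + τ1 + τ2 ≤ (T i + 1) + k * (T i + 1) + k' * (T i + 1) := by omega
    _ = _ := by ring

lemma id (a : ι → Val) (T : ι → ℕ) : Computes a a T := by
  intro base
  refine ⟨.copy base base, 1, trivial, fun i r hr =>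
    ⟨_, 1, Exec.copy _ _ _, ?_, fun j hj => ?_, ?_⟩⟩
  · simp [hr]
  · simp
  · omega

lemma fst (h : Computes a b T) : Computes a (fun i => (b i).fst) T := by
  refine h.trans fun base => ?_
  refine ⟨.fst base base, 1, trivial, fun i r hr => ⟨_, 1, Exec.fst _ _ _, ?_, fun j hj => ?_, ?_⟩⟩
  · simp [hr]
  · rw [Function.update_of_ne hj.ne]
  · omega

lemma snd (h : Computes a b T) : Computes a (fun i => (b i).snd) T := by
  refine h.trans fun base => ?_
  refine ⟨.snd base base, 1, trivial, fun i r hr => ⟨_, 1, Exec.snd _ _ _, ?_, fun j hj => ?_, ?_⟩⟩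
  · simp [hr]
  · rw [Function.update_of_ne hj.ne]
  · omega

lemma const (a : ι → Val) (T : ι → ℕ) (k : ℕ) : Computes a (fun _ => .num k) T := by
  intro base
  refine ⟨.const base k, 1, trivial, fun i r hr => ⟨_, 1, Exec.const _ _ _, ?_, fun j hj => ?_, ?_⟩⟩
  · simp
  · rw [Function.update_of_ne hj.ne]
  · omega

/-- The scheme for binary operations: the operands are computed in registers above `base`. -/
lemma binary (op : ℕ → ℕ → ℕ → Prog) (f : Val → Val → Val)
    (hop : ∀ x y z, (op x y z).SamplesOnly)
    (hexec : ∀ x y z r, Exec (op x y z) r (Function.update r x (f (r y) (r z))) 1)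
    (hb : Computes a b T) (hc : Computes a c T) : Computes a (fun i => f (b i) (c i)) T := by
  intro base
  obtain ⟨p, k, hp, h⟩ := hb (base + 1)
  obtain ⟨p', k', hp', h'⟩ := hc (base + 2)
  refine ⟨.seq (.copy (base + 1) base) (.seq p (.seq (.copy (base + 2) base) (.seq p'
    (op base (base + 1) (base + 2))))), k + k' + 7, ⟨trivial, hp, trivial, hp', hop _ _ _⟩,
    fun i r hr => ?_⟩
  obtain ⟨r1, τ1, e1, b1, f1, t1⟩ := h i (Function.update r (base + 1) (r base)) (by simp [hr])
  have hr1 : r1 base = a i := by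
    rw [f1 base (by omega), Function.update_of_ne (by omega), hr]
  obtain ⟨r2, τ2, e2, b2, f2, t2⟩ := h' i (Function.update r1 (base + 2) (r1 base)) (by simp [hr1])
  refine ⟨_, _, (Exec.copy _ _ _).seq (e1.seq ((Exec.copy _ _ _).seq (e2.seq (hexec _ _ _ _)))),
    ?_, fun j hj => ?_, ?_⟩
  · rw [Function.update_self, b2, f2 (base + 1) (by omega), Function.update_of_ne (by omega), b1]
  · rw [Function.update_of_ne hj.ne, f2 j (by omega), Function.update_of_ne (by omega),
      f1 j (by omega), Function.update_of_ne (by omega)]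
  · calc _ ≤ 7 * (T i + 1) + k * (T i + 1) + k' * (T i + 1) := by omega
      _ = _ := by ring

lemma pair (hb : Computes a b T) (hc : Computes a c T) :
    Computes a (fun i => .pair (b i) (c i)) T :=
  binary .pair .pair (fun _ _ _ => trivial) Exec.pair hb hc

lemma add (hb : Computes a b T) (hc : Computes a c T) :
    Computes a (fun i => .num ((b i).toNat + (c i).toNat)) T :=
  binary .add (fun u v => .num (u.toNat + v.toNat)) (fun _ _ _ => trivial) Exec.add hb hc

lemma sub (hb : Computes a b T) (hc : Computes a c T) :
    Computes a (fun i => .num ((b i).toNat - (c i).toNat)) T :=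
  binary .sub (fun u v => .num (u.toNat - v.toNat)) (fun _ _ _ => trivial) Exec.sub hb hc

/-- A call of the subroutine `h` on the argument `f i`. -/
lemma call {x y : κ → Val} {U : κ → ℕ} (h : Computes x y U) (f : ι → κ)
    (hx : Computes a (fun i => x (f i)) T) (hU : ∀ i, U (f i) ≤ T i) :
    Computes a (fun i => y (f i)) T :=
  hx.trans ((h.reindex f).mono hU)

/-- Case distinction; the time is that of the branch taken. -/
lemma ite {t e : ι → Val} (ht : Computes a t T) (hb : Computes a b T) (hc : Computes a c T)
    (he : ∀ i, t i ≠ .num 0 → e i = b i) (he' : ∀ i, t i = .num 0 → e i = c i) :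
    Computes a e T := by
  intro base
  obtain ⟨pt, kt, hpt, h0⟩ := ht (base + 1)
  obtain ⟨p, k, hp, h⟩ := hb base
  obtain ⟨p', k', hp', h'⟩ := hc base
  refine ⟨.seq (.copy (base + 1) base) (.seq pt (.ifNZ (base + 1) p p')), kt + k + k' + 5,
    ⟨trivial, hpt, hp, hp'⟩, fun i r hr => ?_⟩
  obtain ⟨r1, τ1, e1, b1, f1, t1⟩ := h0 i (Function.update r (base + 1) (r base)) (by simp [hr])
  have hr1 : r1 base = a i := by
    rw [f1 base (by omega), Function.update_of_ne (by omega), hr]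
  by_cases hz : t i = .num 0
  · obtain ⟨r2, τ2, e2, b2, f2, t2⟩ := h' i r1 hr1
    refine ⟨r2, _, (Exec.copy _ _ _).seq (e1.seq (Exec.ifNZ_neg (b1.trans hz) e2)),
      b2.trans (he' i hz).symm, fun j hj => ?_, ?_⟩
    · rw [f2 j hj, f1 j (by omega), Function.update_of_ne (by omega)]
    · calc _ ≤ 5 * (T i + 1) + kt * (T i + 1) + k' * (T i + 1) := by omega
        _ ≤ 5 * (T i + 1) + kt * (T i + 1) + k' * (T i + 1) + k * (T i + 1) := Nat.le_add_right _ _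
        _ = _ := by ring
  · obtain ⟨r2, τ2, e2, b2, f2, t2⟩ := h i r1 hr1
    refine ⟨r2, _, (Exec.copy _ _ _).seq (e1.seq (Exec.ifNZ_pos (by rw [b1]; exact hz) e2)),
      b2.trans (he i hz).symm, fun j hj => ?_, ?_⟩
    · rw [f2 j hj, f1 j (by omega), Function.update_of_ne (by omega)]
    · calc _ ≤ 5 * (T i + 1) + kt * (T i + 1) + k * (T i + 1) := by omega
        _ ≤ 5 * (T i + 1) + kt * (T i + 1) + k * (T i + 1) + k' * (T i + 1) := Nat.le_add_right _ _
        _ = _ := by ring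

/-- A loop with `N i` rounds; the first component of the state tells whether to go on. -/
lemma loop (N : ι → ℕ) (S : ι → ℕ → Val) (T : ι → ℕ)
    (hgo : ∀ i, ∀ j < N i, (S i j).fst ≠ .num 0) (hend : ∀ i, (S i (N i)).fst = .num 0)
    (hstep : Computes (fun p : {p : ι × ℕ // p.2 < N p.1} => S p.1.1 p.1.2)
      (fun p => S p.1.1 (p.1.2 + 1)) (fun p => T p.1.1)) :
    Computes (fun i => S i 0) (fun i => S i (N i)) (fun i => N i * (T i + 1)) := by
  intro base
  obtain ⟨p, k, hp, h⟩ := hstep base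
  refine ⟨.seq (.fst (base + 1) base) (.whileNZ (base + 1) (.seq p (.fst (base + 1) base))), k + 5,
    ⟨trivial, hp, trivial⟩, fun i r hr => ?_⟩
  have main : ∀ j m, j + m = N i → ∀ r : ℕ → Val, r base = S i j → r (base + 1) = (S i j).fst →
      ∃ r' τ, Exec (.whileNZ (base + 1) (.seq p (.fst (base + 1) base))) r r' τ ∧
        r' base = S i (N i) ∧ (∀ j < base, r' j = r j) ∧ τ ≤ m * (k + 3) * (T i + 1) + 1 := by
    intro j m
    induction m generalizing j with
    | zero =>
      intro hj r h1 h2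
      obtain rfl : j = N i := by omega
      exact ⟨r, 1, Exec.while_stop (h2.trans (hend i)), h1, fun _ _ => rfl, by omega⟩
    | succ m ih =>
      intro hj r h1 h2
      have hlt : j < N i := by omega
      obtain ⟨r1, τ1, e1, b1, f1, t1⟩ := h ⟨(i, j), hlt⟩ r h1
      obtain ⟨r2, τ2, e2, b2, f2, t2⟩ := ih (j + 1) (by omega)
        (Function.update r1 (base + 1) (r1 base).fst) (by simpa using b1) (by simp [b1])
      refine ⟨r2, _, Exec.while_go (by rw [h2]; exact hgo i j hlt)
        (e1.seq (Exec.fst _ _ _)) e2, b2, fun l hl => ?_, ?_⟩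
      · rw [f2 l hl, Function.update_of_ne (by omega), f1 l hl]
      · have t1' : τ1 ≤ k * (T i + 1) := t1
        have e : (m + 1) * (k + 3) * (T i + 1)
            = m * (k + 3) * (T i + 1) + k * (T i + 1) + 3 * (T i + 1) := by ring
        omega
  obtain ⟨r', τ, e, b', f, t⟩ := main 0 (N i) (by omega)
    (Function.update r (base + 1) (r base).fst) (by simpa using hr) (by simp [hr])
  refine ⟨r', _, (Exec.fst _ _ _).seq e, b', fun j hj => ?_, ?_⟩
  · rw [f j hj, Function.update_of_ne (by omega)]
  · beta_reduce
    have e1 : N i * (k + 3) * (T i + 1) = (k + 3) * (N i * (T i + 1)) := by ring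
    have e2 : (k + 5) * (N i * (T i + 1) + 1)
        = (k + 3) * (N i * (T i + 1)) + 2 * (N i * (T i + 1)) + k + 5 := by ring
    omega

/-- Counted iteration, with the input `a i` at the disposal of each round. -/
lemma iterate {N : ι → ℕ} (st : ι → ℕ → Val) (hN : Computes a (fun i => .num (N i)) T)
    (h0 : Computes a (fun i => st i 0) T)
    (hstep : Computes (fun p : {p : ι × ℕ // p.2 < N p.1} => .pair (a p.1.1) (st p.1.1 p.1.2))
      (fun p => st p.1.1 (p.1.2 + 1)) (fun p => T' p.1.1)) :
    Computes a (fun i => st i (N i)) (fun i => T i + N i * (T' i + 1)) := by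
  have hinit : Computes a (fun i => .pair (.num (N i - 0)) (.pair (a i) (st i 0)))
      (fun i => T i + N i * (T' i + 1)) :=
    (hN.pair ((id a T).pair h0)).mono fun i => Nat.le_add_right _ _
  have hl := loop N (fun i j => .pair (.num (N i - j)) (.pair (a i) (st i j))) T'
    (fun i j hj => by simp only [Val.fst, ne_eq, Val.num.injEq]; omega)
    (fun i => by simp [Val.fst]) (by
      have h1 := id (fun p : {p : ι × ℕ // p.2 < N p.1} =>
        Val.pair (.num (N p.1.1 - p.1.2)) (.pair (a p.1.1) (st p.1.1 p.1.2))) (fun p => T' p.1.1)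
      exact ((h1.fst.sub (const _ _ 1)).pair (h1.snd.fst.pair (h1.snd.trans hstep))).congr_right
        fun p => by simp [Val.fst, Val.snd, Val.toNat, Nat.sub_sub])
  exact (hinit.trans (hl.mono fun i => Nat.le_add_left _ _)).snd.snd

end Computes

/-- Lists as S-expressions. -/
def encList {β : Type} (enc : β → Val) : List β → Val
  | [] => .num 0
  | x :: l => .pair (enc x) (encList enc l)

namespace Computes

variable {ι : Type} {a : ι → Val} {T T' : ι → ℕ}

/-- Left fold over a list, with the input `a i` at the disposal of each round. -/
lemma foldl {β σ : Type} {encβ : β → Val} {encσ : σ → Val} {l : ι → List β} {s₀ : ι → σ}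
    {g : ι → σ → β → σ} (hl : Computes a (fun i => encList encβ (l i)) T)
    (h0 : Computes a (fun i => encσ (s₀ i)) T)
    (hstep : Computes (fun p : {p : ι × σ × β // p.2.2 ∈ l p.1} =>
        .pair (a p.1.1) (.pair (encσ p.1.2.1) (encβ p.1.2.2)))
      (fun p => encσ (g p.1.1 p.1.2.1 p.1.2.2)) (fun p => T' p.1.1)) :
    Computes a (fun i => encσ ((l i).foldl (g i) (s₀ i)))
      (fun i => T i + (l i).length * (T' i + 1)) := by
  set S : ι → ℕ → Val := fun i j => .pair (encList encβ ((l i).drop j))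
    (.pair (a i) (encσ (((l i).take j).foldl (g i) (s₀ i)))) with hS
  have hinit : Computes a (fun i => S i 0) (fun i => T i + (l i).length * (T' i + 1)) := by
    simp only [hS, List.drop_zero, List.take_zero, List.foldl_nil]
    exact (hl.pair ((id a T).pair h0)).mono fun i => Nat.le_add_right _ _
  have hloop := loop (fun i => (l i).length) S T'
    (fun i j hj => by
      simp only [hS, Val.fst]
      rw [List.drop_eq_getElem_cons hj]
      simp [encList])
    (fun i => by simp [hS, Val.fst, encList]) (by
      have h1 := id (fun p : {p : ι × ℕ // p.2 < (l p.1).length} => S p.1.1 p.1.2)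
        (fun p => T' p.1.1)
      have h2 := hstep.reindex (fun p : {p : ι × ℕ // p.2 < (l p.1).length} =>
        ⟨(p.1.1, ((l p.1.1).take p.1.2).foldl (g p.1.1) (s₀ p.1.1), (l p.1.1)[p.1.2]'p.2),
          List.getElem_mem _⟩)
      refine (h1.fst.snd.pair (h1.snd.fst.pair
        (Computes.trans ((h1.snd.fst.pair (h1.snd.snd.pair h1.fst.fst)).congr_right ?_)
          h2))).congr_right ?_
      · intro p
        simp only [hS, Val.fst, Val.snd]
        rw [List.drop_eq_getElem_cons p.2]
        rfl
      · intro p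
        simp only [hS, Val.fst, Val.snd]
        rw [List.drop_eq_getElem_cons p.2, List.take_succ_eq_append_getElem p.2, List.foldl_append]
        rfl)
  have hfin := (hinit.trans (hloop.mono fun i => Nat.le_add_left _ _)).snd.snd
  refine hfin.congr_right fun i => ?_
  simp [hS, Val.snd]

end Computes

/-! ### Subroutines -/

/-- A bit as an S-expression. -/
def encBit (b : Bool) : Val := .num (if b then 1 else 0)

/-- A record as an S-expression. -/
def encRecord (r : Record) : Val := .pair (encList encBit r.1) (encList encBit r.2)

/-- A node of the search as an S-expression. -/
def encState (s : State) : Val := .pair (encList encRecord s.1) (encList .num s.2)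

/-- The parameters of the search as an S-expression. -/
def encParams (P : Params) : Val :=
  .pair (.num P.m) (.pair (.num P.A) (.pair (.num P.K) (.num P.G)))

lemma ofPoint_eq {n : ℕ} (x : Fin n → Bool) : Val.ofPoint x = encList encBit (List.ofFn x) := by
  unfold Val.ofPoint
  generalize List.ofFn x = l
  induction l with
  | nil => rfl
  | cons b l ih => simp only [List.foldr_cons, ih, encList, encBit]

lemma snd_encList {β : Type} (enc : β → Val) (l : List β) :
    (encList enc l).snd = encList enc l.tail := by
  cases l <;> rfl

lemma fst_encBits (l : List Bool) : (encList encBit l).fst = encBit (l.getD 0 false) := by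
  cases l <;> rfl

namespace Computes

/-- The time for the access to a bit of a list is its index. -/
lemma getBit : Computes (fun p : ℕ × List Bool => .pair (.num p.1) (encList encBit p.2))
    (fun p => encBit (p.2.getD p.1 false)) (fun p => p.1) := by
  have ctx := id (fun p : ℕ × List Bool => .pair (.num p.1) (encList encBit p.2)) (fun _ => 0)
  have h := iterate (N := fun p => p.1) (T' := fun _ => 0)
    (fun (p : ℕ × List Bool) j => encList encBit (p.2.drop j)) ctx.fst ctx.snd
    ((id _ _).snd.snd.congr_right fun p => by
      rw [← List.tail_drop, ← snd_encList]; rfl)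
  refine (h.mono fun p => by simp).fst.congr_right fun p => ?_
  rw [fst_encBits]
  simp [List.getD_eq_getElem?_getD]

/-- Multiplication by repeated addition; the time is the first factor. -/
lemma mul : Computes (fun p : ℕ × ℕ => .pair (.num p.1) (.num p.2))
    (fun p => .num (p.1 * p.2)) (fun p => p.1) := by
  have ctx := id (fun p : ℕ × ℕ => Val.pair (.num p.1) (.num p.2)) (fun _ => 0)
  have h := iterate (N := fun p => p.1) (T' := fun _ => 0)
    (fun (p : ℕ × ℕ) j => .num (j * p.2)) ctx.fst ((const _ _ 0).congr_right fun p => by simp)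
    (((id _ _).snd.add (id _ _).fst.snd).congr_right fun p => by
      simp [Val.fst, Val.snd, Val.toNat, Nat.succ_mul])
  exact h.mono fun p => by simp

/-- Multiplication by a power of two; the time is the exponent, as doubling is a single step. -/
lemma shift : Computes (fun p : ℕ × ℕ => .pair (.num p.1) (.num p.2))
    (fun p => .num (p.1 * 2 ^ p.2)) (fun p => p.2) := by
  have ctx := id (fun p : ℕ × ℕ => Val.pair (.num p.1) (.num p.2)) (fun _ => 0)
  have h := iterate (N := fun p => p.2) (T' := fun _ => 0)
    (fun (p : ℕ × ℕ) j => .num (p.1 * 2 ^ j)) ctx.snd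
    (ctx.fst.congr_right fun p => by simp [Val.fst])
    (((id _ _).snd.add (id _ _).snd).congr_right fun p => by
      simp only [Val.snd, Val.toNat, pow_succ]; congr 1; ring)
  exact h.mono fun p => by simp

lemma length {β : Type} (enc : β → Val) : Computes (fun l : List β => encList enc l)
    (fun l => .num l.length) (fun l => l.length) := by
  have h := foldl (T := fun _ => 0) (T' := fun _ => 0) (l := fun l : List β => l) (encσ := Val.num)
    (s₀ := fun _ => 0) (g := fun _ c _ => c + 1) (id (encList enc) _) (const _ _ 0)
    (((id _ _).snd.fst.add (const _ _ 1)).congr_right fun p => by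
      simp [Val.fst, Val.snd, Val.toNat])
  refine (h.mono fun p => by simp).congr_right fun l => ?_
  have : ∀ c, l.foldl (fun c _ => c + 1) c = c + l.length := by
    induction l with
    | nil => simp
    | cons b l ih => intro c; rw [List.foldl_cons, ih, List.length_cons]; omega
  rw [this, zero_add]

lemma reverse {β : Type} (enc : β → Val) : Computes (fun l : List β => encList enc l)
    (fun l => encList enc l.reverse) (fun l => l.length) := by
  have h := foldl (T := fun _ => 0) (T' := fun _ => 0) (l := fun l : List β => l)
    (encσ := encList enc)
    (s₀ := fun _ => []) (g := fun _ acc x => x :: acc) (id (encList enc) _) (const _ _ 0)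
    (((id _ _).snd.snd.pair (id _ _).snd.fst).congr_right fun p => rfl)
  exact (h.mono fun p => by simp).congr_right fun l => by rw [List.foldl_flip_cons_eq_append']; simp

/-- Filtering, in reversed order; `t` is the test, nonzero where the element is kept. -/
lemma filter {ι β : Type} {a : ι → Val} {enc : β → Val} {l : ι → List β} {T T' : ι → ℕ}
    {f : ι → β → Bool} (t : ι → β → Val) (hl : Computes a (fun i => encList enc (l i)) T)
    (ht : Computes (fun p : {p : ι × β // p.2 ∈ l p.1} => .pair (a p.1.1) (enc p.1.2))
      (fun p => t p.1.1 p.1.2) (fun p => T' p.1.1))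
    (hf : ∀ i x, f i x = true ↔ t i x ≠ .num 0) :
    Computes a (fun i => encList enc ((l i).filter (f i)).reverse)
      (fun i => T i + (l i).length * (T' i + 1)) := by
  have h := foldl (T := T) (T' := T') (l := l) (encσ := encList enc) (encβ := enc)
    (s₀ := fun _ => []) (g := fun i acc x => if f i x then x :: acc else acc) (a := a) hl
    (const _ _ 0) (by
      have ctx := id (fun p : {p : ι × List β × β // p.2.2 ∈ l p.1} =>
        Val.pair (a p.1.1) (.pair (encList enc p.1.2.1) (enc p.1.2.2))) (fun p => T' p.1.1)
      have h1 := ht.call (T := fun p => T' p.1.1)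
        (fun p : {p : ι × List β × β // p.2.2 ∈ l p.1} => ⟨(p.1.1, p.1.2.2), p.2⟩)
        (ctx.fst.pair ctx.snd.snd) (fun p => le_rfl)
      refine ite h1 (ctx.snd.snd.pair ctx.snd.fst) ctx.snd.fst (fun p hp => ?_) (fun p hp => ?_)
      · rw [if_pos ((hf _ _).2 hp)]; rfl
      · rw [if_neg fun h => (hf _ _).1 h hp]; rfl)
  refine h.congr_right fun i => ?_
  have : ∀ (l acc : List β), l.foldl (fun acc x => if f i x then x :: acc else acc) acc
      = (l.filter (f i)).reverse ++ acc := by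
    intro l
    induction l with
    | nil => simp
    | cons x l ih =>
      intro acc
      rw [List.foldl_cons, ih]
      by_cases hx : f i x <;> simp [hx]
  rw [this, List.append_nil]

lemma score : Computes (fun p : ℕ × List Record => .pair (.num p.1) (encList encRecord p.2))
    (fun p => .num (DTLearn.score p.1 p.2)) (fun p => (p.2.length + 1) * (p.1 + 1)) := by
  have ctx := id (fun p : ℕ × List Record => Val.pair (.num p.1) (encList encRecord p.2))
    (fun p => (p.2.length + 1) * (p.1 + 1))
  have hcount := foldl (T := fun _ => 0) (T' := fun p => p.1) (l := fun p : ℕ × List Record => p.2)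
    (encσ := Val.num) (s₀ := fun _ => 0)
    (g := fun p c r => c + if r.2.getD p.1 false then 1 else 0)
    (id (fun p : ℕ × List Record => Val.pair (.num p.1) (encList encRecord p.2)) _).snd
    (const _ _ 0) (by
      have c2 := id (fun p : {p : (ℕ × List Record) × ℕ × Record // p.2.2 ∈ p.1.2} =>
        Val.pair (.pair (.num p.1.1.1) (encList encRecord p.1.1.2))
          (.pair (.num p.1.2.1) (encRecord p.1.2.2))) (fun p => p.1.1.1)
      exact (c2.snd.fst.add (getBit.call (T := fun p => p.1.1.1)
        (fun p : {p : (ℕ × List Record) × ℕ × Record // p.2.2 ∈ p.1.2} => (p.1.1.1, p.1.2.2.2))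
        (c2.fst.fst.pair c2.snd.snd.snd) (fun p => le_rfl))).congr_right fun p => rfl)
  have hc : Computes (fun p : ℕ × List Record => .pair (.num p.1) (encList encRecord p.2))
      (fun p => .num (p.2.countP (fun r => r.2.getD p.1 false)))
      (fun p => (p.2.length + 1) * (p.1 + 1)) := by
    refine (hcount.mono fun p => by nlinarith).congr_right fun p => ?_
    have : ∀ (l : List Record) (c : ℕ),
        l.foldl (fun c r => c + if r.2.getD p.1 false then 1 else 0) c
        = c + l.countP (fun r => r.2.getD p.1 false) := by
      intro l
      induction l with
      | nil => simp
      | cons r l ih => intro c; rw [List.foldl_cons, ih, List.countP_cons]; omega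
    rw [this, zero_add]
  have hlen := (length encRecord).call (T := fun p => (p.2.length + 1) * (p.1 + 1))
    (fun p : ℕ × List Record => p.2) ctx.snd (fun p => by nlinarith)
  exact ((hc.add hc).sub hlen).congr_right fun p => by
    simp only [Val.toNat, DTLearn.score, two_mul]

lemma branch (b : Bool) : Computes (fun p : ℕ × State => .pair (.num p.1) (encState p.2))
    (fun p => encState (DTLearn.branch b p.1 p.2))
    (fun p => (p.2.1.length + p.2.2.length + 1) * (p.1 + 1)) := by
  have ctx := id (fun p : ℕ × State => Val.pair (.num p.1) (encState p.2)) (fun _ => 0)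
  have h1 := filter (T := fun _ => 0) (T' := fun p => p.1) (l := fun p : ℕ × State => p.2.1)
    (f := fun p r => decide (r.1.getD p.1 false = b))
    (fun p r => encBit (r.1.getD p.1 false == b)) ctx.snd.fst (by
      have c2 := id (fun p : {p : (ℕ × State) × Record // p.2 ∈ p.1.2.1} =>
        Val.pair (.pair (.num p.1.1.1) (encState p.1.1.2)) (encRecord p.1.2)) (fun p => p.1.1.1)
      have hb := getBit.call (T := fun p => p.1.1.1)
        (fun p : {p : (ℕ × State) × Record // p.2 ∈ p.1.2.1} => (p.1.1.1, p.1.2.1))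
        (c2.fst.fst.pair c2.snd.fst) (fun p => le_rfl)
      cases b with
      | true => exact hb.congr_right fun p => by simp
      | false =>
        refine ((const _ _ 1).sub hb).congr_right fun p => ?_
        cases p.1.2.1.getD p.1.1.1 false <;> simp [encBit, Val.toNat])
    (fun p r => by by_cases h : r.1.getD p.1 false = b <;> simp [encBit])
  have h2 := filter (T := fun _ => 0) (T' := fun p => p.1) (l := fun p : ℕ × State => p.2.2)
    (f := fun p j => decide (j ≠ p.1))
    (fun p j => .num ((j - p.1) + (p.1 - j))) ctx.snd.snd (by
      have c2 := id (fun p : {p : (ℕ × State) × ℕ // p.2 ∈ p.1.2.2} =>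
        Val.pair (.pair (.num p.1.1.1) (encState p.1.1.2)) (.num p.1.2)) (fun p => p.1.1.1)
      exact ((c2.snd.sub c2.fst.fst).add (c2.fst.fst.sub c2.snd)).congr_right fun p => rfl)
    (fun p j => by simp only [decide_eq_true_eq, ne_eq, Val.num.injEq]; omega)
  refine ((h1.mono fun p => ?_).pair (h2.mono fun p => ?_)).congr_right fun p => rfl
  · nlinarith
  · nlinarith

end Computes

/-! ### The search procedure as a program -/

/-- The bounds on a node of the search that its processing time depends on. -/
structure Small (n : ℕ) (P : Params) (s : State) : Prop where
  records : s.1.length ≤ P.m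
  length : s.2.length ≤ n
  lt : ∀ j ∈ s.2, j < n

lemma Small.branch {n : ℕ} {P : Params} {s : State} (hs : Small n P s) (b : Bool) (i : ℕ) :
    Small n P (branch b i s) where
  records := by
    rw [DTLearn.branch, List.length_reverse]
    exact (List.length_filter_le _ _).trans hs.records
  length := by
    rw [DTLearn.branch, List.length_reverse]
    exact (List.length_filter_le _ _).trans hs.length
  lt j hj := hs.lt j (List.mem_filter.1 (List.mem_reverse.1 hj)).1

/-- The time, up to a constant, in which a node of the search is processed. -/
def nodeTime (n : ℕ) (P : Params) : ℕ := (n + 1) ^ 2 * (P.m + 1) * (P.A + P.K + 1)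

/-- A node of the search together with bounds. -/
abbrev SmallNode : Type := {p : ℕ × Params × State // Small p.1 p.2.1 p.2.2}

lemma length_cands_le (P : Params) (s : State) : (cands P s).length ≤ P.K := by
  rw [cands, List.length_reverse]; exact List.length_take_le _ _

lemma mem_of_mem_cands {P : Params} {s : State} {j : ℕ} (hj : j ∈ cands P s) : j ∈ s.2 := by
  rw [cands, List.mem_reverse] at hj
  exact (List.mem_filter.1 (List.mem_of_mem_take hj)).1

namespace Computes

lemma cands : Computes (fun p : SmallNode => .pair (encParams p.1.2.1) (encState p.1.2.2))
    (fun p => encList .num (DTLearn.cands p.1.2.1 p.1.2.2))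
    (fun p => nodeTime p.1.1 p.1.2.1) := by
  have ctx := id (fun p : SmallNode => Val.pair (encParams p.1.2.1) (encState p.1.2.2)) (fun _ => 0)
  -- the time for one coordinate
  set U : SmallNode → ℕ := fun p => (p.1.2.1.m + 1) * (p.1.1 + 1) + p.1.2.1.A with hU
  have h := foldl (T := fun _ => 0) (T' := U) (l := fun p : SmallNode => p.1.2.2.2)
    (encσ := fun q : ℕ × List ℕ => .pair (.num q.1) (encList .num q.2))
    (s₀ := fun p => (p.1.2.1.K, []))
    (g := fun p q j => if q.1 ≠ 0 ∧ p.1.2.2.1.length + p.1.2.1.G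
      < p.1.2.1.A * DTLearn.score j p.1.2.2.1 then (q.1 - 1, j :: q.2) else q) ctx.snd.snd
    ((ctx.fst.snd.snd.fst.pair (const _ _ 0)).congr_right fun p => rfl) (by
      set κ := {p : SmallNode × (ℕ × List ℕ) × ℕ // p.2.2 ∈ p.1.1.2.2.2}
      have hlt : ∀ p : κ, p.1.2.2 < p.1.1.1.1 := fun p => p.1.1.2.lt _ p.2
      have hlen : ∀ p : κ, p.1.1.1.2.2.1.length ≤ p.1.1.1.2.1.m := fun p => p.1.1.2.records
      have c2 := id (fun p : κ =>
        Val.pair (.pair (encParams p.1.1.1.2.1) (encState p.1.1.1.2.2))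
          (.pair (.pair (.num p.1.2.1.1) (encList .num p.1.2.1.2)) (.num p.1.2.2)))
        (fun p => U p.1.1)
      have hscore := score.call (T := fun p : κ => U p.1.1)
        (fun p => (p.1.2.2, p.1.1.1.2.2.1)) (c2.snd.snd.pair c2.fst.snd.fst) (fun p => by
          refine le_trans ?_ (Nat.le_add_right _ _)
          exact Nat.mul_le_mul (Nat.succ_le_succ (hlen p)) (Nat.succ_le_succ (hlt p).le))
      have hmul := mul.call (T := fun p : κ => U p.1.1)
        (fun p => (p.1.1.1.2.1.A, DTLearn.score p.1.2.2 p.1.1.1.2.2.1))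
        (c2.fst.fst.snd.fst.pair hscore) (fun p => Nat.le_add_left _ _)
      have hl := (length encRecord).call (T := fun p : κ => U p.1.1)
        (fun p => p.1.1.1.2.2.1) c2.fst.snd.fst (fun p => by
          refine le_trans ?_ (Nat.le_add_right _ _)
          have := hlen p; nlinarith)
      have htest := hmul.sub (hl.add c2.fst.fst.snd.snd.snd)
      have hin := ite (e := fun p : κ => if p.1.1.1.2.2.1.length + p.1.1.1.2.1.G
          < p.1.1.1.2.1.A * DTLearn.score p.1.2.2 p.1.1.1.2.2.1 then
          Val.pair (.num (p.1.2.1.1 - 1)) (encList .num (p.1.2.2 :: p.1.2.1.2)) else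
          .pair (.num p.1.2.1.1) (encList .num p.1.2.1.2)) htest
        ((c2.snd.fst.fst.sub (const _ _ 1)).pair (c2.snd.snd.pair c2.snd.fst.snd)) c2.snd.fst
        (fun p hp => by
          rw [if_pos]
          · rfl
          · simp only [Val.toNat, encParams, Val.fst, Val.snd, ne_eq, Val.num.injEq] at hp
            omega)
        (fun p hp => by
          rw [if_neg]
          · rfl
          · simp only [Val.toNat, encParams, Val.fst, Val.snd, Val.num.injEq] at hp
            omega)
      refine ite c2.snd.fst.fst hin c2.snd.fst (fun p hp => ?_) (fun p hp => ?_)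
      · simp only [Val.fst, Val.snd, ne_eq, Val.num.injEq] at hp
        simp only [ne_eq, hp, not_false_eq_true, true_and]
        split_ifs <;> rfl
      · simp only [Val.fst, Val.snd, Val.num.injEq] at hp
        rw [if_neg (by simp [hp])]
        rfl)
  refine (h.snd.mono_const 2 fun p => ?_).congr_right fun p => ?_
  · have h1 := p.2.length
    have h2 : p.1.2.2.2.length * (U p + 1) ≤ p.1.1 * (U p + 1) := Nat.mul_le_mul_right _ h1
    refine (zero_add (p.1.2.2.2.length * (U p + 1))).le.trans (h2.trans ?_)
    simp only [hU, nodeTime]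
    generalize p.1.1 = n; generalize p.1.2.1.m = m; generalize p.1.2.1.A = A
    generalize p.1.2.1.K = K
    have e : 2 * ((n + 1) ^ 2 * (m + 1) * (A + K + 1) + 1)
      = n * ((m + 1) * (n + 1) + A + 1) + (n * n * m * (2 * A + 2 * K + 1)
       + n * n * (2 * A + 2 * K + 1) + n * m * (4 * A + 4 * K + 3) + n * (3 * A + 4 * K + 2)
       + m * (2 * A + 2 * K + 2) + (2 * A + 2 * K + 2) + 2) := by ring
    omega
  · have : ∀ (l out : List ℕ) (k : ℕ), (l.foldl (fun (q : ℕ × List ℕ) j =>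
        if q.1 ≠ 0 ∧ p.1.2.2.1.length + p.1.2.1.G
          < p.1.2.1.A * DTLearn.score j p.1.2.2.1 then (q.1 - 1, j :: q.2) else q) (k, out)).2
        = ((l.filter fun j => p.1.2.2.1.length + p.1.2.1.G
            < p.1.2.1.A * DTLearn.score j p.1.2.2.1).take k).reverse ++ out := by
      intro l
      induction l with
      | nil => simp
      | cons j l ih =>
        intro out k
        rw [List.foldl_cons]
        by_cases ht : p.1.2.2.1.length + p.1.2.1.G < p.1.2.1.A * DTLearn.score j p.1.2.2.1
        · cases k with
          | zero => simp [ih]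
          | succ k => simp [ih, ht]
        · simp [ih, ht]
    simp only [Val.snd, this, List.append_nil]
    rfl

lemma le_nodeTime (n : ℕ) (P : Params) : (P.m + 1) * (n + 1) ^ 2 ≤ nodeTime n P := by
  rw [nodeTime, mul_comm ((n + 1) ^ 2)]
  exact Nat.le_mul_of_pos_right _ (by omega)

lemma le_nodeTime' (n : ℕ) (P : Params) : n ≤ nodeTime n P :=
  (Nat.le_succ _).trans ((Nat.le_self_pow two_ne_zero _).trans
    ((Nat.le_mul_of_pos_left _ (by positivity)).trans (le_nodeTime n P)))

lemma leafScore : Computes (fun p : SmallNode => .pair (encParams p.1.2.1) (encState p.1.2.2))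
    (fun p => .num (DTLearn.leafScore p.1.2.2)) (fun p => nodeTime p.1.1 p.1.2.1) := by
  have h := foldl (T := fun _ => 0) (T' := fun p => (p.1.2.1.m + 1) * (p.1.1 + 1))
    (l := fun p : SmallNode => p.1.2.2.2) (encσ := Val.num) (s₀ := fun p => 0)
    (g := fun p c j => c + DTLearn.score j p.1.2.2.1)
    (id (fun p : SmallNode => Val.pair (encParams p.1.2.1) (encState p.1.2.2)) (fun _ => 0)).snd.snd
    (const _ _ 0) (by
      set κ := {p : SmallNode × ℕ × ℕ // p.2.2 ∈ p.1.1.2.2.2}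
      have c2 := id (fun p : κ => Val.pair (.pair (encParams p.1.1.1.2.1) (encState p.1.1.1.2.2))
          (.pair (.num p.1.2.1) (.num p.1.2.2)))
        (fun p => (p.1.1.1.2.1.m + 1) * (p.1.1.1.1 + 1))
      have hscore := score.call (T := fun p : κ => (p.1.1.1.2.1.m + 1) * (p.1.1.1.1 + 1))
        (fun p => (p.1.2.2, p.1.1.1.2.2.1)) (c2.snd.snd.pair c2.fst.snd.fst) (fun p =>
          Nat.mul_le_mul (Nat.succ_le_succ p.1.1.2.records)
            (Nat.succ_le_succ (p.1.1.2.lt _ p.2).le))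
      exact (c2.snd.fst.add hscore).congr_right fun p => by
        simp only [Val.toNat, Val.fst, Val.snd])
  refine (h.mono_const 2 fun p => ?_).congr_right fun p => ?_
  · have h1 := p.2.length
    have h2 := le_nodeTime p.1.1 p.1.2.1
    have h3 := Nat.mul_le_mul_right ((p.1.2.1.m + 1) * (p.1.1 + 1) + 1) h1
    have h4 : p.1.1 * ((p.1.2.1.m + 1) * (p.1.1 + 1) + 1)
        ≤ (p.1.2.1.m + 1) * (p.1.1 + 1) ^ 2 + p.1.1 := by
      generalize p.1.1 = n; generalize p.1.2.1.m = m
      nlinarith [Nat.zero_le (m * n)]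
    have h5 := le_nodeTime' p.1.1 p.1.2.1
    omega
  · have : ∀ (l : List ℕ) (c : ℕ), l.foldl (fun c j => c + DTLearn.score j p.1.2.2.1) c
        = c + (l.map fun j => DTLearn.score j p.1.2.2.1).sum := by
      intro l
      induction l with
      | nil => simp
      | cons j l ih => intro c; rw [List.foldl_cons, ih, List.map_cons, List.sum_cons]; omega
    rw [this, zero_add, DTLearn.leafScore]

attribute [irreducible] nodeTime

/-- A leaf with its score. -/
lemma leafVal : Computes (fun p : SmallNode => .pair (encParams p.1.2.1) (encState p.1.2.2))
    (fun p => .pair (.num (DTLearn.leafVal p.1.2.1 p.1.2.2).1) (DTLearn.leafVal p.1.2.1 p.1.2.2).2)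
    (fun p => nodeTime p.1.1 p.1.2.1) := by
  have ctx := id (fun p : SmallNode => Val.pair (encParams p.1.2.1) (encState p.1.2.2))
    (fun p => nodeTime p.1.1 p.1.2.1)
  have hm : ∀ p : SmallNode, p.1.2.1.m ≤ nodeTime p.1.1 p.1.2.1 := fun p =>
    (Nat.le_succ _).trans ((Nat.le_mul_of_pos_right _ (by positivity)).trans (le_nodeTime _ _))
  have hn : ∀ p : SmallNode, p.1.1 ≤ nodeTime p.1.1 p.1.2.1 := fun p => le_nodeTime' _ _
  have hlen := (length encRecord).call (T := fun p => nodeTime p.1.1 p.1.2.1)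
    (fun p : SmallNode => p.1.2.2.1) ctx.snd.fst (fun p => p.2.records.trans (hm p))
  have hfree := (length Val.num).call (T := fun p => nodeTime p.1.1 p.1.2.1)
    (fun p : SmallNode => p.1.2.2.2) ctx.snd.snd (fun p => p.2.length.trans (hn p))
  have hshift := shift.call (T := fun p => nodeTime p.1.1 p.1.2.1)
    (fun p : SmallNode => (p.1.2.1.m, p.1.2.2.2.length)) (ctx.fst.fst.pair hfree)
    (fun p => p.2.length.trans (hn p))
  exact (leafScore.pair ((const _ _ 0).pair (hlen.pair hshift))).congr_right fun p => by
    simp only [DTLearn.leafVal]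

end Computes

/-! ### The recursion as a list of instructions

The recursion of `best` is unfolded, one level at a time, into a list of instructions for a stack
machine, which is then executed from left to right. -/

/-- An instruction. The tag `0` stands for a node of the search still to be expanded, `1` for a
leaf, and `i + 2` for the combination of the topmost three entries of the stack by a query of
`i`. -/
abbrev Item : Type := ℕ × State

/-- One level of the recursion. -/
def expand (P : Params) (it : Item) : List Item :=
  if it.1 = 0 then (1, it.2) :: (cands P it.2).flatMap
    fun j => [(0, branch false j it.2), (0, branch true j it.2), (j + 2, it.2)]
  else [it]

/-- The list of instructions after `k` levels. -/
def unfolded (P : Params) (l : List Item) : ℕ → List Item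
  | 0 => l
  | k + 1 => (unfolded P l k).flatMap (expand P)

lemma unfolded_succ (P : Params) (l : List Item) (k : ℕ) :
    unfolded P l (k + 1) = unfolded P (l.flatMap (expand P)) k := by
  induction k with
  | zero => rfl
  | succ k ih => rw [unfolded, ih]; rfl

lemma unfolded_append (P : Params) (l l' : List Item) (k : ℕ) :
    unfolded P (l ++ l') k = unfolded P l k ++ unfolded P l' k := by
  induction k with
  | zero => rfl
  | succ k ih => simp only [unfolded, ih, List.flatMap_append]

lemma unfolded_inert (P : Params) {it : Item} (h : it.1 ≠ 0) (k : ℕ) :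
    unfolded P [it] k = [it] := by
  induction k with
  | zero => rfl
  | succ k ih => simp [unfolded, ih, expand, h]

/-- A search result as an S-expression. -/
def encResult (v : ℕ × Val) : Val := .pair (.num v.1) v.2

/-- The combination of the topmost three entries of the stack; `c` is one more than the coordinate
queried. -/
def combVal (c : ℕ) (st : Val) : Val :=
  if st.snd.snd.fst.fst.toNat - (st.snd.fst.fst.toNat + st.fst.fst.toNat) = 0 then st.snd.snd
  else .pair (.pair (.num (st.snd.fst.fst.toNat + st.fst.fst.toNat))
    (.pair (.num c) (.pair st.snd.fst.snd st.fst.snd))) st.snd.snd.snd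

/-- The execution of an instruction. -/
def exec (P : Params) (st : Val) (it : Item) : Val :=
  if it.1 - 1 = 0 then .pair (encResult (leafVal P it.2)) st else combVal (it.1 - 1) st

lemma combVal_encResult (i : ℕ) (b v₀ v₁ : ℕ × Val) (st : Val) :
    combVal (i + 1) (.pair (encResult v₁) (.pair (encResult v₀) (.pair (encResult b) st)))
      = .pair (encResult (comb i b v₀ v₁)) st := by
  by_cases h : v₀.1 + v₁.1 < b.1
  · rw [comb, if_pos h]
    exact if_neg (show ¬ b.1 - (v₀.1 + v₁.1) = 0 by omega)
  · rw [comb, if_neg h]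
    exact if_pos (show b.1 - (v₀.1 + v₁.1) = 0 by omega)

/-- The instructions for a node push the result of the search at this node onto the stack. -/
lemma exec_unfolded (P : Params) (k : ℕ) (s : State) (st : Val) :
    (unfolded P [(0, s)] k).foldl (exec P) st = .pair (encResult (best P k s)) st := by
  induction k generalizing s st with
  | zero => rfl
  | succ k ih =>
    have h1 : unfolded P [(0, s)] (k + 1) = (1, s) :: unfolded P ((cands P s).flatMap
        fun j => [(0, branch false j s), (0, branch true j s), (j + 2, s)]) k := by
      rw [unfolded_succ]
      have : [((0 : ℕ), s)].flatMap (expand P) = [(1, s)] ++ (cands P s).flatMap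
          (fun j => [(0, branch false j s), (0, branch true j s), (j + 2, s)]) := by
        simp [expand]
      rw [this, unfolded_append, unfolded_inert P (by simp)]
      rfl
    rw [h1, List.foldl_cons, best]
    change (unfolded P _ k).foldl (exec P) (.pair (encResult (leafVal P s)) st) = _
    generalize leafVal P s = b
    generalize cands P s = l
    induction l generalizing b with
    | nil =>
      have : ∀ k, unfolded P [] k = [] := fun k => by
        induction k with
        | zero => rfl
        | succ k ih => simp [unfolded, ih]
      simp [this]
    | cons j l ihl =>
      have h2 : (j :: l).flatMap (fun j => [((0 : ℕ), branch false j s), (0, branch true j s),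
            (j + 2, s)])
          = [((0 : ℕ), branch false j s)] ++ ([((0 : ℕ), branch true j s)] ++ ([(j + 2, s)] ++
            l.flatMap (fun j => [((0 : ℕ), branch false j s), (0, branch true j s),
              (j + 2, s)]))) := rfl
      rw [h2, unfolded_append, unfolded_append, unfolded_append,
        unfolded_inert P (it := (j + 2, s)) (by simp),
        List.foldl_append, ih, List.foldl_append, ih, List.foldl_append]
      simp only [List.foldl_cons, List.foldl_nil]
      have h3 : exec P (.pair (encResult (best P k (branch true j s)))
          (.pair (encResult (best P k (branch false j s))) (.pair (encResult b) st))) (j + 2, s)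
          = .pair (encResult (comb j b (best P k (branch false j s))
            (best P k (branch true j s)))) st := by
        rw [exec, if_neg (by simp)]
        exact combVal_encResult _ _ _ _ _
      rw [h3]
      exact ihl _

lemma mem_expand {P : Params} {it it' : Item} (h : it' ∈ expand P it) :
    it'.2 = it.2 ∨ ∃ b j, it'.2 = branch b j it.2 := by
  unfold expand at h
  split_ifs at h with h0
  · simp only [List.mem_cons, List.mem_flatMap, List.not_mem_nil, or_false] at h
    rcases h with rfl | ⟨j, _, rfl | rfl | rfl⟩
    · exact Or.inl rfl
    · exact Or.inr ⟨_, _, rfl⟩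
    · exact Or.inr ⟨_, _, rfl⟩
    · exact Or.inl rfl
  · rw [List.mem_singleton] at h
    exact Or.inl (by rw [h])

lemma small_unfolded {n : ℕ} {P : Params} {l : List Item} (h : ∀ it ∈ l, Small n P it.2) (k : ℕ) :
    ∀ it ∈ unfolded P l k, Small n P it.2 := by
  induction k with
  | zero => exact h
  | succ k ih =>
    intro it hit
    obtain ⟨it₀, h0, h1⟩ := List.mem_flatMap.1 hit
    rcases mem_expand h1 with h2 | ⟨b, j, h2⟩
    · rw [h2]; exact ih _ h0
    · rw [h2]; exact (ih _ h0).branch b j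

lemma length_expand_le (P : Params) (it : Item) : (expand P it).length ≤ 3 * P.K + 1 := by
  unfold expand
  split_ifs
  · have := length_cands_le P it.2
    simp only [List.length_cons, List.length_flatMap, List.length_nil, List.map_const',
      List.sum_replicate, smul_eq_mul]
    omega
  · simp

lemma length_unfolded_le (P : Params) (l : List Item) (k : ℕ) :
    (unfolded P l k).length ≤ (3 * P.K + 1) ^ k * l.length := by
  induction k with
  | zero => simp [unfolded]
  | succ k ih =>
    have h1 : ((unfolded P l k).flatMap (expand P)).length
        ≤ (3 * P.K + 1) * (unfolded P l k).length := by
      generalize unfolded P l k = l'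
      induction l' with
      | nil => simp
      | cons it l' ih' =>
        have := length_expand_le P it
        rw [List.flatMap_cons, List.length_append, List.length_cons]
        nlinarith
    refine h1.trans ((Nat.mul_le_mul_left _ ih).trans (le_of_eq ?_))
    rw [pow_succ]; ring

/-- An instruction as an S-expression. -/
def encItem (it : Item) : Val := .pair (.num it.1) (encState it.2)

/-- A list of instructions together with bounds. -/
abbrev SmallItems : Type :=
  {p : ℕ × Params × List Item // ∀ it ∈ p.2.2, Small p.1 p.2.1 it.2}

lemma branch_le_nodeTime {n : ℕ} {P : Params} {s : State} (hs : Small n P s) {j : ℕ} (hj : j < n) :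
    (cands P s).length * ((s.1.length + s.2.length + 1) * (j + 1) + 1) ≤ 2 * nodeTime n P := by
  have h1 := length_cands_le P s
  have h2 := hs.records
  have h3 := hs.length
  have h4 : (s.1.length + s.2.length + 1) * (j + 1) + 1 ≤ (P.m + n + 1) * (n + 1) + 1 :=
    Nat.succ_le_succ (Nat.mul_le_mul (by omega) (by omega))
  refine (Nat.mul_le_mul h1 h4).trans ?_
  have h5 : (P.m + n + 1) * (n + 1) + 1 ≤ 2 * ((n + 1) ^ 2 * (P.m + 1)) := by
    generalize P.m = m
    nlinarith [Nat.zero_le (n * n * m), Nat.zero_le (n * m)]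
  refine (Nat.mul_le_mul_left _ h5).trans ?_
  unfold nodeTime
  have h6 : P.K ≤ P.A + P.K + 1 := by omega
  calc P.K * (2 * ((n + 1) ^ 2 * (P.m + 1))) = 2 * ((n + 1) ^ 2 * (P.m + 1) * P.K) := by ring
    _ ≤ _ := by gcongr

namespace Computes

/-- The expansion of one instruction, put in reversed order in front of a list. -/
lemma expand : Computes (fun p : {p : ℕ × Params × List Item × Item // Small p.1 p.2.1 p.2.2.2.2} =>
      .pair (encParams p.1.2.1) (.pair (encList encItem p.1.2.2.1) (encItem p.1.2.2.2)))
    (fun p => encList encItem ((DTLearn.expand p.1.2.1 p.1.2.2.2).reverse ++ p.1.2.2.1))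
    (fun p => nodeTime p.1.1 p.1.2.1) := by
  set κ := {p : ℕ × Params × List Item × Item // Small p.1 p.2.1 p.2.2.2.2}
  set a : κ → Val := fun p =>
    .pair (encParams p.1.2.1) (.pair (encList encItem p.1.2.2.1) (encItem p.1.2.2.2)) with ha
  have ctx := id a (fun p => nodeTime p.1.1 p.1.2.1)
  have hc := cands.call (T := fun p => nodeTime p.1.1 p.1.2.1)
    (fun p : κ => ⟨(p.1.1, p.1.2.1, p.1.2.2.2.2), p.2⟩) (ctx.fst.pair ctx.snd.snd.snd)
    (fun p => le_rfl)
  -- the longest time for one candidate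
  set U : κ → ℕ := fun p => (p.1.2.2.2.2.1.length + p.1.2.2.2.2.2.length + 1) * p.1.1 with hU
  have h := foldl (T := fun p => nodeTime p.1.1 p.1.2.1) (T' := U)
    (l := fun p : κ => DTLearn.cands p.1.2.1 p.1.2.2.2.2) (encσ := encList encItem)
    (s₀ := fun p => (1, p.1.2.2.2.2) :: p.1.2.2.1)
    (g := fun p acc j => (j + 2, p.1.2.2.2.2) :: (0, DTLearn.branch true j p.1.2.2.2.2)
      :: (0, DTLearn.branch false j p.1.2.2.2.2) :: acc) hc
    (((((const _ _ 1).pair ctx.snd.snd.snd).pair ctx.snd.fst)).congr_right fun p => rfl) (by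
      set κ' := {p : κ × List Item × ℕ // p.2.2 ∈ DTLearn.cands p.1.1.2.1 p.1.1.2.2.2.2}
      have hlt : ∀ p : κ', p.1.2.2 < p.1.1.1.1 := fun p => p.1.1.2.lt _ (mem_of_mem_cands p.2)
      have c2 := id (fun p : κ' => Val.pair (a p.1.1)
        (.pair (encList encItem p.1.2.1) (.num p.1.2.2))) (fun p => U p.1.1)
      have hb := fun b => (branch b).call (T := fun p : κ' => U p.1.1)
        (fun p => (p.1.2.2, p.1.1.1.2.2.2.2)) (c2.snd.snd.pair c2.fst.snd.snd.snd)
        (fun p => Nat.mul_le_mul_left _ (hlt p))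
      exact (((c2.snd.snd.add (const _ _ 2)).pair c2.fst.snd.snd.snd).pair
        (((const _ _ 0).pair (hb true)).pair (((const _ _ 0).pair (hb false)).pair
          c2.snd.fst))).congr_right fun p => rfl)
  have h' := h.mono_const (T' := fun p => nodeTime p.1.1 p.1.2.1) 3 (fun p => by
    rcases Nat.eq_zero_or_pos p.1.1 with h0 | h0
    · have h1 : DTLearn.cands p.1.2.1 p.1.2.2.2.2 = [] := by
        rw [List.eq_nil_iff_forall_not_mem]
        intro j hj
        have := p.2.lt j (mem_of_mem_cands hj)
        omega
      rw [h1, List.length_nil, zero_mul]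
      omega
    · have h1 := branch_le_nodeTime p.2 (j := p.1.1 - 1) (by omega)
      rw [Nat.sub_add_cancel h0] at h1
      simp only [hU]
      omega)
  refine ite ctx.snd.snd.fst (ctx.snd.snd.pair ctx.snd.fst) h' (fun p hp => ?_) (fun p hp => ?_)
  · have hp' : p.1.2.2.2.1 ≠ 0 := fun h0 => hp (by simp [ha, encItem, Val.fst, Val.snd, h0])
    simp only [DTLearn.expand, if_neg hp']
    rfl
  · have hp' : p.1.2.2.2.1 = 0 := by
      simpa [ha, encItem, Val.fst, Val.snd] using hp
    simp only [DTLearn.expand, if_pos hp']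
    congr 1
    generalize p.1.2.2.2.2 = s
    generalize p.1.2.2.1 = acc
    rw [List.reverse_cons, List.append_assoc, List.singleton_append]
    generalize ((1, s) :: acc : List Item) = acc'
    generalize DTLearn.cands p.1.2.1 s = l
    induction l generalizing acc' with
    | nil => rfl
    | cons j l ih =>
      rw [List.foldl_cons, ← ih, List.flatMap_cons, List.reverse_append]
      simp

lemma expandAll : Computes
    (fun p : SmallItems => .pair (encParams p.1.2.1) (encList encItem p.1.2.2))
    (fun p => encList encItem (p.1.2.2.flatMap (DTLearn.expand p.1.2.1)))
    (fun p => p.1.2.2.length * (nodeTime p.1.1 p.1.2.1 + 3 * p.1.2.1.K + 1)) := by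
  have ctx := id (fun p : SmallItems => Val.pair (encParams p.1.2.1) (encList encItem p.1.2.2))
    (fun _ => 0)
  have h := foldl (T := fun _ => 0) (T' := fun p => nodeTime p.1.1 p.1.2.1)
    (l := fun p : SmallItems => p.1.2.2) (encσ := encList encItem) (s₀ := fun _ => [])
    (g := fun p acc it => (DTLearn.expand p.1.2.1 it).reverse ++ acc) ctx.snd (const _ _ 0) (by
      set κ := {p : SmallItems × List Item × Item // p.2.2 ∈ p.1.1.2.2}
      have c2 := id (fun p : κ => Val.pair
        (.pair (encParams p.1.1.1.2.1) (encList encItem p.1.1.1.2.2))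
        (.pair (encList encItem p.1.2.1) (encItem p.1.2.2)))
        (fun p => nodeTime p.1.1.1.1 p.1.1.1.2.1)
      exact expand.call (T := fun p : κ => nodeTime p.1.1.1.1 p.1.1.1.2.1)
        (fun p => ⟨(p.1.1.1.1, p.1.1.1.2.1, p.1.2.1, p.1.2.2), p.1.1.2 _ p.2⟩)
        (c2.fst.fst.pair c2.snd) (fun p => le_rfl))
  have hfold : ∀ (P : Params) (l acc : List Item),
      l.foldl (fun acc it => (DTLearn.expand P it).reverse ++ acc) acc
        = (l.flatMap (DTLearn.expand P)).reverse ++ acc := by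
    intro P l
    induction l with
    | nil => simp
    | cons it l ih => intro acc; rw [List.foldl_cons, ih]; simp
  have h' := (reverse encItem).call
    (T := fun p : SmallItems => p.1.2.2.length * (nodeTime p.1.1 p.1.2.1 + 3 * p.1.2.1.K + 1))
    (fun p : SmallItems => (p.1.2.2.flatMap (DTLearn.expand p.1.2.1)).reverse)
    ((h.mono (fun p => by
      rw [zero_add]; exact Nat.mul_le_mul_left _ (by omega))).congr_right fun p => by
        rw [hfold, List.append_nil])
    (fun p => by
      rw [List.length_reverse]
      have := length_unfolded_le p.1.2.1 p.1.2.2 1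
      rw [pow_one] at this
      refine this.trans ?_
      rw [mul_comm]
      exact Nat.mul_le_mul_left _ (by omega))
  exact h'.congr_right fun p => by rw [List.reverse_reverse]

lemma exec : Computes (fun p : {p : ℕ × Params × Val × Item // Small p.1 p.2.1 p.2.2.2.2} =>
      .pair (encParams p.1.2.1) (.pair p.1.2.2.1 (encItem p.1.2.2.2)))
    (fun p => DTLearn.exec p.1.2.1 p.1.2.2.1 p.1.2.2.2) (fun p => nodeTime p.1.1 p.1.2.1) := by
  set κ := {p : ℕ × Params × Val × Item // Small p.1 p.2.1 p.2.2.2.2}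
  have ctx := id (fun p : κ => Val.pair (encParams p.1.2.1) (.pair p.1.2.2.1 (encItem p.1.2.2.2)))
    (fun p => nodeTime p.1.1 p.1.2.1)
  have htag : Computes _ (fun p : κ => .num (p.1.2.2.2.1 - 1)) _ :=
    ctx.snd.snd.fst.sub (const _ _ 1)
  have hleaf := leafVal.call (T := fun p => nodeTime p.1.1 p.1.2.1)
    (fun p : κ => ⟨(p.1.1, p.1.2.1, p.1.2.2.2.2), p.2⟩) (ctx.fst.pair ctx.snd.snd.snd)
    (fun p => le_rfl)
  have hst : Computes _ (fun p : κ => p.1.2.2.1) _ := ctx.snd.fst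
  have hsum := hst.snd.fst.fst.add hst.fst.fst
  have hcomb : Computes _ (fun p : κ => combVal (p.1.2.2.2.1 - 1) p.1.2.2.1) _ :=
    ite (hst.snd.snd.fst.fst.sub hsum)
      ((hsum.pair (htag.pair (hst.snd.fst.snd.pair hst.fst.snd))).pair hst.snd.snd.snd)
      hst.snd.snd
      (fun p hp => by
        rw [combVal, if_neg (by simpa [Val.toNat] using hp)])
      (fun p hp => by
        rw [combVal, if_pos (by simpa [Val.toNat] using hp)])
  exact ite htag hcomb (hleaf.pair hst)
    (fun p hp => by rw [DTLearn.exec, if_neg (by simpa using hp)])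
    (fun p hp => by rw [DTLearn.exec, if_pos (by simpa using hp)]; rfl)

lemma execAll : Computes (fun p : SmallItems => .pair (encParams p.1.2.1) (encList encItem p.1.2.2))
    (fun p => p.1.2.2.foldl (DTLearn.exec p.1.2.1) (.num 0))
    (fun p => p.1.2.2.length * (nodeTime p.1.1 p.1.2.1 + 1)) := by
  have ctx := id (fun p : SmallItems => Val.pair (encParams p.1.2.1) (encList encItem p.1.2.2))
    (fun _ => 0)
  have h := foldl (T := fun _ => 0) (T' := fun p => nodeTime p.1.1 p.1.2.1)
    (l := fun p : SmallItems => p.1.2.2) (encσ := fun v : Val => v) (s₀ := fun _ => .num 0)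
    (g := fun p => DTLearn.exec p.1.2.1) ctx.snd (const _ _ 0) (by
      set κ := {p : SmallItems × Val × Item // p.2.2 ∈ p.1.1.2.2}
      have c2 := id (fun p : κ => Val.pair
        (.pair (encParams p.1.1.1.2.1) (encList encItem p.1.1.1.2.2))
        (.pair p.1.2.1 (encItem p.1.2.2))) (fun p => nodeTime p.1.1.1.1 p.1.1.1.2.1)
      exact exec.call (T := fun p : κ => nodeTime p.1.1.1.1 p.1.1.1.2.1)
        (fun p => ⟨(p.1.1.1.1, p.1.1.1.2.1, p.1.2.1, p.1.2.2), p.1.1.2 _ p.2⟩)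
        (c2.fst.fst.pair c2.snd) (fun p => le_rfl))
  exact h.mono fun p => by rw [zero_add]

/-- The time, up to a constant, for the search. -/
def _root_.DTLearn.searchTime (n d : ℕ) (P : Params) : ℕ :=
  n + (d + 1) * ((3 * P.K + 1) ^ d * (nodeTime n P + 3 * P.K + 1) + 1)

lemma search : Computes (fun p : {p : (ℕ × ℕ) × Params × List Record // p.2.2.length ≤ p.2.1.m} =>
      .pair (.pair (.num p.1.1.1) (.num p.1.1.2))
        (.pair (encParams p.1.2.1) (encList encRecord p.1.2.2)))
    (fun p => (best p.1.2.1 p.1.1.2 (p.1.2.2, (List.range p.1.1.1).reverse)).2)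
    (fun p => searchTime p.1.1.1 p.1.1.2 p.1.2.1) := by
  set κ := {p : (ℕ × ℕ) × Params × List Record // p.2.2.length ≤ p.2.1.m}
  set a : κ → Val := fun p => .pair (.pair (.num p.1.1.1) (.num p.1.1.2))
        (.pair (encParams p.1.2.1) (encList encRecord p.1.2.2)) with ha
  have ctx := id a (fun _ => 0)
  -- the list of all coordinates, together with its length
  have hrange := (iterate (N := fun p : κ => p.1.1.1) (T' := fun _ => 0)
    (fun p j => .pair (.num j) (encList .num (List.range j).reverse)) ctx.fst.fst
    ((const _ _ 0).pair (const _ _ 0)) (by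
      have c2 := id (fun p : {p : κ × ℕ // p.2 < p.1.1.1.1} =>
        Val.pair (a p.1.1) (.pair (.num p.1.2) (encList .num (List.range p.1.2).reverse)))
        (fun _ => 0)
      exact ((c2.snd.fst.add (const _ _ 1)).pair
        (c2.snd.fst.pair c2.snd.snd)).congr_right fun p => by
        rw [List.range_succ, List.reverse_append]; rfl)).snd
  set items : κ → ℕ → List Item := fun p j =>
    unfolded p.1.2.1 [(0, (p.1.2.2, (List.range p.1.1.1).reverse))] j with hitems
  have hsmall : ∀ (p : κ) j, ∀ it ∈ items p j, Small p.1.1.1 p.1.2.1 it.2 := fun p j =>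
    small_unfolded (fun it hit => by
      rw [List.mem_singleton.1 hit]
      exact ⟨p.2, by simp, fun j hj => by simpa using hj⟩) j
  have hlen : ∀ (p : κ) j, j ≤ p.1.1.2 → (items p j).length ≤ (3 * p.1.2.1.K + 1) ^ p.1.1.2 :=
    fun p j hj => (length_unfolded_le _ _ _).trans (by
      rw [List.length_singleton, mul_one]
      exact Nat.pow_le_pow_right (by omega) hj)
  set U : κ → ℕ := fun p => (3 * p.1.2.1.K + 1) ^ p.1.1.2
    * (nodeTime p.1.1.1 p.1.2.1 + 3 * p.1.2.1.K + 1) with hU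
  have hrange' := hrange.mono (T' := fun p => p.1.1.1) (fun p => by simp)
  have hunfold := iterate (N := fun p : κ => p.1.1.2) (T := fun p : κ => p.1.1.1) (T' := U)
    (a := a) (fun p j => encList encItem (items p j)) ((id a _).fst.snd)
    (((const _ _ 0).pair ((id a _).snd.snd.pair hrange')).pair (const _ _ 0)) (by
      set κ' := {p : κ × ℕ // p.2 < p.1.1.1.2}
      have c2 := id (fun p : κ' => Val.pair (a p.1.1) (encList encItem (items p.1.1 p.1.2)))
        (fun p => U p.1.1)
      exact expandAll.call (T := fun p : κ' => U p.1.1)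
        (fun p => ⟨(p.1.1.1.1.1, p.1.1.1.2.1, items p.1.1 p.1.2), hsmall _ _⟩)
        (c2.fst.snd.fst.pair c2.snd)
        (fun p => Nat.mul_le_mul_right _ (hlen p.1.1 p.1.2 p.2.le)))
  have hT : ∀ p : κ, p.1.1.1 + p.1.1.2 * (U p + 1) ≤ searchTime p.1.1.1 p.1.1.2 p.1.2.1 := by
    intro p
    rw [searchTime]
    exact Nat.add_le_add_left (Nat.mul_le_mul_right _ (Nat.le_succ _)) _
  have hexec := execAll.call (T := fun p : κ => searchTime p.1.1.1 p.1.1.2 p.1.2.1)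
    (fun p : κ => ⟨(p.1.1.1, p.1.2.1, items p p.1.1.2), hsmall _ _⟩)
    ((id a _).snd.fst.pair (hunfold.mono hT))
    (fun p => by
      refine (Nat.mul_le_mul (hlen p p.1.1.2 le_rfl)
        (show nodeTime p.1.1.1 p.1.2.1 + 1 ≤ nodeTime p.1.1.1 p.1.2.1 + 3 * p.1.2.1.K + 1 by
          omega)).trans ?_
      change U p ≤ _
      rw [searchTime]
      refine le_trans ?_ (Nat.le_add_left _ _)
      refine le_trans (Nat.le_succ _) (Nat.le_mul_of_pos_left _ (by omega)))
  refine hexec.fst.snd.congr_right fun p => ?_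
  simp only [hitems, exec_unfolded]
  rfl

end Computes

/-! ### Randomized execution -/

section Wp

variable {n : ℕ} {D : PMF (Fin n → Bool)}

/-- From the configuration `c`, the machine always halts within further time `B` and after at most
`S` further samples, and with probability at least `q` the final registers satisfy `G`. -/
def Wp (D : PMF (Fin n → Bool)) (c : Config) (B S : ℕ) (G : (ℕ → Val) → Prop) (q : ℝ) : Prop :=
  ∃ t, (∀ c' ∈ (run D t c).support, c'.Halted ∧ c'.time ≤ c.time + B ∧ c'.samples ≤ c.samples + S) ∧
    ENNReal.ofReal q ≤ (run D t c).toOuterMeasure {c' | G c'.regs}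

lemma run_of_halted {c : Config} (hc : c.Halted) (t : ℕ) : run D t c = PMF.pure c := by
  have hstep : step D c = PMF.pure c := by
    obtain ⟨todo, r, t, s⟩ := c
    obtain rfl : todo = [] := hc
    rfl
  induction t with
  | zero => rfl
  | succ t ih => rw [run, hstep, PMF.pure_bind, ih]

lemma run_add_of_halted {c : Config} {t : ℕ} (h : ∀ c' ∈ (run D t c).support, c'.Halted) (s : ℕ) :
    run D (t + s) c = run D t c := by
  rw [run_add]
  conv_rhs => rw [← PMF.bind_pure (run D t c)]
  ext c'
  simp only [PMF.bind_apply]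
  refine tsum_congr fun c'' => ?_
  by_cases h0 : run D t c c'' = 0
  · simp [h0]
  · rw [run_of_halted (h c'' ((PMF.mem_support_iff _ _).2 h0))]

variable {k : List Prog} {r r' : ℕ → Val} {t s B S : ℕ} {G : (ℕ → Val) → Prop} {q : ℝ}

namespace Wp

lemma halt (h1 : q ≤ 1) (h2 : ¬ G r → q ≤ 0) : Wp D ⟨[], r, t, s⟩ 0 0 G q := by
  refine ⟨0, fun c' hc' => ?_, ?_⟩
  · simp only [run, PMF.support_pure, Set.mem_singleton_iff] at hc'
    subst hc'
    exact ⟨rfl, le_rfl, le_rfl⟩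
  · rw [run, PMF.toOuterMeasure_pure_apply]
    split_ifs with h
    · exact ENNReal.ofReal_le_one.2 h1
    · exact (ENNReal.ofReal_eq_zero.2 (h2 h)).le

lemma mono {B' S' : ℕ} {c : Config} (h : Wp D c B S G q) (hB : B ≤ B') (hS : S ≤ S') :
    Wp D c B' S' G q := by
  obtain ⟨t, h1, h2⟩ := h
  refine ⟨t, fun c' hc' => ?_, h2⟩
  obtain ⟨h3, h4, h5⟩ := h1 c' hc'
  exact ⟨h3, by omega, by omega⟩

lemma of_run {c c' : Config} {τ : ℕ} (hrun : run D τ c = PMF.pure c')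
    (ht : c'.time = c.time + τ) (hs : c'.samples = c.samples) (h : Wp D c' B S G q) :
    Wp D c (τ + B) S G q := by
  obtain ⟨t, h1, h2⟩ := h
  refine ⟨τ + t, ?_, ?_⟩ <;> rw [run_add, hrun, PMF.pure_bind]
  · intro c'' hc''
    obtain ⟨h3, h4, h5⟩ := h1 c'' hc''
    exact ⟨h3, by omega, by omega⟩
  · exact h2

lemma exec {p : Prog} {τ : ℕ} (hp : Exec p r r' τ) (h : Wp D ⟨k, r', t + τ, s⟩ B S G q) :
    Wp D ⟨p :: k, r, t, s⟩ (τ + B) S G q :=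
  of_run (hp n D k t s) rfl rfl h

lemma seq {p p' : Prog} (h : Wp D ⟨p :: p' :: k, r, t + 1, s⟩ B S G q) :
    Wp D ⟨.seq p p' :: k, r, t, s⟩ (1 + B) S G q :=
  of_run (c' := ⟨p :: p' :: k, r, t + 1, s⟩) (by simp [run, step, Config.goto]) rfl rfl h

lemma while_stop {y : ℕ} {p : Prog} (hy : r y = .num 0) (h : Wp D ⟨k, r, t + 1, s⟩ B S G q) :
    Wp D ⟨.whileNZ y p :: k, r, t, s⟩ (1 + B) S G q :=
  of_run (c' := ⟨k, r, t + 1, s⟩) (by simp [run, step, Config.goto, hy]) rfl rfl h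

lemma while_go {y : ℕ} {p : Prog} (hy : r y ≠ .num 0)
    (h : Wp D ⟨p :: .whileNZ y p :: k, r, t + 1, s⟩ B S G q) :
    Wp D ⟨.whileNZ y p :: k, r, t, s⟩ (1 + B) S G q :=
  of_run (c' := ⟨p :: .whileNZ y p :: k, r, t + 1, s⟩) (by simp [run, step, Config.goto, hy])
    rfl rfl h

lemma draw {μ : PMF (Fin n → Bool)} {x : ℕ} {c : Config}
    (hstep : step D c = μ.map (c.receive k x)) (Q : (Fin n → Bool) → ℝ)
    (h : ∀ y, μ y ≠ 0 → Wp D (c.receive k x y) B S G (Q y)) :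
    Wp D c (n + 1 + B) (1 + S) G (∑ y, (μ y).toReal * Q y) := by
  classical
  have h' : ∀ y, ∃ t, μ y ≠ 0 → (∀ c' ∈ (run D t (c.receive k x y)).support, c'.Halted ∧
      c'.time ≤ (c.receive k x y).time + B ∧ c'.samples ≤ (c.receive k x y).samples + S) ∧
      ENNReal.ofReal (Q y) ≤ (run D t (c.receive k x y)).toOuterMeasure {c' | G c'.regs} := by
    intro y
    by_cases hy : μ y = 0
    · exact ⟨0, fun h => absurd hy h⟩
    · obtain ⟨t, ht⟩ := h y hy
      exact ⟨t, fun _ => ht⟩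
  choose f hf using h'
  -- a number of steps that suffices whatever sample is drawn
  set N := Finset.univ.sup f with hN
  have hN' : ∀ y, μ y ≠ 0 → run D N (c.receive k x y) = run D (f y) (c.receive k x y) := by
    intro y hy
    obtain ⟨m, hm⟩ := Nat.exists_eq_add_of_le (Finset.le_sup (f := f) (Finset.mem_univ y))
    rw [hN, hm]
    exact run_add_of_halted (fun c' hc' => ((hf y hy).1 c' hc').1) m
  have hrun : run D (N + 1) c = μ.bind fun y => run D N (c.receive k x y) := by
    rw [run, hstep, PMF.bind_map]; rfl
  refine ⟨N + 1, ?_, ?_⟩ <;> rw [hrun]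
  · intro c' hc'
    rw [PMF.mem_support_bind_iff] at hc'
    obtain ⟨y, hy, hc'⟩ := hc'
    rw [PMF.mem_support_iff] at hy
    rw [hN' y hy] at hc'
    obtain ⟨h3, h4, h5⟩ := (hf y hy).1 c' hc'
    simp only [Config.receive] at h4 h5
    exact ⟨h3, by omega, by omega⟩
  · rw [PMF.toOuterMeasure_bind_apply, tsum_fintype]
    refine le_trans (Finset.le_sum_of_subadditive _ ENNReal.ofReal_zero.le
      (fun _ _ => ENNReal.ofReal_add_le) _ _) (Finset.sum_le_sum fun y _ => ?_)
    rw [ENNReal.ofReal_mul ENNReal.toReal_nonneg, ENNReal.ofReal_toReal (μ.apply_ne_top y)]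
    by_cases hy : μ y = 0
    · simp [hy]
    · rw [hN' y hy]
      gcongr
      exact (hf y hy).2

lemma sample {x : ℕ} (Q : (Fin n → Bool) → ℝ)
    (h : ∀ y, D y ≠ 0 →
      Wp D ⟨k, Function.update r x (Val.ofPoint y), t + (n + 1), s + 1⟩ B S G (Q y)) :
    Wp D ⟨.sample x :: k, r, t, s⟩ (n + 1 + B) (1 + S) G (∑ y, (D y).toReal * Q y) :=
  draw (k := k) (x := x) rfl Q h

lemma condSample {x y : ℕ} (hy : ∃ z ∈ (r y).subcube n, z ∈ D.support) (Q : (Fin n → Bool) → ℝ)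
    (h : ∀ z, D.filter ((r y).subcube n) hy z ≠ 0 →
      Wp D ⟨k, Function.update r x (Val.ofPoint z), t + (n + 1), s + 1⟩ B S G (Q z)) :
    Wp D ⟨.condSample x y :: k, r, t, s⟩ (n + 1 + B) (1 + S) G
      (∑ z, (D.filter ((r y).subcube n) hy z).toReal * Q z) :=
  draw (k := k) (x := x) (by exact dif_pos hy) Q h

end Wp

/-! ### The collection of records -/

/-- The program `body` draws a record with distribution `M` into register `4`, leaving the registers
below alone. -/
def DrawsRecord (D : PMF (Fin n → Bool)) (body : Prog) (M : Mean Record) (b σ : ℕ) : Prop :=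
  ∀ (r : ℕ → Val) (k : List Prog) (t s B S : ℕ) (G : (ℕ → Val) → Prop) (Q : Record → ℝ),
    (∀ (R : Record) (r' : ℕ → Val) (t' s' : ℕ), (∀ j < 4, r' j = r j) → r' 4 = encRecord R →
      Wp D ⟨k, r', t', s'⟩ B S G (Q R)) →
    Wp D ⟨body :: k, r, t, s⟩ (b + B) (σ + S) G (M.E Q)

/-- The loop that collects records: register `1` counts them, register `2` is the list of records,
register `3` holds the number `1`. -/
def collect (body : Prog) : Prog :=
  .whileNZ 1 (.seq body (.seq (.pair 2 4 2) (.sub 1 1 3)))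

lemma DrawsRecord.collect {body : Prog} {M : Mean Record} {b σ : ℕ}
    (hbody : DrawsRecord D body M b σ) (j : ℕ) (data : List Record) (r : ℕ → Val) (k : List Prog)
    (t s B S : ℕ) (G : (ℕ → Val) → Prop) (Q : List Record → ℝ) (h1 : r 1 = .num j)
    (h2 : r 2 = encList encRecord data) (h3 : r 3 = .num 1)
    (hk : ∀ (data' : List Record) (r' : ℕ → Val) (t' s' : ℕ), r' 0 = r 0 →
      r' 2 = encList encRecord data' → data'.length = j + data.length →
      Wp D ⟨k, r', t', s'⟩ B S G (Q data')) :
    Wp D ⟨collect body :: k, r, t, s⟩ (j * (b + 5) + 1 + B) (j * σ + S) G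
      ((Mean.draws (List.replicate j M) data).E Q) := by
  induction j generalizing data r t s with
  | zero =>
    refine (Wp.while_stop h1 (hk data r _ _ rfl h2 (by simp))).mono (by omega) (by omega)
  | succ j ih =>
    rw [List.replicate_succ]
    have := hbody r (.seq (.pair 2 4 2) (.sub 1 1 3) :: DTLearn.collect body :: k) (t + 1 + 1) s
      (1 + (1 + (1 + (j * (b + 5) + 1 + B)))) (j * σ + S) G
      (fun R => (Mean.draws (List.replicate j M) (R :: data)).E Q) ?_
    · refine (Wp.while_go (by simp [h1]) (Wp.seq this)).mono ?_ ?_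
      · rw [Nat.succ_mul]; omega
      · rw [Nat.succ_mul]; omega
    · intro R r' t' s' hr' hr4
      refine Wp.seq (Wp.exec (Exec.pair _ _ _ _) (Wp.exec (Exec.sub _ _ _ _) ?_))
      refine ih (R :: data) _ _ _ ?_ ?_ ?_ ?_
      · simp [hr' 1, hr' 3, h1, h3, Val.toNat]
      · simp [hr4, hr' 2, h2, encList]
      · simp [hr' 3, h3]
      · intro data' r'' t'' s'' e0 e2 elen
        refine hk data' r'' t'' s'' (e0.trans ?_) e2 (by rw [elen, List.length_cons]; omega)
        simp [hr' 0]

/-- The distribution of a sample. -/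
noncomputable def sampleMean (D : PMF (Fin n → Bool)) : Mean (Fin n → Bool) :=
  .ofWeights (fun x => (D x).toReal) (fun _ => ENNReal.toReal_nonneg) (sum_toReal D)

/-- Records for monotone distributions: the sample itself serves as the list of signs. -/
noncomputable def monoRecord (D : PMF (Fin n → Bool)) : Mean Record :=
  (sampleMean D).bind fun x => .pure (List.ofFn x, List.ofFn x)

/-- The program that draws a record for a monotone distribution. -/
def monoBody : Prog := .seq (.sample 4) (.pair 4 4 4)

lemma drawsRecord_monoBody (D : PMF (Fin n → Bool)) :
    DrawsRecord D monoBody (monoRecord D) (n + 3) 1 := by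
  intro r k t s B S G Q h
  have := Wp.seq (Wp.sample (D := D) (k := .pair 4 4 4 :: k) (r := r) (t := t + 1) (s := s)
    (B := 1 + B) (S := S) (G := G) (x := 4) (fun x => Q (List.ofFn x, List.ofFn x)) ?_)
  · exact this.mono (by omega) le_rfl
  · intro x _
    refine Wp.exec (Exec.pair _ _ _ _) (h _ _ _ _ (fun j hj => ?_) ?_)
    · rw [Function.update_of_ne (by omega), Function.update_of_ne (by omega)]
    · simp [encRecord, ofPoint_eq]

end Wp

/-! ### Records from subcube-conditional samples -/

/-- The description of the subcube of all points that agree with `l` except possibly in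
coordinate `i`. -/
def edgeQuery (l : List Bool) (i : ℕ) : Val :=
  (l.take i).foldr (fun b v => .pair (encBit b) v)
    (.pair (.num 2) (encList encBit (l.drop (i + 1))))

lemma nth_edgeQuery (l : List Bool) (i : ℕ) (hi : i < l.length) (j : ℕ) :
    (edgeQuery l i).nth j = if j = i then .num 2 else encBit (l.getD j false) := by
  have hlist : ∀ (l : List Bool) (j : ℕ), (encList encBit l).nth j = encBit (l.getD j false) := by
    intro l
    induction l with
    | nil =>
      intro j
      have : ∀ j, (Val.num 0).nth j = .num 0 := fun j => by
        induction j with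
        | zero => rfl
        | succ j ih => exact ih
      rw [encList, this]; rfl
    | cons b l ih =>
      intro j
      cases j with
      | zero => rfl
      | succ j => exact ih j
  induction l generalizing i j with
  | nil => simp at hi
  | cons b l ih =>
    cases i with
    | zero =>
      cases j with
      | zero => rfl
      | succ j => rw [if_neg (by omega)]; exact hlist l j
    | succ i =>
      cases j with
      | zero => rfl
      | succ j =>
        have := ih i (by simpa using hi) j
        simp only [Nat.add_right_cancel_iff]
        exact this

lemma mem_subcube_edgeQuery {n : ℕ} (x y : Fin n → Bool) (i : Fin n) :
    y ∈ (edgeQuery (List.ofFn x) i).subcube n ↔ y = x ∨ y = flip i x := by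
  have h1 : y ∈ (edgeQuery (List.ofFn x) i).subcube n ↔ ∀ j, j ≠ i → y j = x j := by
    rw [Val.subcube, Set.mem_ofPred_eq]
    refine forall_congr' fun j => ?_
    rw [nth_edgeQuery _ _ (by simp)]
    by_cases hj : j = i
    · simp [hj]
    · rw [if_neg (by simpa [Fin.val_inj] using hj)]
      simp only [List.getD_eq_getElem?_getD, encBit]
      cases hx : x j <;> simp [hj, hx]
  rw [h1]
  constructor
  · intro h
    by_cases hi : y i = x i
    · left; funext j
      by_cases hj : j = i
      · rw [hj, hi]
      · exact h j hj
    · right; funext j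
      by_cases hj : j = i
      · subst hj; rw [flip_same]; cases hy : y j <;> cases hx : x j <;> simp_all
      · rw [flip_ne hj]; exact h j hj
  · rintro (rfl | rfl) j hj
    · rfl
    · exact flip_ne hj x

/-- The state of the loop that computes the list of signs, before coordinate `i - 1` is treated: the
first `i` bits of the sample `l` in reversed order, the other bits, and the signs found so far. -/
def signState (l : List Bool) (i : ℕ) (w : List Bool) : Val :=
  .pair (encList encBit (l.take i).reverse) (.pair (encList encBit (l.drop i)) (encList encBit w))

namespace Computes

/-- Indices for the loop that computes the list of signs. -/
abbrev SignIndex : Type :=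
  {p : (List Bool × ℕ) × List Bool × List Bool // p.1.2 < p.1.1.length}

lemma take_succ_reverse {l : List Bool} {i : ℕ} (hi : i < l.length) :
    (l.take (i + 1)).reverse = l.getD i false :: (l.take i).reverse := by
  rw [List.take_succ_eq_append_getElem hi]
  simp [List.getD_eq_getElem?_getD, hi]

lemma drop_getD {l : List Bool} {i : ℕ} (hi : i < l.length) :
    l.drop i = l.getD i false :: l.drop (i + 1) := by
  rw [List.drop_eq_getElem_cons hi]
  simp [List.getD_eq_getElem?_getD, hi]

lemma signStart : Computes (fun l : List Bool => encList encBit l)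
    (fun l => signState l l.length []) (fun l => l.length) :=
  ((reverse encBit).pair ((const _ _ 0).pair (const _ _ 0))).congr_right fun l => by
    simp [signState, encList]

lemma edgeQuery : Computes (fun p : SignIndex => signState p.1.1.1 (p.1.1.2 + 1) p.1.2.1)
    (fun p => DTLearn.edgeQuery p.1.1.1 p.1.1.2) (fun p => p.1.1.1.length) := by
  have ctx := id (fun p : SignIndex => signState p.1.1.1 (p.1.1.2 + 1) p.1.2.1) (fun _ => 0)
  have h := foldl (T := fun _ => 0) (T' := fun _ => 0) (encβ := encBit)
    (l := fun p : SignIndex => (p.1.1.1.take p.1.1.2).reverse) (encσ := fun v : Val => v)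
    (s₀ := fun p => .pair (.num 2) (encList encBit (p.1.1.1.drop (p.1.1.2 + 1))))
    (g := fun _ v b => .pair (encBit b) v)
    (ctx.fst.snd.congr_right fun p => by
      rw [signState, take_succ_reverse p.2]; rfl)
    ((const _ _ 2).pair ctx.snd.fst) (((id _ _).snd.snd.pair (id _ _).snd.fst))
  refine (h.mono fun p => ?_).congr_right fun p => ?_
  · simp
  · rw [List.foldl_reverse]; rfl

lemma signStep : Computes
    (fun p : SignIndex => .pair (signState p.1.1.1 (p.1.1.2 + 1) p.1.2.1) (encList encBit p.1.2.2))
    (fun p => signState p.1.1.1 p.1.1.2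
      ((p.1.2.2.getD p.1.1.2 false == p.1.1.1.getD p.1.1.2 false) :: p.1.2.1))
    (fun p => p.1.1.1.length) := by
  set a : SignIndex → Val := fun p =>
    .pair (signState p.1.1.1 (p.1.1.2 + 1) p.1.2.1) (encList encBit p.1.2.2) with ha
  have ctx := id a (fun p => p.1.1.1.length)
  have hbit : Computes a (fun p => encBit (p.1.1.1.getD p.1.1.2 false)) (fun p => p.1.1.1.length) :=
    ctx.fst.fst.fst.congr_right fun p => by
      simp only [ha, signState, take_succ_reverse p.2]; rfl
  have hpre : Computes a (fun p => encList encBit (p.1.1.1.take p.1.1.2).reverse)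
      (fun p => p.1.1.1.length) :=
    ctx.fst.fst.snd.congr_right fun p => by
      simp only [ha, signState, take_succ_reverse p.2]; rfl
  -- the number of bits before coordinate `i` is the index of the bit wanted
  have hlen : Computes a (fun p => .num p.1.1.2) (fun p => p.1.1.1.length) :=
    ((length encBit).call (fun p : SignIndex => (p.1.1.1.take p.1.1.2).reverse) hpre
      (fun p => by simp)).congr_right fun p => by simp [p.2.le]
  have hy : Computes a (fun p => encBit (p.1.2.2.getD p.1.1.2 false)) (fun p => p.1.1.1.length) :=
    getBit.call (fun p : SignIndex => (p.1.1.2, p.1.2.2)) (hlen.pair ctx.snd) (fun p => p.2.le)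
  have heq : Computes a
      (fun p => encBit (p.1.2.2.getD p.1.1.2 false == p.1.1.1.getD p.1.1.2 false))
      (fun p => p.1.1.1.length) :=
    ((const _ _ 1).sub ((hy.sub hbit).add (hbit.sub hy))).congr_right fun p => by
      cases p.1.2.2.getD p.1.1.2 false <;> cases p.1.1.1.getD p.1.1.2 false <;> rfl
  refine (hpre.pair ((hbit.pair ctx.fst.snd.fst).pair (heq.pair ctx.fst.snd.snd))).congr_right
    fun p => ?_
  rw [signState, drop_getD p.2]
  rfl

end Computes

section Conditional

variable {n : ℕ}

/-- The probability that a sample from the two points `x` and `flip i x` is the latter one. -/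
noncomputable def flipProb (D : PMF (Fin n → Bool)) (x : Fin n → Bool) (i : Fin n) : ℝ :=
  (D (flip i x)).toReal / ((D x).toReal + (D (flip i x)).toReal)

lemma flipProb_nonneg (D : PMF (Fin n → Bool)) (x : Fin n → Bool) (i : Fin n) :
    0 ≤ flipProb D x i := by unfold flipProb; positivity

lemma flipProb_le_one (D : PMF (Fin n → Bool)) (x : Fin n → Bool) (i : Fin n) :
    flipProb D x i ≤ 1 :=
  div_le_one_of_le₀ (le_add_of_nonneg_left ENNReal.toReal_nonneg) (by positivity)

/-- The distribution of the sign for coordinate `i`, given the sample `x`. -/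
noncomputable def signMean (D : PMF (Fin n → Bool)) (x : Fin n → Bool) (i : Fin n) : Mean Bool :=
  .ofWeights (fun b => if b then 1 - flipProb D x i else flipProb D x i)
    (fun b => by
      have := flipProb_nonneg D x i
      have := flipProb_le_one D x i
      split_ifs <;> linarith) (by simp)

/-- The distributions of the signs for the first `k` coordinates, the last one first. -/
noncomputable def signMeans (D : PMF (Fin n → Bool)) (x : Fin n → Bool) : ℕ → List (Mean Bool)
  | 0 => []
  | k + 1 => (if h : k < n then signMean D x ⟨k, h⟩ else .pure true) :: signMeans D x k

/-- Records from conditional samples: the sign for coordinate `i` of the sample `x` tells whether a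
fresh sample from the edge of `x` in direction `i` is equal to `x`. -/
noncomputable def condRecord (D : PMF (Fin n → Bool)) : Mean Record :=
  (sampleMean D).bind fun x =>
    (Mean.draws (signMeans D x n) []).bind fun w => .pure (List.ofFn x, w)

/-- A conditional sample from an edge of `x` agrees with `x` in the direction of the edge with the
probability given by `signMean`. -/
lemma sum_filter_edge {D : PMF (Fin n → Bool)} {x : Fin n → Bool} (hx : D x ≠ 0) (i : Fin n)
    {v : Val} (hv : v = edgeQuery (List.ofFn x) i) (hy : ∃ z ∈ v.subcube n, z ∈ D.support)
    (Q : Bool → ℝ) :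
    ∑ z, (D.filter (v.subcube n) hy z).toReal * Q (z i == x i) = (signMean D x i).E Q := by
  classical
  subst hv
  have hne : x ≠ flip i x := fun h => by
    have := congrFun h i
    rw [flip_same] at this
    cases hb : x i <;> simp [hb] at this
  have hind : ∀ z, ((edgeQuery (List.ofFn x) i).subcube n).indicator D z
      = if z = x ∨ z = flip i x then D z else 0 := fun z => by
    rw [Set.indicator_apply]
    simp only [mem_subcube_edgeQuery]
  have hsum : ∀ F : (Fin n → Bool) → ℝ,
      ∑ z, (if z = x ∨ z = flip i x then F z else 0) = F x + F (flip i x) := by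
    intro F
    rw [← Finset.sum_filter, ← Finset.sum_pair hne]
    refine Finset.sum_congr ?_ fun _ _ => rfl
    ext z; simp
  have htot : ∑' z, ((edgeQuery (List.ofFn x) i).subcube n).indicator D z
      = D x + D (flip i x) := by
    rw [tsum_fintype]
    simp only [hind]
    rw [← Finset.sum_filter, ← Finset.sum_pair hne]
    refine Finset.sum_congr ?_ fun _ _ => rfl
    ext z; simp
  have hpt : ∀ z, (D.filter _ hy z).toReal * Q (z i == x i)
      = if z = x ∨ z = flip i x then
        (D z).toReal * ((D x).toReal + (D (flip i x)).toReal)⁻¹ * Q (z i == x i) else 0 := by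
    intro z
    rw [PMF.filter_apply, htot, hind]
    split_ifs with hz
    · rw [ENNReal.toReal_mul, ENNReal.toReal_inv, ENNReal.toReal_add (D.apply_ne_top _)
        (D.apply_ne_top _)]
    · simp
  rw [Finset.sum_congr rfl fun z _ => hpt z, hsum]
  have hpos : 0 < (D x).toReal := ENNReal.toReal_pos hx (D.apply_ne_top x)
  have hpos' : 0 ≤ (D (flip i x)).toReal := ENNReal.toReal_nonneg
  have h1 : (flip i x i == x i) = false := by rw [flip_same]; cases x i <;> rfl
  simp only [signMean, Mean.ofWeights, Fintype.sum_bool, h1, beq_self_eq_true, if_true,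
    Bool.false_eq_true, if_false, flipProb]
  field_simp
  ring

/-- The program that draws a record with the help of conditional samples. The arguments are the
subroutines `signStart`, `edgeQuery` and `signStep`. -/
def condBody (p₀ p₁ p₂ : Prog) : Prog :=
  .seq (.sample 4) (.seq (.copy 5 4) (.seq p₀ (.seq (.fst 6 5) (.seq
    (.whileNZ 6 (.seq (.copy 6 5) (.seq p₁ (.seq (.condSample 7 6) (.seq (.pair 5 5 7)
      (.seq p₂ (.fst 6 5))))))) (.seq (.snd 5 5) (.seq (.snd 5 5) (.pair 4 4 5)))))))

lemma exists_drawsRecord_condBody : ∃ (body : Prog) (c : ℕ), ∀ (n : ℕ) (D : PMF (Fin n → Bool)),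
    DrawsRecord D body (condRecord D) (c * (n + 1) ^ 2) (n + 1) := by
  obtain ⟨p₀, c₀, -, h₀⟩ := Computes.signStart 5
  obtain ⟨p₁, c₁, -, h₁⟩ := Computes.edgeQuery 6
  obtain ⟨p₂, c₂, -, h₂⟩ := Computes.signStep 5
  refine ⟨condBody p₀ p₁ p₂, c₀ + c₁ + c₂ + 40, fun n D r k t s B S G Q hk => ?_⟩
  -- the inner loop, when `i` coordinates are left
  have loop : ∀ (x : Fin n → Bool), D x ≠ 0 → ∀ (i : ℕ), i ≤ n → ∀ (w : List Bool) (r' : ℕ → Val)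
      (t' s' : ℕ), (∀ j < 4, r' j = r j) → r' 4 = encList encBit (List.ofFn x) →
      r' 5 = signState (List.ofFn x) i w → r' 6 = (r' 5).fst →
      Wp D ⟨.whileNZ 6 (.seq (.copy 6 5) (.seq p₁ (.seq (.condSample 7 6) (.seq (.pair 5 5 7)
          (.seq p₂ (.fst 6 5)))))) :: .seq (.snd 5 5) (.seq (.snd 5 5) (.pair 4 4 5)) :: k,
          r', t', s'⟩
        (i * (c₁ * (n + 1) + c₂ * (n + 1) + n + 12) + 6 + B) (i + S) G
        ((Mean.draws (signMeans D x i) w).E fun w => Q (List.ofFn x, w)) := by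
    intro x hx i
    induction i with
    | zero =>
      intro _ w r' t' s' hr' hr4 hr5 hr6
      have h6 : r' 6 = .num 0 := by rw [hr6, hr5]; rfl
      refine (Wp.while_stop h6 (Wp.seq (Wp.exec (Exec.snd _ _ _) (Wp.seq (Wp.exec (Exec.snd _ _ _)
        (Wp.exec (Exec.pair _ _ _ _) (hk (List.ofFn x, w) _ _ _ (fun j hj => ?_) ?_))))))).mono
        (by omega) (by omega)
      · rw [Function.update_of_ne (by omega), Function.update_of_ne (by omega),
          Function.update_of_ne (by omega), hr' j hj]
      · simp [hr4, hr5, signState, Val.snd, encRecord]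
    | succ i ih =>
      intro hi w r' t' s' hr' hr4 hr5 hr6
      have hin : i < n := hi
      have hil : i < (List.ofFn x).length := by simpa using hin
      have h6 : r' 6 ≠ .num 0 := by
        rw [hr6, hr5, signState, Computes.take_succ_reverse hil]
        simp [encList, Val.fst]
      obtain ⟨r1, τ1, e1, b1, f1, t1⟩ := h₁ ⟨((List.ofFn x, i), w, []), hil⟩
        (Function.update r' 6 (r' 5)) (by simp [hr5])
      have hr1 : ∀ j < 6, r1 j = r' j := fun j hj => by
        rw [f1 j hj, Function.update_of_ne (by omega)]
      have hmem : ∃ z ∈ (r1 6).subcube n, z ∈ D.support := by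
        refine ⟨x, ?_, (PMF.mem_support_iff _ _).2 hx⟩
        rw [b1]
        exact (mem_subcube_edgeQuery x x ⟨i, hin⟩).2 (Or.inl rfl)
      -- the time of one round
      have hround : ∀ (z : Fin n → Bool) (t' s' : ℕ),
          Wp D ⟨.seq (.pair 5 5 7) (.seq p₂ (.fst 6 5)) ::
            .whileNZ 6 (.seq (.copy 6 5) (.seq p₁ (.seq (.condSample 7 6) (.seq (.pair 5 5 7)
              (.seq p₂ (.fst 6 5)))))) :: .seq (.snd 5 5) (.seq (.snd 5 5) (.pair 4 4 5)) :: k,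
            Function.update r1 7 (Val.ofPoint z), t', s'⟩
          (4 + c₂ * (n + 1) + (i * (c₁ * (n + 1) + c₂ * (n + 1) + n + 12) + 6 + B)) (i + S) G
          ((Mean.draws (signMeans D x i) ((z ⟨i, hin⟩ == x ⟨i, hin⟩) :: w)).E
            fun w => Q (List.ofFn x, w)) := by
        intro z t' s'
        obtain ⟨r2, τ2, e2, b2, f2, t2⟩ := h₂ ⟨((List.ofFn x, i), w, List.ofFn z), hil⟩
          (Function.update (Function.update r1 7 (Val.ofPoint z)) 5
            (.pair (r1 5) (Val.ofPoint z))) (by simp [hr1, hr5, ofPoint_eq])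
        have hr2 : ∀ j < 5, r2 j = r' j := fun j hj => by
          rw [f2 j hj, Function.update_of_ne (by omega), Function.update_of_ne (by omega),
            hr1 j (by omega)]
        have hexec := (Exec.pair 5 5 7 (Function.update r1 7 (Val.ofPoint z)))
        have hregs : Function.update (Function.update r1 7 (Val.ofPoint z)) 5
            (.pair (Function.update r1 7 (Val.ofPoint z) 5)
              (Function.update r1 7 (Val.ofPoint z) 7))
            = Function.update (Function.update r1 7 (Val.ofPoint z)) 5
              (.pair (r1 5) (Val.ofPoint z)) := by simp
        rw [hregs] at hexec
        have hbit : ((List.ofFn z).getD i false == (List.ofFn x).getD i false)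
            = (z ⟨i, hin⟩ == x ⟨i, hin⟩) := by
          simp [List.getD_eq_getElem?_getD, hin]
        have t2' : τ2 ≤ c₂ * (n + 1) := by simpa using t2
        refine (Wp.seq (Wp.exec hexec (Wp.seq (Wp.exec e2 (Wp.exec (Exec.fst _ _ _)
          (ih (by omega) _ _ _ _ (fun j hj => ?_) ?_ ?_ ?_)))))).mono (by omega) le_rfl
        · rw [Function.update_of_ne (by omega), hr2 j (by omega), hr' j hj]
        · rw [Function.update_of_ne (by omega), hr2 4 (by omega), hr4]
        · rw [Function.update_of_ne (by omega), b2]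
          dsimp only
          rw [hbit]
        · simp
      have hsample := Wp.condSample (x := 7) (r := r1) (y := 6) hmem
        (t := t' + 1 + 1 + 1 + 1 + τ1 + 1) (s := s') _ (fun z _ => hround z _ _)
      have hval := sum_filter_edge hx ⟨i, hin⟩ b1 hmem (fun b =>
        (Mean.draws (signMeans D x i) (b :: w)).E fun w => Q (List.ofFn x, w))
      rw [hval] at hsample
      have hmeans : (Mean.draws (signMeans D x (i + 1)) w).E (fun w => Q (List.ofFn x, w))
          = (signMean D x ⟨i, hin⟩).E fun b =>
            (Mean.draws (signMeans D x i) (b :: w)).E fun w => Q (List.ofFn x, w) := by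
        rw [signMeans, dif_pos hin]; rfl
      rw [hmeans]
      have t1' : τ1 ≤ c₁ * (n + 1) := by simpa using t1
      refine (Wp.while_go h6 (Wp.seq (Wp.exec (Exec.copy _ _ _) (Wp.seq (Wp.exec e1
        (Wp.seq hsample)))))).mono ?_ (by omega)
      have e : (i + 1) * (c₁ * (n + 1) + c₂ * (n + 1) + n + 12)
        = i * (c₁ * (n + 1) + c₂ * (n + 1) + n + 12) + (c₁ * (n + 1) + c₂ * (n + 1) + n + 12) := by
        ring
      omega
  have := Wp.seq (Wp.sample (D := D) (r := r) (x := 4) (t := t + 1) (s := s)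
    (B := c₀ * (n + 1) + 6 + (n * (c₁ * (n + 1) + c₂ * (n + 1) + n + 12) + 6 + B)) (S := n + S)
    (G := G) (k := .seq (.copy 5 4) (.seq p₀ (.seq (.fst 6 5) (.seq
    (.whileNZ 6 (.seq (.copy 6 5) (.seq p₁ (.seq (.condSample 7 6) (.seq (.pair 5 5 7)
      (.seq p₂ (.fst 6 5))))))) (.seq (.snd 5 5) (.seq (.snd 5 5) (.pair 4 4 5)))))) :: k)
    (fun x => (Mean.draws (signMeans D x n) []).E fun w => Q (List.ofFn x, w)) ?_)
  · refine this.mono ?_ (by omega)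
    have e : (c₀ + c₁ + c₂ + 40) * (n + 1) ^ 2 = n * (c₁ * (n + 1) + c₂ * (n + 1) + n + 12)
      + (c₀ * (n + 1) + n + 22) + (c₀ * n * (n + 1) + c₁ * (n + 1) + c₂ * (n + 1)
        + 39 * n * n + 67 * n + 18) := by ring
    rw [e]
    generalize n * (c₁ * (n + 1) + c₂ * (n + 1) + n + 12) = X
    generalize c₀ * (n + 1) = Y
    omega
  · intro x hx
    obtain ⟨r1, τ1, e1, b1, f1, t1⟩ := h₀ (List.ofFn x)
      (Function.update (Function.update r 4 (Val.ofPoint x)) 5 (Val.ofPoint x))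
      (by simp [ofPoint_eq])
    have hr1 : ∀ j < 5, r1 j = Function.update r 4 (Val.ofPoint x) j := fun j hj => by
      rw [f1 j hj, Function.update_of_ne (by omega)]
    have hcopy := Exec.copy 5 4 (Function.update r 4 (Val.ofPoint x))
    rw [Function.update_self] at hcopy
    have t1' : τ1 ≤ c₀ * (n + 1) := by simpa using t1
    refine (Wp.seq (Wp.exec hcopy (Wp.seq (Wp.exec e1 (Wp.seq (Wp.exec (Exec.fst _ _ _)
      (Wp.seq (loop x hx n le_rfl [] _ _ _ (fun j hj => ?_) ?_ ?_ ?_)))))))).mono (by omega) le_rfl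
    · rw [Function.update_of_ne (by omega), hr1 j (by omega), Function.update_of_ne (by omega)]
    · rw [Function.update_of_ne (by omega), hr1 4 (by omega), Function.update_self, ofPoint_eq]
    · rw [Function.update_of_ne (by omega), b1]
      dsimp only
      rw [List.length_ofFn]
    · simp

end Conditional

/-! ### The records estimate masses and influences -/

section Estimates

variable {n : ℕ}

/-- The statistic of a record that is averaged: membership in the subcube of `ρ` or, for a
coordinate `i`, the sign for `i` if the record lies in the subcube. -/
def stat (κ : (Fin n → Option Bool) × Option (Fin n)) (r : Record) : ℝ :=
  if Matches κ.1 r.1 then κ.2.elim 1 fun i => if r.2.getD i false then 1 else -1 else 0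

lemma abs_stat_le (κ : (Fin n → Option Bool) × Option (Fin n)) (r : Record) : |stat κ r| ≤ 1 := by
  unfold stat
  rcases κ with ⟨ρ, _ | i⟩ <;> simp only [Option.elim] <;> split_ifs <;> norm_num

lemma sum_stat_none (ρ : Fin n → Option Bool) (data : List Record) :
    (data.map (stat (ρ, none))).sum = (inside data ρ).length := by
  unfold inside
  induction data with
  | nil => simp
  | cons r l ih =>
    rw [List.map_cons, List.sum_cons, ih, List.filter_cons, stat]
    by_cases h : Matches ρ r.1 <;> simp [h, add_comm]

lemma sum_stat_some (ρ : Fin n → Option Bool) (i : Fin n) (data : List Record) :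
    (data.map (stat (ρ, some i))).sum = signSum i (inside data ρ) := by
  unfold inside signSum
  induction data with
  | nil => simp
  | cons r l ih =>
    rw [List.map_cons, List.sum_cons, ih, List.filter_cons, stat]
    by_cases h : Matches ρ r.1 <;> simp [h]

/-- In expectation, the statistics of a record are the masses of the subcubes and the weights of the
free coordinates. -/
structure Unbiased (M : Mean Record) (g : (Fin n → Bool) → ℝ) (h : Fin n → (Fin n → Bool) → ℝ) :
    Prop where
  mass : ∀ ρ, M.E (stat (ρ, none)) = mass g ρ
  weight : ∀ ρ, ∀ i ∈ free ρ, M.E (stat (ρ, some i)) = weight h i ρ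

lemma Unbiased.accurate {M : Mean Record} {g : (Fin n → Bool) → ℝ}
    {h : Fin n → (Fin n → Bool) → ℝ} (hM : Unbiased M g h) {m : ℕ} {c : ℝ} {data : List Record}
    (hlen : data.length = m)
    (hdev : ¬ ∃ κ, m * c < |(data.map (stat (n := n) κ)).sum - m * M.E (stat κ)|) :
    Accurate m g h c data where
  length_eq := hlen
  mass ρ := by
    have := not_lt.1 (not_exists.1 hdev (ρ, none))
    rwa [sum_stat_none, hM.mass] at this
  weight ρ i hi := by
    have := not_lt.1 (not_exists.1 hdev (ρ, some i))
    rwa [sum_stat_some, hM.weight ρ i hi] at this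

/-- The sum over a subcube is unchanged if a function is averaged over the edges in a free
direction. -/
lemma sum_symm {ρ : Fin n → Option Bool} {i : Fin n} (hi : i ∈ free ρ)
    (F H : (Fin n → Bool) → ℝ) (hF : ∀ x, F x + F (flip i x) = 2 * H x) :
    ∑ x ∈ points ρ, F x = ∑ x ∈ points ρ, H x := by
  have h1 := sum_flip hi F
  have h2 : ∑ x ∈ points ρ, (F x + F (flip i x)) = 2 * ∑ x ∈ points ρ, H x := by
    rw [Finset.mul_sum]; exact Finset.sum_congr rfl fun x _ => hF x
  rw [Finset.sum_add_distrib, h1] at h2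
  linarith

lemma sampleMean_indicator (D : PMF (Fin n → Bool)) (ρ : Fin n → Option Bool)
    (F : (Fin n → Bool) → ℝ) :
    (sampleMean D).E (fun x => if Matches ρ (List.ofFn x) then F x else 0)
      = ∑ x ∈ points ρ, (D x).toReal * F x := by
  simp only [sampleMean, Mean.ofWeights, matches_ofFn, mul_ite, mul_zero]
  rw [← Finset.sum_filter]
  exact Finset.sum_congr (by ext; simp) fun _ _ => rfl

lemma getD_ofFn (x : Fin n → Bool) (i : Fin n) : (List.ofFn x).getD i false = x i := by
  simp [List.getD_eq_getElem?_getD]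

/-- For monotone distributions the sign of the difference along an edge is known, so that the `L¹`
influence itself can be estimated from random samples. -/
lemma edgeWeight_mono (g : (Fin n → Bool) → ℝ) (hg : ∀ x, 0 ≤ g x) :
    EdgeWeight g (fun i x => |g x - g (flip i x)| / 2) where
  nonneg _ _ := by positivity
  le _ _ := le_rfl
  sq_le i x := by
    have h1 : |g x - g (flip i x)| ≤ g x + g (flip i x) :=
      abs_le.2 ⟨by linarith [hg x, hg (flip i x)], by linarith [hg x, hg (flip i x)]⟩
    rw [← sq_abs]
    nlinarith [abs_nonneg (g x - g (flip i x))]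

lemma unbiased_monoRecord {D : PMF (Fin n → Bool)} (hD : IsMonotone D) :
    Unbiased (monoRecord D) (fun x => (D x).toReal)
      (fun i x => |(D x).toReal - (D (flip i x)).toReal| / 2) where
  mass ρ := by
    refine (sampleMean_indicator D ρ fun _ => 1).trans ?_
    simp [mass]
  weight ρ i hi := by
    refine (sampleMean_indicator D ρ fun x => if (List.ofFn x).getD i false then 1 else -1).trans ?_
    refine sum_symm hi _ _ fun x => ?_
    have hle : ∀ y : Fin n → Bool, y i = false → (D y).toReal ≤ (D (flip i y)).toReal := by
      intro y hy
      refine ENNReal.toReal_mono (D.apply_ne_top _) (hD _ _ fun j => ?_)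
      by_cases hj : j = i
      · subst hj; rw [hy]; exact Bool.false_le _
      · rw [flip_ne hj]
    simp only [getD_ofFn, flip_same]
    cases hx : x i
    · have := hle x hx
      rw [abs_of_nonpos (by linarith)]
      simp; ring
    · have := hle (flip i x) (by simp [hx])
      rw [flip_flip] at this
      rw [abs_of_nonneg (by linarith)]
      simp; ring

/-- What conditional samples from the edges of random points estimate: an edge with probabilities
`p` and `q` contributes `(p - q)² / (p + q)`, distributed evenly over its two ends. -/
lemma edgeWeight_cond (g : (Fin n → Bool) → ℝ) (hg : ∀ x, 0 ≤ g x) :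
    EdgeWeight g (fun i x => (g x - g (flip i x)) ^ 2 / (2 * (g x + g (flip i x)))) where
  nonneg i x := by have := hg x; have := hg (flip i x); positivity
  le i x := by
    have hp := hg x
    have hq := hg (flip i x)
    have h1 : |g x - g (flip i x)| ≤ g x + g (flip i x) :=
      abs_le.2 ⟨by linarith, by linarith⟩
    refine div_le_of_le_mul₀ (by positivity) (by positivity) ?_
    rw [← sq_abs]
    nlinarith [abs_nonneg (g x - g (flip i x))]
  sq_le i x := by
    have hp := hg x
    have hq := hg (flip i x)
    rcases (add_nonneg hp hq).eq_or_lt with h0 | h0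
    · have h1 : g x = 0 := by linarith
      have h2 : g (flip i x) = 0 := by linarith
      simp [h1, h2]
    · refine le_of_eq ?_
      field_simp

/-- The marginal distributions of the list of signs. -/
lemma draws_signMeans (D : PMF (Fin n → Bool)) (x : Fin n → Bool) (F : Bool → ℝ) (k : ℕ)
    (w : List Bool) (i : ℕ) :
    (Mean.draws (signMeans D x k) w).E (fun l => F (l.getD i false))
      = if h : i < k ∧ i < n then (signMean D x ⟨i, h.2⟩).E F
        else if i < k then F true else F (w.getD (i - k) false) := by
  induction k generalizing w with
  | zero => simp [signMeans, Mean.draws, Mean.pure]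
  | succ k ih =>
    have hstep : (Mean.draws (signMeans D x (k + 1)) w).E (fun l => F (l.getD i false))
        = (if h : k < n then signMean D x ⟨k, h⟩ else .pure true).E fun b =>
          (Mean.draws (signMeans D x k) (b :: w)).E (fun l => F (l.getD i false)) := rfl
    rw [hstep]
    simp only [ih]
    rcases lt_trichotomy i k with hik | rfl | hik
    · by_cases hn : i < n
      · simp only [hik, hn, and_self, dif_pos, Mean.const, show i < k + 1 by omega]
      · simp only [hik, hn, and_false, dif_neg, not_false_iff, if_true, Mean.const,
          show i < k + 1 by omega]
    · by_cases hn : i < n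
      · simp [hn]
      · simp [hn, Mean.pure]
    · have h1 : ¬ i < k := by omega
      have h2 : ¬ i < k + 1 := by omega
      obtain ⟨j, rfl⟩ := Nat.exists_eq_add_of_lt hik
      simp only [h1, h2, false_and, dif_neg, not_false_iff, if_false, Mean.const,
        show k + j + 1 - k = j + 1 by omega, show k + j + 1 - (k + 1) = j by omega,
        List.getD_cons_succ]

lemma unbiased_condRecord (D : PMF (Fin n → Bool)) :
    Unbiased (condRecord D) (fun x => (D x).toReal) (fun i x =>
      ((D x).toReal - (D (flip i x)).toReal) ^ 2
        / (2 * ((D x).toReal + (D (flip i x)).toReal))) where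
  mass ρ := by
    refine Eq.trans ?_ ((sampleMean_indicator D ρ fun _ => 1).trans (by simp [mass]))
    refine congrArg (sampleMean D).E (funext fun x => ?_)
    exact (Mean.draws (signMeans D x n) []).const (if Matches ρ (List.ofFn x) then 1 else 0)
  weight ρ i hi := by
    refine Eq.trans ?_ ((sampleMean_indicator D ρ fun x => 1 - 2 * flipProb D x i).trans ?_)
    · refine congrArg (sampleMean D).E (funext fun x => ?_)
      have h1 := draws_signMeans D x (fun b => if b then 1 else -1) n [] i
      rw [dif_pos ⟨i.2, i.2⟩] at h1
      change (Mean.draws (signMeans D x n) []).E (fun w => if Matches ρ (List.ofFn x) then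
        (if w.getD i false then (1 : ℝ) else -1) else 0) = _
      split_ifs with hx
      · rw [h1]
        simp only [signMean, Mean.ofWeights, Fintype.sum_bool]
        simp
        ring
      · exact Mean.const _ _
    · refine sum_symm hi _ _ fun x => ?_
      simp only [flipProb, flip_flip]
      have hp : 0 ≤ (D x).toReal := ENNReal.toReal_nonneg
      have hq : 0 ≤ (D (flip i x)).toReal := ENNReal.toReal_nonneg
      generalize (D x).toReal = p at hp ⊢
      generalize (D (flip i x)).toReal = q at hq ⊢
      rcases (add_nonneg hp hq).eq_or_lt with h0 | h0
      · obtain rfl : p = 0 := by linarith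
        obtain rfl : q = 0 := by linarith
        simp
      · rw [add_comm q p]
        field_simp
        ring

end Estimates

/-! ### The choice of the parameters -/

/-- With accurate samples, the search leaves out a coordinate in a subcube only if its influence is
about a fraction `1 / lam d e` of the mass of the subcube or less. -/
def lam (d e : ℕ) : ℕ := 2 * d ^ 3 * e ^ 2

/-- The inverse of the accuracy required of the samples. -/
def gam (n d e : ℕ) : ℕ := 2 ^ (d + 2) * d * e ^ 2 * (d * lam d e + n)

/-- The ratio of the number of samples and of `gam n d e`. -/
def ratio (n d e L : ℕ) : ℕ := 64 * gam n d e * (n + 1 + L)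

/-- The parameters for depth `d`, accuracy `1 / e` and confidence `2 ^ (-L)` in dimension `n`. At
depth `0` all of them vanish except for the number of samples, which is `1`. -/
def tuned (n d e L : ℕ) : Params where
  m := gam n d e * ratio n d e L + (1 - d)
  A := lam d e * lam d e
  K := d * (lam d e * lam d e)
  G := 2 * ratio n d e L * (lam d e * lam d e)

lemma lam_pos {d e : ℕ} (hd : 0 < d) (he : 0 < e) : 0 < lam d e := by
  unfold lam; positivity

lemma gam_pos {d e : ℕ} (hd : 0 < d) (he : 0 < e) (n : ℕ) : 0 < gam n d e := by
  have := lam_pos hd he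
  unfold gam; positivity

lemma ratio_pos {d e : ℕ} (hd : 0 < d) (he : 0 < e) (n L : ℕ) : 0 < ratio n d e L := by
  have := gam_pos hd he n
  unfold ratio; positivity

lemma tuned_m {d : ℕ} (hd : 0 < d) (n e L : ℕ) :
    (tuned n d e L).m = gam n d e * ratio n d e L := by
  have : 1 - d = 0 := by omega
  simp [tuned, this]

lemma tuned_zero (n e L : ℕ) : tuned n 0 e L = ⟨1, 0, 0, 0⟩ := by
  simp [tuned, ratio, gam, lam]

lemma tuned_spec {d e : ℕ} (hd : 0 < d) (he : 0 < e) (n L : ℕ) :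
    Tuned n d e (gam n d e) (lam d e) (tuned n d e L) where
  d_pos := hd
  e_pos := he
  m_pos := by
    rw [tuned_m hd]
    exact Nat.mul_pos (gam_pos hd he n) (ratio_pos hd he n L)
  Λ_eq := rfl
  A_eq := rfl
  K_eq := rfl
  Γ_eq := rfl
  G_eq := by
    have h : (gam n d e : ℝ) ≠ 0 := by have := gam_pos hd he n; positivity
    rw [tuned_m hd]
    simp only [tuned]
    push_cast
    field_simp

/-- The number of records suffices for all `3 ^ n` subcubes and all coordinates at once: the
exponent in the Chernoff bound is `m / (16 Γ²) = 4 (n + 1 + L)`. -/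
lemma prob_deviation_le {n d e L : ℕ} (hd : 0 < d) (he : 0 < e) {δ : ℝ} (hδ : 0 < δ)
    (hL : Real.log (1 / δ) ≤ L) (M : Mean Record) :
    (Mean.draws (List.replicate (tuned n d e L).m M) []).prob (fun data =>
      ∃ κ, (tuned n d e L).m * (1 / (gam n d e : ℝ))
        < |(data.map (stat (n := n) κ)).sum - (tuned n d e L).m * M.E (stat κ)|) ≤ δ := by
  have hΓ : (1 : ℝ) ≤ gam n d e := by exact_mod_cast gam_pos hd he n
  refine (M.prob_exists_deviation_le (stat (n := n)) abs_stat_le _ (by positivity)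
    (by rw [div_le_one (by positivity)]; exact hΓ)).trans ?_
  have hcard : Fintype.card ((Fin n → Option Bool) × Option (Fin n)) = 3 ^ n * (n + 1) := by simp
  have hexp : ((tuned n d e L).m : ℝ) * (1 / (gam n d e : ℝ)) ^ 2 / 16 = 4 * (n + 1 + L) := by
    rw [tuned_m hd, ratio]
    push_cast
    field_simp
    norm_num
  have he1 : (2 : ℝ) ≤ Real.exp 1 := by have := Real.add_one_le_exp (1 : ℝ); linarith
  have h3 : (3 : ℝ) ≤ Real.exp 2 := by have := Real.add_one_le_exp (2 : ℝ); linarith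
  have h3n : (3 : ℝ) ^ n ≤ Real.exp (2 * n) := by
    rw [mul_comm, Real.exp_nat_mul]; exact pow_le_pow_left₀ (by norm_num) h3 n
  have hn : (n : ℝ) + 1 ≤ Real.exp n := Real.add_one_le_exp _
  have hδ' : Real.exp (-L) ≤ δ := by
    rw [← Real.exp_log hδ]
    refine Real.exp_le_exp.2 ?_
    rw [one_div, Real.log_inv] at hL
    linarith
  rw [hcard, hexp]
  push_cast
  calc 2 * ((3 : ℝ) ^ n * (n + 1)) * Real.exp (-(4 * (n + 1 + L)))
      ≤ Real.exp 1 * (Real.exp (2 * n) * Real.exp n) * Real.exp (-(4 * (n + 1 + L))) := by gcongr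
    _ = Real.exp (1 + (2 * n + n) + -(4 * (n + 1 + L))) := by
      rw [Real.exp_add, Real.exp_add, Real.exp_add]
    _ ≤ Real.exp (-L) := by
      refine Real.exp_le_exp.2 ?_
      have : (0 : ℝ) ≤ n := Nat.cast_nonneg n
      have : (0 : ℝ) ≤ L := Nat.cast_nonneg L
      linarith
    _ ≤ δ := hδ'

/-- The data lead to a good tree with probability at least `1 - δ`, expressed by a lower bound `Q`
for the indicator function of this event. -/
lemma exists_indicator {n d e L : ℕ} {ε δ : ℝ} (he : 0 < e) (heε : 1 / (e : ℝ) ≤ ε) (hδ : 0 < δ)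
    (hL : Real.log (1 / δ) ≤ L) {D : PMF (Fin n → Bool)} (hD : RepresentableByDepth D d)
    {M : Mean Record} {h : Fin n → (Fin n → Bool) → ℝ}
    (hM : Unbiased M (fun x => (D x).toReal) h) (hw : EdgeWeight (fun x => (D x).toReal) h) :
    ∃ Q : List Record → ℝ,
      1 - δ ≤ (Mean.draws (List.replicate (tuned n d e L).m M) []).E Q ∧
      ∀ data, data.length = (tuned n d e L).m → Q data ≤ 1 ∧
        (¬ GoodOutput D d ε (best (tuned n d e L) d (data, (List.range n).reverse)).2 →
          Q data ≤ 0) := by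
  classical
  have hrep : ∀ data : List Record,
      Represents data (fun _ : Fin n => none) (data, (List.range n).reverse) := fun data =>
    { perm := by rw [inside_none]
      nodup := List.nodup_reverse.2 List.nodup_range
      mem := fun j => by
        simp only [List.mem_reverse, List.mem_range, mem_free, true_and]
        exact ⟨fun hj => ⟨⟨j, hj⟩, rfl⟩, fun ⟨i, hi⟩ => hi ▸ i.2⟩ }
  rcases Nat.eq_zero_or_pos d with rfl | hd
  · refine ⟨fun _ => 1, ?_, fun data hlen => ⟨le_rfl, fun hbad => absurd ?_ hbad⟩⟩
    · rw [Mean.one]; linarith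
    · rw [tuned_zero] at hlen ⊢
      have : (0 : ℝ) ≤ 1 / (e : ℝ) := by positivity
      exact goodOutput_zero hD rfl hlen (this.trans heε) (hrep data)
  · set bad : List Record → Prop := fun data =>
      ∃ κ, (tuned n d e L).m * (1 / (gam n d e : ℝ))
        < |(data.map (stat (n := n) κ)).sum - (tuned n d e L).m * M.E (stat κ)| with hbad
    refine ⟨fun data => if ¬ bad data then 1 else 0, ?_, fun data hlen => ⟨?_, fun hgood => ?_⟩⟩
    · have h1 := (Mean.draws (List.replicate (tuned n d e L).m M) []).prob_not bad
      have h2 := prob_deviation_le (n := n) hd he hδ hL M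
      have h3 : (Mean.draws (List.replicate (tuned n d e L).m M) []).E
          (fun data => if ¬ bad data then 1 else 0)
          = (Mean.draws (List.replicate (tuned n d e L).m M) []).prob (fun data => ¬ bad data) := by
        unfold Mean.prob; congr! 3
      rw [h3, h1]
      linarith
    · dsimp only
      split_ifs <;> norm_num
    · dsimp only
      rw [if_neg]
      intro hb
      exact hgood (goodOutput_of_accurate hD (tuned_spec hd he n L) hw (hM.accurate hlen hb) heε
        (hrep data))

/-! ### The computation of the parameters -/

/-- The time, up to a constant, for the computation of the parameters. -/
def tuneTime (n d e L : ℕ) : ℕ :=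
  d + d ^ 3 + d ^ 3 * e + d * e + d * e ^ 2 + lam d e + lam d e * lam d e + gam n d e + n + L

namespace Computes

variable {ι : Type} {a : ι → Val} {T : ι → ℕ} {x y : ι → ℕ}

lemma mulNum (hx : Computes a (fun i => .num (x i)) T) (hy : Computes a (fun i => .num (y i)) T)
    (hT : ∀ i, x i ≤ T i) : Computes a (fun i => .num (x i * y i)) T :=
  mul.call (fun i => (x i, y i)) (hx.pair hy) hT

lemma addNum (hx : Computes a (fun i => .num (x i)) T) (hy : Computes a (fun i => .num (y i)) T) :
    Computes a (fun i => .num (x i + y i)) T := hx.add hy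

lemma shiftNum (hx : Computes a (fun i => .num (x i)) T) (hy : Computes a (fun i => .num (y i)) T)
    (C : ℕ) (hT : ∀ i, y i ≤ C * (T i + 1)) : Computes a (fun i => .num (x i * 2 ^ y i)) T :=
  (hx.pair hy).trans ((shift.reindex fun i => (x i, y i)).mono_const C hT)

/-- Indices `(n, d, e, L)` for the computation of the parameters. -/
abbrev TuneIndex : Type := ℕ × ℕ × ℕ × ℕ

/-- The time for the computation of the parameters, as a function of the index. -/
abbrev tuneBound (p : TuneIndex) : ℕ := tuneTime p.1 p.2.1 p.2.2.1 p.2.2.2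

variable {a : TuneIndex → Val}

-- in the products below, a factor that vanishes for `d = 0` comes first, as it determines the time
lemma lam (hd : Computes a (fun p => .num p.2.1) tuneBound)
    (he : Computes a (fun p => .num p.2.2.1) tuneBound) :
    Computes a (fun p => .num (DTLearn.lam p.2.1 p.2.2.1)) tuneBound := by
  have hd3 := hd.mulNum (hd.mulNum hd fun p => by unfold tuneBound tuneTime; omega) fun p => by
    unfold tuneBound tuneTime; omega
  have hd3e := hd3.mulNum he fun p => by
    rw [show p.2.1 * (p.2.1 * p.2.1) = p.2.1 ^ 3 by ring]; unfold tuneBound tuneTime; omega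
  have hd3e2 := hd3e.mulNum he fun p => by
    rw [show p.2.1 * (p.2.1 * p.2.1) * p.2.2.1 = p.2.1 ^ 3 * p.2.2.1 by ring]
    unfold tuneBound tuneTime; omega
  refine (hd3e2.addNum hd3e2).congr_right fun p => ?_
  rw [DTLearn.lam]
  congr 1
  ring

lemma gam (hn : Computes a (fun p => .num p.1) tuneBound)
    (hd : Computes a (fun p => .num p.2.1) tuneBound)
    (he : Computes a (fun p => .num p.2.2.1) tuneBound) :
    Computes a (fun p => .num (DTLearn.gam p.1 p.2.1 p.2.2.1)) tuneBound := by
  have hde := hd.mulNum he fun p => by unfold tuneBound tuneTime; omega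
  have hde2 := hde.mulNum he fun p => by unfold tuneBound tuneTime; omega
  have hsum := (hd.mulNum (lam hd he) fun p => by unfold tuneBound tuneTime; omega).addNum hn
  have hprod := hde2.mulNum hsum fun p => by
    rw [show p.2.1 * p.2.2.1 * p.2.2.1 = p.2.1 * p.2.2.1 ^ 2 by ring]
    unfold tuneBound tuneTime; omega
  refine (hprod.shiftNum (hd.addNum (const _ _ 2)) 2 fun p => by
    unfold tuneBound tuneTime; omega).congr_right fun p => ?_
  rw [DTLearn.gam]
  congr 1
  ring

lemma ratio (hn : Computes a (fun p => .num p.1) tuneBound)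
    (hL : Computes a (fun p => .num p.2.2.2) tuneBound)
    (hgam : Computes a (fun p => .num (DTLearn.gam p.1 p.2.1 p.2.2.1)) tuneBound) :
    Computes a (fun p => .num (DTLearn.ratio p.1 p.2.1 p.2.2.1 p.2.2.2)) tuneBound := by
  have hmul := hgam.mulNum (hn.addNum ((const _ _ 1).addNum hL)) fun p => by
    unfold tuneBound tuneTime; omega
  refine (hmul.shiftNum (const _ _ 6) 6 fun p => by omega).congr_right fun p => ?_
  rw [DTLearn.ratio]
  congr 1
  ring

lemma tuned : Computes
    (fun p : TuneIndex =>
      .pair (.num p.1) (.pair (.num p.2.1) (.pair (.num p.2.2.1) (.num p.2.2.2))))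
    (fun p => .pair (.pair (.num p.1) (.num p.2.1))
      (encParams (DTLearn.tuned p.1 p.2.1 p.2.2.1 p.2.2.2))) tuneBound := by
  set a : TuneIndex → Val := fun p =>
    .pair (.num p.1) (.pair (.num p.2.1) (.pair (.num p.2.2.1) (.num p.2.2.2)))
  have ctx := id a tuneBound
  have hn : Computes a (fun p => .num p.1) tuneBound := ctx.fst
  have hd : Computes a (fun p => .num p.2.1) tuneBound := ctx.snd.fst
  have he : Computes a (fun p => .num p.2.2.1) tuneBound := ctx.snd.snd.fst
  have hL : Computes a (fun p => .num p.2.2.2) tuneBound := ctx.snd.snd.snd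
  have hlam := lam hd he
  have hgam := gam hn hd he
  have hratio := ratio hn hL hgam
  have hA := hlam.mulNum hlam fun p => by unfold tuneBound tuneTime; omega
  have hK := hd.mulNum hA fun p => by unfold tuneBound tuneTime; omega
  have hm := (hgam.mulNum hratio fun p => by unfold tuneBound tuneTime; omega).addNum
    ((const _ _ 1).sub hd)
  have hG := hA.mulNum hratio fun p => by unfold tuneBound tuneTime; omega
  refine ((hn.pair hd).pair (hm.pair (hA.pair (hK.pair (hG.addNum hG))))).congr_right fun p => ?_
  rw [encParams]
  congr 4
  exact congrArg Val.num (by rw [DTLearn.tuned]; ring)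

end Computes

/-! ### Size of the parameters -/

section Size

/-- All parameters are polynomial in this number, in `n` and in `L`. -/
def size (d e : ℕ) : ℕ := (2 * d * e) ^ d

lemma size_pos {e : ℕ} (he : 0 < e) (d : ℕ) : 0 < size d e := by
  unfold size
  rcases Nat.eq_zero_or_pos d with rfl | hd
  · simp
  · positivity

variable {d e : ℕ}

lemma le_size (hd : 0 < d) : 2 * d * e ≤ size d e := Nat.le_self_pow hd.ne' _

lemma two_le_size (hd : 0 < d) (he : 0 < e) : 2 ≤ size d e := by
  refine le_trans ?_ (le_size hd)
  have : 1 ≤ d * e := Nat.mul_pos hd he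
  rw [mul_assoc]; omega

lemma lam_le (hd : 0 < d) (he : 0 < e) : lam d e ≤ size d e ^ 3 := by
  refine le_trans ?_ (Nat.pow_le_pow_left (le_size hd) 3)
  have h : d ^ 3 * e ^ 2 * 1 ≤ d ^ 3 * e ^ 2 * e := Nat.mul_le_mul_left _ he
  have h8 : (2 * d * e) ^ 3 = 8 * (d ^ 3 * e ^ 2 * e) := by ring
  rw [lam, mul_assoc]
  omega

lemma le_size_self (hd : 0 < d) (he : 0 < e) : d ≤ size d e := by
  refine le_trans ?_ (le_size hd)
  nlinarith [Nat.mul_le_mul_left d he]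

lemma gam_le (hd : 0 < d) (he : 0 < e) (n : ℕ) : gam n d e ≤ size d e ^ 7 * (n + 1) := by
  have h1 : 2 ^ d ≤ size d e := by
    refine Nat.pow_le_pow_left ?_ d
    have : 1 ≤ d * e := Nat.mul_pos hd he
    rw [mul_assoc]; omega
  have h2 : 4 * (d * e ^ 2) ≤ size d e ^ 2 := by
    refine le_trans ?_ (Nat.pow_le_pow_left (le_size hd) 2)
    have : d * e ^ 2 * 1 ≤ d * e ^ 2 * d := Nat.mul_le_mul_left _ hd
    nlinarith
  have h3 : d * lam d e + n ≤ size d e ^ 4 * (n + 1) := by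
    have h4 : d * lam d e ≤ size d e * size d e ^ 3 :=
      Nat.mul_le_mul (le_size_self hd he) (lam_le hd he)
    have h5 : n * 1 ≤ n * size d e ^ 4 := Nat.mul_le_mul_left _ (pow_pos (size_pos he d) 4)
    calc _ ≤ size d e * size d e ^ 3 + n * size d e ^ 4 := by omega
      _ = _ := by ring
  calc gam n d e = 2 ^ d * (4 * (d * e ^ 2)) * (d * lam d e + n) := by unfold gam; ring
    _ ≤ size d e * size d e ^ 2 * (size d e ^ 4 * (n + 1)) :=
      Nat.mul_le_mul (Nat.mul_le_mul h1 h2) h3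
    _ = _ := by ring

lemma m_le (he : 0 < e) (n L : ℕ) :
    (tuned n d e L).m ≤ size d e ^ 20 * (n + 1) ^ 3 * (1 + L) := by
  rcases Nat.eq_zero_or_pos d with rfl | hd
  · rw [tuned_zero]
    have := size_pos he 0
    change 0 < _
    positivity
  · have h64 : 2 ^ 6 ≤ size d e ^ 6 := Nat.pow_le_pow_left (two_le_size hd he) 6
    have hL : n + 1 + L ≤ (n + 1) * (1 + L) := by nlinarith [Nat.zero_le (n * L)]
    have hΓ := gam_le hd he n
    rw [tuned_m hd, ratio]
    calc gam n d e * (64 * gam n d e * (n + 1 + L))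
        ≤ (size d e ^ 7 * (n + 1)) * (size d e ^ 6 * (size d e ^ 7 * (n + 1))
            * ((n + 1) * (1 + L))) := by gcongr; omega
      _ = _ := by ring

lemma pow_K_le (he : 0 < e) (n L : ℕ) : (3 * (tuned n d e L).K + 1) ^ d ≤ size d e ^ 7 := by
  unfold size
  rw [← pow_mul, mul_comm d, pow_mul]
  rcases Nat.eq_zero_or_pos d with rfl | hd
  · simp
  · refine Nat.pow_le_pow_left ?_ d
    have h1 : 1 ≤ d ^ 7 * e ^ 7 := Nat.mul_pos (pow_pos hd 7) (pow_pos he 7)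
    have h2 : d ^ 7 * e ^ 4 * 1 ≤ d ^ 7 * e ^ 4 * e ^ 3 := Nat.mul_le_mul_left _ (pow_pos he 3)
    calc 3 * (tuned n d e L).K + 1 = 12 * (d ^ 7 * e ^ 4) + 1 := by simp only [tuned, lam]; ring
      _ ≤ 128 * (d ^ 7 * e ^ 7) := by nlinarith
      _ = _ := by ring

lemma three_mul_K_le (he : 0 < e) (n L : ℕ) : 3 * (tuned n d e L).K + 1 ≤ size d e ^ 7 := by
  rcases Nat.eq_zero_or_pos d with rfl | hd
  · have := size_pos he 0
    rw [tuned_zero]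
    exact pow_pos this 7
  · exact (Nat.le_self_pow hd.ne' _).trans (pow_K_le he n L)

lemma A_le (he : 0 < e) (n L : ℕ) : (tuned n d e L).A ≤ size d e ^ 6 := by
  rcases Nat.eq_zero_or_pos d with rfl | hd
  · rw [tuned_zero]; exact Nat.zero_le _
  · calc _ ≤ size d e ^ 3 * size d e ^ 3 := Nat.mul_le_mul (lam_le hd he) (lam_le hd he)
      _ = _ := by ring

lemma nodeTime_le (he : 0 < e) (n L : ℕ) :
    nodeTime n (tuned n d e L) ≤ 4 * (size d e ^ 27 * (n + 1) ^ 5 * (1 + L)) := by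
  have hs := size_pos he d
  have h1 : (tuned n d e L).A + (tuned n d e L).K + 1 ≤ 2 * size d e ^ 7 := by
    have := three_mul_K_le (d := d) he n L
    have := A_le (d := d) he n L
    have : size d e ^ 6 ≤ size d e ^ 7 := Nat.pow_le_pow_right hs (by norm_num)
    omega
  have h2 : (tuned n d e L).m + 1 ≤ 2 * (size d e ^ 20 * (n + 1) ^ 3 * (1 + L)) := by
    have := m_le (d := d) he n L
    have : 0 < size d e ^ 20 * (n + 1) ^ 3 * (1 + L) := by positivity
    omega
  unfold nodeTime
  calc _ ≤ (n + 1) ^ 2 * (2 * (size d e ^ 20 * (n + 1) ^ 3 * (1 + L))) * (2 * size d e ^ 7) := by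
        gcongr
    _ = _ := by ring

lemma searchTime_le (he : 0 < e) (n L : ℕ) :
    searchTime n d (tuned n d e L) ≤ 13 * (size d e ^ 35 * (n + 1) ^ 5 * (1 + L)) := by
  have hs := size_pos he d
  have hd : d + 1 ≤ 2 * size d e := by
    rcases Nat.eq_zero_or_pos d with rfl | hd
    · omega
    · have := le_size_self hd he; have := two_le_size hd he; omega
  have h1 : size d e ^ 7 ≤ size d e ^ 27 * (n + 1) ^ 5 * (1 + L) := by
    calc size d e ^ 7 ≤ size d e ^ 27 := Nat.pow_le_pow_right hs (by norm_num)
      _ ≤ size d e ^ 27 * ((n + 1) ^ 5 * (1 + L)) := Nat.le_mul_of_pos_right _ (by positivity)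
      _ = _ := by ring
  have h2 : n ≤ size d e ^ 35 * (n + 1) ^ 5 * (1 + L) := by
    calc n ≤ (n + 1) ^ 5 := (Nat.le_succ n).trans (Nat.le_self_pow (by norm_num) _)
      _ ≤ (n + 1) ^ 5 * (size d e ^ 35 * (1 + L)) := Nat.le_mul_of_pos_right _ (by positivity)
      _ = _ := by ring
  have h3 : (3 * (tuned n d e L).K + 1) ^ d * (nodeTime n (tuned n d e L)
      + 3 * (tuned n d e L).K + 1) + 1 ≤ 6 * (size d e ^ 34 * (n + 1) ^ 5 * (1 + L)) := by
    have h4 := nodeTime_le (d := d) he n L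
    have h5 := three_mul_K_le (d := d) he n L
    have h6 : 0 < size d e ^ 34 * (n + 1) ^ 5 * (1 + L) := by positivity
    calc _ ≤ size d e ^ 7 * (5 * (size d e ^ 27 * (n + 1) ^ 5 * (1 + L))) + 1 :=
          Nat.add_le_add_right (Nat.mul_le_mul (pow_K_le he n L) (by omega)) 1
      _ = 5 * (size d e ^ 34 * (n + 1) ^ 5 * (1 + L)) + 1 := by ring
      _ ≤ _ := by omega
  unfold searchTime
  calc _ ≤ size d e ^ 35 * (n + 1) ^ 5 * (1 + L)
        + 2 * size d e * (6 * (size d e ^ 34 * (n + 1) ^ 5 * (1 + L))) :=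
        Nat.add_le_add h2 (Nat.mul_le_mul hd h3)
    _ = _ := by ring

lemma nodeTime_add_le (n d : ℕ) (P : Params) : nodeTime n P + n ≤ searchTime n d P := by
  have h1 : 1 * nodeTime n P ≤ (3 * P.K + 1) ^ d * (nodeTime n P + 3 * P.K + 1) :=
    Nat.mul_le_mul (Nat.pos_of_ne_zero (by positivity)) (by omega)
  have h2 := Nat.le_mul_of_pos_left ((3 * P.K + 1) ^ d * (nodeTime n P + 3 * P.K + 1) + 1)
    (Nat.add_one_pos d)
  unfold searchTime
  omega

lemma tuneTime_le (he : 0 < e) (n L : ℕ) :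
    tuneTime n d e L ≤ 8 * (searchTime n d (tuned n d e L) + L) := by
  have hnode := nodeTime_add_le n d (tuned n d e L)
  rcases Nat.eq_zero_or_pos d with rfl | hd
  · simp only [tuneTime, lam, gam]
    ring_nf
    omega
  have hl : 0 < lam d e := lam_pos hd he
  have hA : lam d e * lam d e ≤ nodeTime n (tuned n d e L) := by
    unfold nodeTime
    refine le_trans (show lam d e * lam d e ≤ (tuned n d e L).A + (tuned n d e L).K + 1 from ?_)
      (Nat.le_mul_of_pos_left _ (by positivity))
    simp only [tuned]; omega
  have hm : gam n d e ≤ nodeTime n (tuned n d e L) := by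
    have h1 : gam n d e ≤ (tuned n d e L).m := by
      rw [tuned_m hd]; exact Nat.le_mul_of_pos_right _ (ratio_pos hd he n L)
    unfold nodeTime
    calc gam n d e ≤ (tuned n d e L).m + 1 := by omega
      _ ≤ ((tuned n d e L).m + 1) * ((n + 1) ^ 2 * ((tuned n d e L).A + (tuned n d e L).K + 1)) :=
        Nat.le_mul_of_pos_right _ (by positivity)
      _ = _ := by ring
  have hll : lam d e ≤ lam d e * lam d e := Nat.le_mul_of_pos_left _ hl
  have h3e : 2 * (d ^ 3 * e) ≤ lam d e := by
    unfold lam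
    have : d ^ 3 * e * 1 ≤ d ^ 3 * e * e := Nat.mul_le_mul_left _ he
    nlinarith
  have h3 : d ^ 3 ≤ d ^ 3 * e := Nat.le_mul_of_pos_right _ he
  have h1 : d ≤ d ^ 3 := Nat.le_self_pow (by norm_num) _
  have hde : d * e ≤ d ^ 3 * e := Nat.mul_le_mul_right _ h1
  have hde2 : 2 * (d * e ^ 2) ≤ lam d e := by
    unfold lam
    have := Nat.mul_le_mul_right (e ^ 2) h1
    nlinarith
  unfold tuneTime
  omega

lemma m_mul_le_searchTime (n d : ℕ) (P : Params) : P.m * (n + 1) ^ 2 ≤ searchTime n d P := by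
  have h1 : P.m * (n + 1) ^ 2 ≤ nodeTime n P := by
    have := Computes.le_nodeTime n P
    rw [Nat.succ_mul] at this
    omega
  have := nodeTime_add_le n d P
  omega

/-- Passage to the form of the bound that is asked for. -/
lemma bound_le {n d : ℕ} {ε δ : ℝ} (hε : 0 < ε) (hε1 : ε ≤ 1) (hδ : 0 < δ) (hδ1 : δ ≤ 1) :
    ((size d ⌈1 / ε⌉₊ ^ 35 * (n + 1) ^ 5 * (1 + ⌈Real.logb 2 (1 / δ)⌉₊) : ℕ) : ℝ)
      ≤ 2 * 4 ^ 35 * ((n : ℝ) + 1) ^ 5 * ((d : ℝ) / ε) ^ (105 * d) * (1 + Real.log (1 / δ)) := by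
  have hinv : 1 ≤ 1 / ε := by rw [le_div_iff₀ hε]; linarith
  have he : (⌈1 / ε⌉₊ : ℝ) ≤ 2 / ε := by
    have := (Nat.ceil_lt_add_one (by positivity : 0 ≤ 1 / ε)).le
    have h2 : 2 / ε = 1 / ε + 1 / ε := by ring
    linarith
  have hlog0 : 0 ≤ Real.log (1 / δ) := Real.log_nonneg (by rw [le_div_iff₀ hδ]; linarith)
  have hL : (1 : ℝ) + ⌈Real.logb 2 (1 / δ)⌉₊ ≤ 2 * (1 + Real.log (1 / δ)) := by
    have h2 := Real.log_two_gt_d9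
    have h3 : Real.logb 2 (1 / δ) ≤ 2 * Real.log (1 / δ) := by
      rw [Real.logb, div_le_iff₀ (by linarith)]
      nlinarith
    have h4 : 0 ≤ Real.logb 2 (1 / δ) := div_nonneg hlog0 (by linarith)
    have := (Nat.ceil_lt_add_one h4).le
    linarith
  have hsize : (size d ⌈1 / ε⌉₊ : ℝ) ≤ 4 * ((d : ℝ) / ε) ^ (3 * d) := by
    rcases Nat.eq_zero_or_pos d with rfl | hd
    · simp [size]
    have hd1 : (1 : ℝ) ≤ d := by exact_mod_cast hd
    have hdε : (d : ℝ) ≤ d / ε := by rw [le_div_iff₀ hε]; nlinarith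
    have h4 : (4 : ℝ) ^ d ≤ 4 * (d : ℝ) ^ (2 * d) := by
      rcases Nat.lt_or_ge d 2 with h | h
      · obtain rfl : d = 1 := by omega
        norm_num
      · have hd2 : (2 : ℝ) ≤ d := by exact_mod_cast h
        have : (4 : ℝ) ^ d ≤ (d : ℝ) ^ (2 * d) := by
          rw [pow_mul]; exact pow_le_pow_left₀ (by norm_num) (by nlinarith) d
        have : 0 ≤ (d : ℝ) ^ (2 * d) := by positivity
        linarith
    unfold size
    push_cast
    calc (2 * (d : ℝ) * ⌈1 / ε⌉₊) ^ d ≤ (2 * (d : ℝ) * (2 / ε)) ^ d := by gcongr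
      _ = 4 ^ d * ((d : ℝ) / ε) ^ d := by rw [← mul_pow]; congr 1; ring
      _ ≤ 4 * (d : ℝ) ^ (2 * d) * ((d : ℝ) / ε) ^ d := by gcongr
      _ ≤ 4 * ((d : ℝ) / ε) ^ (2 * d) * ((d : ℝ) / ε) ^ d := by gcongr
      _ = _ := by rw [mul_assoc, ← pow_add]; congr 2; ring
  push_cast
  calc (size d ⌈1 / ε⌉₊ : ℝ) ^ 35 * ((n : ℝ) + 1) ^ 5 * (1 + ⌈Real.logb 2 (1 / δ)⌉₊)
      ≤ (4 * ((d : ℝ) / ε) ^ (3 * d)) ^ 35 * ((n : ℝ) + 1) ^ 5 * (2 * (1 + Real.log (1 / δ))) := by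
        gcongr
    _ = _ := by rw [mul_pow, ← pow_mul, show 3 * d * 35 = 105 * d by ring]; ring

end Size

/-! ### The learning algorithm -/

section Learner

/-- The learning algorithm: the parameters are computed by `p₀`, the records are drawn by `body`,
and the search is done by `p₁`. -/
def learner (p₀ body p₁ : Prog) : Prog :=
  .seq (.pair 3 2 3) (.seq (.pair 3 1 3) (.seq (.pair 0 0 3) (.seq p₀
    (.seq (.snd 1 0) (.seq (.fst 1 1) (.seq (.const 2 0) (.seq (.const 3 1) (.seq (collect body)
      (.seq (.fst 1 0) (.seq (.snd 0 0) (.seq (.pair 0 0 2) (.seq (.pair 0 1 0) p₁))))))))))))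

lemma Wp.learns {P : Prog} {n d B S : ℕ} {ε δ C : ℝ} {D : PMF (Fin n → Bool)} {q : ℝ}
    (h : Wp D (Config.start P n d ⌈1 / ε⌉₊ ⌈Real.logb 2 (1 / δ)⌉₊) B S
      (fun r => GoodOutput D d ε (r 0)) q) (hq : 1 - δ ≤ q) (hB : (B : ℝ) ≤ C) (hS : (S : ℝ) ≤ C) :
    Learns P D d ε δ C := by
  obtain ⟨t, h1, h2⟩ := h
  refine ⟨t, fun c hc => ?_, (ENNReal.ofReal_le_ofReal hq).trans h2⟩
  obtain ⟨h3, h4, h5⟩ := h1 c hc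
  simp only [Config.start, zero_add] at h4 h5
  exact ⟨h3, le_trans (by exact_mod_cast h4) hB, le_trans (by exact_mod_cast h5) hS⟩

lemma DrawsRecord.mono {n : ℕ} {D : PMF (Fin n → Bool)} {body : Prog} {M : Mean Record}
    {b b' σ σ' : ℕ} (h : DrawsRecord D body M b σ) (hb : b ≤ b') (hσ : σ ≤ σ') :
    DrawsRecord D body M b' σ' :=
  fun r k t s B S G Q hk => (h r k t s B S G Q hk).mono (by omega) (by omega)

/-- The run of the learning algorithm: `G` holds for the output with probability at least the
expectation of `Q`, if `Q` is at most the indicator function of this event. -/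
lemma wp_learner {p₀ body p₁ : Prog} {c₀ c₁ : ℕ}
    (h₀ : ∀ (p : Computes.TuneIndex) (r : ℕ → Val),
      r 0 = .pair (.num p.1) (.pair (.num p.2.1) (.pair (.num p.2.2.1) (.num p.2.2.2))) →
      ∃ r' τ, Exec p₀ r r' τ ∧ r' 0 = .pair (.pair (.num p.1) (.num p.2.1))
        (encParams (tuned p.1 p.2.1 p.2.2.1 p.2.2.2)) ∧ (∀ j < 0, r' j = r j) ∧
        τ ≤ c₀ * (tuneTime p.1 p.2.1 p.2.2.1 p.2.2.2 + 1))
    (h₁ : ∀ (p : {p : (ℕ × ℕ) × Params × List Record // p.2.2.length ≤ p.2.1.m}) (r : ℕ → Val),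
      r 0 = .pair (.pair (.num p.1.1.1) (.num p.1.1.2))
        (.pair (encParams p.1.2.1) (encList encRecord p.1.2.2)) →
      ∃ r' τ, Exec p₁ r r' τ ∧
        r' 0 = (best p.1.2.1 p.1.1.2 (p.1.2.2, (List.range p.1.1.1).reverse)).2 ∧
        (∀ j < 0, r' j = r j) ∧ τ ≤ c₁ * (searchTime p.1.1.1 p.1.1.2 p.1.2.1 + 1))
    {n d e L b σ : ℕ} {D : PMF (Fin n → Bool)} {M : Mean Record} (hbody : DrawsRecord D body M b σ)
    {G : Val → Prop} (Q : List Record → ℝ)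
    (hQ : ∀ data, data.length = (tuned n d e L).m → Q data ≤ 1 ∧
      (¬ G (best (tuned n d e L) d (data, (List.range n).reverse)).2 → Q data ≤ 0)) :
    Wp D (Config.start (learner p₀ body p₁) n d e L)
      (c₀ * (tuneTime n d e L + 1) + ((tuned n d e L).m * (b + 5)
        + c₁ * (searchTime n d (tuned n d e L) + 1) + 30)) ((tuned n d e L).m * σ)
      (fun r => G (r 0)) ((Mean.draws (List.replicate (tuned n d e L).m M) []).E Q) := by
  set r₀ := (Config.start (learner p₀ body p₁) n d e L).regs with hr₀
  obtain ⟨r1, τ1, e1, b1, -, t1⟩ := h₀ (n, d, e, L)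
    (Function.update (Function.update (Function.update r₀ 3 (.pair (r₀ 2) (r₀ 3))) 3
      (.pair (r₀ 1) (.pair (r₀ 2) (r₀ 3)))) 0 (.pair (r₀ 0) (.pair (r₀ 1) (.pair (r₀ 2) (r₀ 3)))))
    (by simp [hr₀, Config.start])
  dsimp only at b1 t1
  -- the search, for given records
  have hsearch : ∀ (data : List Record) (r : ℕ → Val) (t s : ℕ),
      r 0 = .pair (.pair (.num n) (.num d)) (encParams (tuned n d e L)) →
      r 2 = encList encRecord data → data.length = (tuned n d e L).m →
      Wp D ⟨[.seq (.fst 1 0) (.seq (.snd 0 0) (.seq (.pair 0 0 2) (.seq (.pair 0 1 0) p₁)))],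
          r, t, s⟩
        (c₁ * (searchTime n d (tuned n d e L) + 1) + 8) 0 (fun r => G (r 0)) (Q data) := by
    intro data r t s hr0 hr2 hlen
    obtain ⟨r2, τ2, e2, b2, -, t2⟩ := h₁ ⟨((n, d), tuned n d e L, data), hlen.le⟩
      (Function.update (Function.update (Function.update (Function.update r 1 (r 0).fst) 0
        (r 0).snd) 0 (.pair (r 0).snd (r 2))) 0 (.pair (r 0).fst (.pair (r 0).snd (r 2))))
      (by simp [hr0, hr2, Val.fst, Val.snd])
    dsimp only at b2 t2
    have x1 := Exec.fst 1 0 r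
    have x2 := Exec.snd 0 0 (Function.update r 1 (r 0).fst)
    have x3 := Exec.pair 0 0 2 (Function.update (Function.update r 1 (r 0).fst) 0 (r 0).snd)
    have x4 := Exec.pair 0 1 0 (Function.update (Function.update (Function.update r 1 (r 0).fst) 0
      (r 0).snd) 0 (.pair (r 0).snd (r 2)))
    simp only [Function.update_self, ne_eq, zero_ne_one, not_false_eq_true, Function.update_of_ne,
      OfNat.ofNat_ne_zero, OfNat.ofNat_ne_one, one_ne_zero] at x2 x3 x4
    refine (Wp.seq (Wp.exec x1 (Wp.seq (Wp.exec x2 (Wp.seq (Wp.exec x3 (Wp.seq (Wp.exec x4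
      (Wp.exec e2 (Wp.halt (hQ data hlen).1 fun h => (hQ data hlen).2 ?_)))))))))).mono
        (by omega) le_rfl
    rwa [b2] at h
  -- the collection of the records
  have hcollect : ∀ (r : ℕ → Val) (t s : ℕ),
      r 0 = .pair (.pair (.num n) (.num d)) (encParams (tuned n d e L)) →
      Wp D ⟨[.seq (.snd 1 0) (.seq (.fst 1 1) (.seq (.const 2 0) (.seq (.const 3 1)
          (.seq (collect body) (.seq (.fst 1 0) (.seq (.snd 0 0) (.seq (.pair 0 0 2)
            (.seq (.pair 0 1 0) p₁))))))))], r, t, s⟩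
        ((tuned n d e L).m * (b + 5) + c₁ * (searchTime n d (tuned n d e L) + 1) + 18)
        ((tuned n d e L).m * σ) (fun r => G (r 0))
        ((Mean.draws (List.replicate (tuned n d e L).m M) []).E Q) := by
    intro r t s hr0
    have x1 := Exec.snd 1 0 r
    have x2 := Exec.fst 1 1 (Function.update r 1 (r 0).snd)
    refine (Wp.seq (Wp.exec x1 (Wp.seq (Wp.exec x2 (Wp.seq (Wp.exec (Exec.const _ _ _)
      (Wp.seq (Wp.exec (Exec.const _ _ _) (Wp.seq (hbody.collect (tuned n d e L).m []
        _ _ _ _ _ 0 _ Q ?_ ?_ ?_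
        fun data r' t s hr0' hr2 hlen => hsearch data r' t s ?_ hr2 hlen)))))))))).mono
        (by omega) (by omega)
    · simp [hr0, encParams, Val.fst, Val.snd]
    · simp [encList]
    · simp
    · rw [hr0']
      simp [hr0]
  have x1 := Exec.pair 3 2 3 r₀
  have x2 := Exec.pair 3 1 3 (Function.update r₀ 3 (.pair (r₀ 2) (r₀ 3)))
  have x3 := Exec.pair 0 0 3 (Function.update (Function.update r₀ 3 (.pair (r₀ 2) (r₀ 3))) 3
      (.pair (r₀ 1) (.pair (r₀ 2) (r₀ 3))))
  simp only [Function.update_self, ne_eq, not_false_eq_true, Function.update_of_ne,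
    OfNat.zero_ne_ofNat, OfNat.one_ne_ofNat] at x2 x3
  exact (Wp.seq (Wp.exec x1 (Wp.seq (Wp.exec x2 (Wp.seq (Wp.exec x3 (Wp.seq (Wp.exec e1
    (hcollect r1 _ _ b1))))))))).mono (by omega) (by omega)

/-- A program that draws records whose statistics are unbiased estimates of the masses and of
edge weights gives rise to a learning algorithm. -/
theorem exists_learner {body : Prog} {c : ℕ}
    {M : ∀ {n : ℕ}, PMF (Fin n → Bool) → Mean Record}
    (hbody : ∀ {n : ℕ} (D : PMF (Fin n → Bool)),
      DrawsRecord D body (M D) (c * (n + 1) ^ 2) (n + 1)) :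
    ∃ P : Prog, (body.SamplesOnly → P.SamplesOnly) ∧ ∃ C : ℕ,
      ∀ (n d : ℕ) (ε δ : ℝ), 0 < ε → ε ≤ 1 → 0 < δ → δ ≤ 1 →
        ∀ (D : PMF (Fin n → Bool)) (h : Fin n → (Fin n → Bool) → ℝ),
          EdgeWeight (fun x => (D x).toReal) h → Unbiased (M D) (fun x => (D x).toReal) h →
          RepresentableByDepth D d → Learns P D d ε δ
            (C * ((n : ℝ) + 1) ^ C * ((d : ℝ) / ε) ^ (C * d) * (1 + Real.log (1 / δ))) := by
  obtain ⟨p₀, c₀, hp₀, h₀⟩ := Computes.tuned 0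
  obtain ⟨p₁, c₁, hp₁, h₁⟩ := Computes.search 0
  obtain ⟨b, hb⟩ : ∃ b : ℕ, (b : ℝ) = 14 * (2 * 4 ^ 35) := ⟨14 * (2 * 4 ^ 35), by norm_num⟩
  obtain ⟨C, hC⟩ : ∃ C, C = (10 * c₀ + c + c₁ + 40) * b + 105 := ⟨_, rfl⟩
  refine ⟨learner p₀ body p₁, fun hs => ⟨trivial, trivial, trivial, hp₀, trivial, trivial, trivial,
    trivial, ⟨hs, trivial, trivial⟩, trivial, trivial, trivial, trivial, hp₁⟩, C, ?_⟩
  intro n d ε δ hε hε1 hδ hδ1 D h hw hM hD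
  have hbound := bound_le (n := n) (d := d) hε hε1 hδ hδ1
  have heε : 1 / (⌈1 / ε⌉₊ : ℝ) ≤ ε := by
    rw [one_div]
    exact inv_le_of_inv_le₀ hε (by rw [← one_div]; exact Nat.le_ceil _)
  have he : 0 < ⌈1 / ε⌉₊ := Nat.ceil_pos.2 (by positivity)
  have hlog0 : 0 ≤ Real.log (1 / δ) := Real.log_nonneg (by rw [le_div_iff₀ hδ]; linarith)
  have hL : Real.log (1 / δ) ≤ ⌈Real.logb 2 (1 / δ)⌉₊ := by
    refine le_trans ?_ (Nat.le_ceil _)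
    rw [Real.logb, le_div_iff₀ (Real.log_pos (by norm_num))]
    nlinarith [Real.log_two_lt_d9]
  obtain ⟨Q, hQ, hQG⟩ := exists_indicator he heε hδ hL hD hM hw
  have htune := tuneTime_le (d := d) he n ⌈Real.logb 2 (1 / δ)⌉₊
  have hsearch := searchTime_le (d := d) he n ⌈Real.logb 2 (1 / δ)⌉₊
  have hm := m_mul_le_searchTime n d (tuned n d ⌈1 / ε⌉₊ ⌈Real.logb 2 (1 / δ)⌉₊)
  have hX : 1 + ⌈Real.logb 2 (1 / δ)⌉₊
      ≤ size d ⌈1 / ε⌉₊ ^ 35 * (n + 1) ^ 5 * (1 + ⌈Real.logb 2 (1 / δ)⌉₊) :=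
    Nat.le_mul_of_pos_left _ (by have := size_pos he d; positivity)
  set e := ⌈1 / ε⌉₊ with he_def
  set L := ⌈Real.logb 2 (1 / δ)⌉₊ with hL_def
  set X : ℕ := size d e ^ 35 * (n + 1) ^ 5 * (1 + L) with hX_def
  set P := tuned n d e L with hP
  -- the cost of one record, and of all of them
  have hrec : P.m * (c * (n + 1) ^ 2 + 5) ≤ (c + 5) * searchTime n d P := by
    calc P.m * (c * (n + 1) ^ 2 + 5) ≤ P.m * (c * (n + 1) ^ 2 + 5 * (n + 1) ^ 2) := by
          gcongr
          exact Nat.le_mul_of_pos_right _ (by positivity)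
      _ = (c + 5) * (P.m * (n + 1) ^ 2) := by ring
      _ ≤ _ := by gcongr
  have hsam : P.m * (n + 1) ≤ searchTime n d P :=
    le_trans (Nat.mul_le_mul_left _ (Nat.le_self_pow (by norm_num) _)) hm
  set B : ℕ := c₀ * (tuneTime n d e L + 1) + (P.m * (c * (n + 1) ^ 2 + 5)
    + c₁ * (searchTime n d P + 1) + 30) with hB
  have hBX : B ≤ (10 * c₀ + c + c₁ + 40) * (14 * X) := by
    have h1 : c₀ * (tuneTime n d e L + 1) ≤ c₀ * (10 * (14 * X)) := by gcongr; omega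
    have h2 : c₁ * (searchTime n d P + 1) ≤ c₁ * (14 * X) := by gcongr; omega
    have h3 : (c + 5) * searchTime n d P ≤ (c + 5) * (14 * X) := by gcongr; omega
    calc B ≤ c₀ * (10 * (14 * X)) + ((c + 5) * (14 * X) + c₁ * (14 * X) + 30 * X) := by omega
      _ ≤ c₀ * (10 * (14 * X)) + ((c + 5) * (14 * X) + c₁ * (14 * X) + 35 * (14 * X)) := by omega
      _ = _ := by ring
  have hXC : ∀ T : ℕ, T ≤ (10 * c₀ + c + c₁ + 40) * (14 * X) →
      (T : ℝ) ≤ C * ((n : ℝ) + 1) ^ C * ((d : ℝ) / ε) ^ (C * d) * (1 + Real.log (1 / δ)) := by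
    intro T hT
    have hC1 : ((10 * c₀ + c + c₁ + 40 : ℕ) : ℝ) * (14 * (2 * 4 ^ 35)) ≤ C := by
      rw [hC, ← hb]; push_cast; linarith
    have hC105 : 105 ≤ C := hC ▸ Nat.le_add_left _ _
    have hn : ((n : ℝ) + 1) ^ 5 ≤ ((n : ℝ) + 1) ^ C :=
      pow_le_pow_right₀ (by linarith [(Nat.cast_nonneg n : (0 : ℝ) ≤ n)]) (by omega)
    have hdε : ((d : ℝ) / ε) ^ (105 * d) ≤ ((d : ℝ) / ε) ^ (C * d) := by
      rcases Nat.eq_zero_or_pos d with rfl | hd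
      · simp
      · refine pow_le_pow_right₀ ?_ (Nat.mul_le_mul_right _ hC105)
        have : (1 : ℝ) ≤ d := by exact_mod_cast hd
        rw [le_div_iff₀ hε]; linarith
    calc (T : ℝ) ≤ ((10 * c₀ + c + c₁ + 40 : ℕ) : ℝ) * (14 * (X : ℝ)) := by exact_mod_cast hT
      _ ≤ ((10 * c₀ + c + c₁ + 40 : ℕ) : ℝ) * (14 * (2 * 4 ^ 35 * ((n : ℝ) + 1) ^ 5
          * ((d : ℝ) / ε) ^ (105 * d) * (1 + Real.log (1 / δ)))) := by gcongr
      _ = ((10 * c₀ + c + c₁ + 40 : ℕ) : ℝ) * (14 * (2 * 4 ^ 35)) * ((n : ℝ) + 1) ^ 5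
          * ((d : ℝ) / ε) ^ (105 * d) * (1 + Real.log (1 / δ)) := by ring
      _ ≤ _ := by gcongr
  refine Wp.learns (B := B) (S := P.m * (n + 1))
    (q := (Mean.draws (List.replicate P.m (M D)) []).E Q)
    ?_ hQ (hXC _ hBX) (hXC _ ?_)
  swap
  · refine hsam.trans (hsearch.trans ?_)
    calc 13 * X ≤ 1 * (14 * X) := by omega
      _ ≤ _ := Nat.mul_le_mul_right _ (by omega)
  exact wp_learner (fun i r => h₀ i r) (fun i r => h₁ i r) (hbody D) Q hQG

end Learner

end DTLearn

theorem mainTheorem2 :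
    (∃ P : DTLearn.Prog, P.SamplesOnly ∧ ∃ C : ℕ,
      ∀ (n d : ℕ) (ε δ : ℝ), 0 < ε → ε ≤ 1 → 0 < δ → δ ≤ 1 →
        ∀ D : PMF (Fin n → Bool), DTLearn.RepresentableByDepth D d → DTLearn.IsMonotone D →
          DTLearn.Learns P D d ε δ
            (C * ((n : ℝ) + 1) ^ C * ((d : ℝ) / ε) ^ (C * d) * (1 + Real.log (1 / δ)))) ∧
    (∃ P : DTLearn.Prog, ∃ C : ℕ,
      ∀ (n d : ℕ) (ε δ : ℝ), 0 < ε → ε ≤ 1 → 0 < δ → δ ≤ 1 →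
        ∀ D : PMF (Fin n → Bool), DTLearn.RepresentableByDepth D d →
          DTLearn.Learns P D d ε δ
            (C * ((n : ℝ) + 1) ^ C * ((d : ℝ) / ε) ^ (C * d) * (1 + Real.log (1 / δ)))) := by
  constructor
  · obtain ⟨P, hP, C, h⟩ := DTLearn.exists_learner (body := DTLearn.monoBody) (c := 3)
      (M := DTLearn.monoRecord) fun {n} D =>
        (DTLearn.drawsRecord_monoBody D).mono (by nlinarith) (by omega)
    exact ⟨P, hP ⟨trivial, trivial⟩, C, fun n d ε δ hε hε1 hδ hδ1 D hD hmono =>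
      h n d ε δ hε hε1 hδ hδ1 D _ (DTLearn.edgeWeight_mono _ fun _ => ENNReal.toReal_nonneg)
        (DTLearn.unbiased_monoRecord hmono) hD⟩
  · obtain ⟨body, c, hbody⟩ := DTLearn.exists_drawsRecord_condBody
    obtain ⟨P, -, C, h⟩ := DTLearn.exists_learner (body := body) (c := c)
      (M := DTLearn.condRecord) fun {n} D => hbody n D
    exact ⟨P, C, fun n d ε δ hε hε1 hδ hδ1 D hD =>
      h n d ε δ hε hε1 hδ hδ1 D _ (DTLearn.edgeWeight_cond _ fun _ => ENNReal.toReal_nonneg)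
        (DTLearn.unbiased_condRecord D) hD⟩
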